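/- **Setting.** Let $\mathcal M$ be the set of finite nonnegative Borel measures on $[0,\infty)$ with the Prohorov metric $$\mathbf d[m_1,m_2]=\inf\{\varepsilon>0:\ m_1(A)\le m_2(A^\varepsilon)+\varepsilon \text{ and } m_2(A)\le m_1(A^\varepsilon)+\varepsilon\text{ for all Borel } A\},\qquad A^\varepsilon=\{b:\inf_{a\in A}|a-b|<\varepsilon\},$$ and give $\mathcal M\times\mathcal M$ the maximum of the two distances. Write $\langle g,m\rangle=\int g\,dm$, $\chi(x)=x$, $A_y=(y,\infty)$. Let $K>0$ and $\lambda\geq 0$ be real numbers and let $\nu$ be a probability measure on $[0,\infty)$ with finite mean $\beta=\langle\chi,\nu\rangle<\infty$, with $\lambda\beta=1$, with $\nu(\{0\})=0$, and nonlattice (for no $d>0$ is $\nu$ concentrated on $\{0,d,2d,\dots\}$). Let $\nu_e$ be the measure with density $y\mapsto\nu((y,\infty))/\beta$ on $[0,\infty)$, let $\beta_e=\langle\chi,\nu_e\rangle\in(0,\infty]$, and for $w\in[0,\infty)$ put $$\Delta_{K,\nu}w=\Big(\frac{(w-K\beta_e)^+}{\beta}\,\nu,\ \frac{w\wedge K\beta_e}{\beta_e}\,\nu_e\Big),$$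 which is read as $(\mathbf 0,\mathbf 0)$ if $\beta_e=\infty$. A pair $(\xi,\mu)\in\mathcal M\times\mathcal M$ is a *valid initial condition* if $\xi=(\langle1,\xi\rangle+\langle1,\mu\rangle-K)^+\nu$, $\langle1,\mu\rangle=(\langle1,\xi\rangle+\langle1,\mu\rangle)\wedge K$ and $\mu(\{0\})=0$. A *solution of the fluid model $(K,\lambda,\nu)$* with valid initial condition $(\xi,\mu)$ is a function $(\mathcal B(\cdot),\mathcal S(\cdot)):[0,\infty)\to\mathcal M\times\mathcal M$, right-continuous with left limits, such that $(\mathcal B(0),\mathcal S(0))=(\xi,\mu)$, $\mathcal S(t)(\{0\})=0$ for all $t\ge 0$, and, with $$Q(t)=\langle1,\mathcal B(t)\rangle,\quad Z(t)=\langle1,\mathcal S(t)\rangle,\quad X=Q+Z,\quad B(t)=\lambda t-Q(t),\quad S(s,t)=\int_s^t\phi(Z(\tau))\,d\tau,$$ where $\phi(x)=1/x$ for $x>0$ and $\phi(0)=\infty$, the following hold for all $t,y\ge0$: $$\mathcal B(t)(A_y)=\xi(A_y)+(Q(t)-Q(0))\,\nu(A_y),$$ $$\mathcal S(t)(A_y)=\mu(A_y+S(0,t))+\int_{[0,t]}\nu(A_y+S(s,t))\,dB(s),$$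 $B$ is nondecreasing, $Q(t)=(X(t)-K)^+$ and $Z(t)=X(t)\wedge K$. Here the integral is a Lebesgue–Stieltjes integral with the convention $B(0-)=B(0)$, and $A_y+\infty=\emptyset$. **Theorem.** For every valid initial condition $(\xi,\mu)$ with $w=\langle\chi,\xi+\mu\rangle<\infty$, the fluid model has exactly one solution $(\mathcal B,\mathcal S)$ with this initial condition, and $$(\mathcal B(t),\mathcal S(t))\to\Delta_{K,\nu}w\qquad(t\to\infty)$$ in the Prohorov metric. Moreover, for all constants $p,M>0$ the convergence is uniform over all fluid solutions whose valid initial condition satisfies $\langle\chi,\xi+\mu\rangle<M$ and $\langle\chi^{1+p},\xi+\mu\rangle<M$: for every $\varepsilon>0$ there is $T\geq 0$ (depending only on $K,\lambda,\nu,p,M,\varepsilon$) such that $\mathbf d[(\mathcal B(t),\mathcal S(t)),\Delta_{K,\nu}\langle\chi,\xi+\mu\rangle]<\varepsilon$ for all such solutions and all $t\ge T$. -/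

import Mathlib

open MeasureTheory Set Filter Topology
open scoped NNReal ENNReal

namespace LPS

noncomputable section

/-- The space of finite nonnegative Borel measures on `[0, ∞)`. -/
abbrev FinMeas : Type := FiniteMeasure ℝ≥0

/-- Pairs (buffer measure, server measure), each factor with the Prohorov metric; the metric of the
product is the maximum of the two distances. -/
abbrev State : Type := LevyProkhorov FinMeas × LevyProkhorov FinMeas

def State.mk (ξ μ : FinMeas) : State := (.ofMeasure ξ, .ofMeasure μ)

def State.buffer (s : State) : FinMeas := s.1.toMeasure

def State.server (s : State) : FinMeas := s.2.toMeasure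

/-- `⟨χ, m⟩`, where `χ` is the identity. -/
def firstMoment (m : FinMeas) : ℝ≥0∞ := ∫⁻ x, (x : ℝ≥0∞) ∂(m : Measure ℝ≥0)

/-- `⟨χ ^ q, m⟩`. -/
def momentOfOrder (q : ℝ) (m : FinMeas) : ℝ≥0∞ := ∫⁻ x, (x : ℝ≥0∞) ^ q ∂(m : Measure ℝ≥0)

/-- `β`, the mean of the job size distribution. -/
def meanSize (ν : ProbabilityMeasure ℝ≥0) : ℝ≥0∞ := firstMoment ν.toFiniteMeasure

/-- `ν` is nonlattice: it is not concentrated on `{0, d, 2d, …}` for any span `d > 0`. -/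
def Nonlattice (ν : ProbabilityMeasure ℝ≥0) : Prop :=
  ∀ d : ℝ≥0, 0 < d → (ν : Measure ℝ≥0) (range fun n : ℕ => (n : ℝ≥0) * d)ᶜ ≠ 0

/-- Lebesgue measure on `[0, ∞)`. -/
def lebesgue : Measure ℝ≥0 := (volume : Measure ℝ).comap ((↑) : ℝ≥0 → ℝ)

theorem measurableEmbedding_coe : MeasurableEmbedding ((↑) : ℝ≥0 → ℝ) :=
  MeasurableEmbedding.subtype_coe measurableSet_Ici

theorem lebesgue_Iio (x : ℝ≥0) : lebesgue (Iio x) = x := by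
  rw [lebesgue, measurableEmbedding_coe.comap_apply]
  have h : ((↑) : ℝ≥0 → ℝ) '' Iio x = Ico 0 (x : ℝ) := by
    ext r
    constructor
    · rintro ⟨y, hy, rfl⟩
      exact ⟨y.2, by exact_mod_cast hy⟩
    · rintro ⟨h0, h1⟩
      exact ⟨⟨r, h0⟩, h1, rfl⟩
  rw [h, Real.volume_Ico, sub_zero, ENNReal.ofReal_coe_nnreal]

instance : IsLocallyFiniteMeasure lebesgue :=
  ⟨fun x => ⟨Iio (x + 1), Iio_mem_nhds (lt_add_of_pos_right x one_pos), by
    rw [lebesgue_Iio]; exact ENNReal.coe_lt_top⟩⟩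

theorem lintegral_tail (ν : Measure ℝ≥0) [SFinite ν] :
    ∫⁻ y, ν (Ioi y) ∂lebesgue = ∫⁻ x, (x : ℝ≥0∞) ∂ν := by
  have hs : MeasurableSet {p : ℝ≥0 × ℝ≥0 | p.1 < p.2} :=
    measurableSet_lt measurable_fst measurable_snd
  have h1 := Measure.prod_apply (μ := lebesgue) (ν := ν) hs
  have h2 := Measure.prod_apply_symm (μ := lebesgue) (ν := ν) hs
  calc ∫⁻ y, ν (Ioi y) ∂lebesgue = (lebesgue.prod ν) {p : ℝ≥0 × ℝ≥0 | p.1 < p.2} := h1.symm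
    _ = ∫⁻ x, lebesgue (Iio x) ∂ν := h2
    _ = ∫⁻ x, (x : ℝ≥0∞) ∂ν := by simp_rw [lebesgue_Iio]

theorem measurable_tail (ν : Measure ℝ≥0) : Measurable fun y : ℝ≥0 => ν (Ioi y) :=
  Antitone.measurable fun _ _ h => measure_mono (Ioi_subset_Ioi h)

/-- The equilibrium measure `ν_e` of `ν`: the measure on `[0, ∞)` with Lebesgue density
`y ↦ ν((y, ∞)) / β`. -/
def equilibriumMeasure (ν : ProbabilityMeasure ℝ≥0) : FinMeas :=
  ⟨lebesgue.withDensity fun y => (ν : Measure ℝ≥0) (Ioi y) / meanSize ν, by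
    refine isFiniteMeasure_withDensity ?_
    simp_rw [div_eq_mul_inv]
    rw [lintegral_mul_const _ (measurable_tail _), lintegral_tail, mul_comm]
    exact ((ENNReal.inv_mul_le_one (meanSize ν)).trans_lt ENNReal.one_lt_top).ne⟩

/-- `β_e`, the mean of the equilibrium measure; it may be infinite. -/
def equilibriumMean (ν : ProbabilityMeasure ℝ≥0) : ℝ≥0∞ := firstMoment (equilibriumMeasure ν)

/-- The lifting map `Δ_{K,ν} w = ((w - K β_e)⁺ / β • ν, (w ∧ K β_e) / β_e • ν_e)`. The coefficients
are computed in `[0, ∞]`, where subtraction is truncated at `0`; if `β_e = ∞` (and `K > 0`) both are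
`0`. -/
def lift (K : ℝ≥0) (ν : ProbabilityMeasure ℝ≥0) (w : ℝ≥0) : State :=
  State.mk
    (((w - K * equilibriumMean ν) / meanSize ν).toNNReal • ν.toFiniteMeasure)
    ((min (w : ℝ≥0∞) (K * equilibriumMean ν) / equilibriumMean ν).toNNReal • equilibriumMeasure ν)

/-- Valid initial conditions `(ξ, μ)`: `ξ = (⟨1,ξ⟩ + ⟨1,μ⟩ - K)⁺ ν`, `⟨1,μ⟩ = (⟨1,ξ⟩ + ⟨1,μ⟩) ∧ K`,
and no mass in service has residual size `0`. -/
structure IsValid (K : ℝ≥0) (ν : ProbabilityMeasure ℝ≥0) (ξ μ : FinMeas) : Prop where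
  buffer_eq : ξ = (ξ.mass + μ.mass - K) • ν.toFiniteMeasure
  server_mass : μ.mass = min (ξ.mass + μ.mass) K
  server_zero : μ {0} = 0

/-- Right-continuous with left limits (in the space of states). -/
def IsCadlag (Ψ : ℝ≥0 → State) : Prop :=
  (∀ t, ContinuousWithinAt Ψ (Ici t) t) ∧ ∀ t, 0 < t → ∃ l, Tendsto Ψ (𝓝[<] t) (𝓝 l)

/-- `Q(t)`, the mass in the buffer. -/
def Q (Ψ : ℝ≥0 → State) (t : ℝ≥0) : ℝ≥0 := (Ψ t).buffer.mass

/-- `Z(t)`, the mass in service. -/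
def Z (Ψ : ℝ≥0 → State) (t : ℝ≥0) : ℝ≥0 := (Ψ t).server.mass

/-- `X(t) = Q(t) + Z(t)`. -/
def X (Ψ : ℝ≥0 → State) (t : ℝ≥0) : ℝ≥0 := Q Ψ t + Z Ψ t

/-- `B(t) = λ t - Q(t)`. -/
def B (lam : ℝ≥0) (Ψ : ℝ≥0 → State) (t : ℝ≥0) : ℝ := lam * t - Q Ψ t

/-- `S(s,t) = ∫ₛᵗ φ(Z(τ)) dτ` with `φ(x) = 1/x` for `x > 0` and `φ(0) = ∞`. -/
def S (Ψ : ℝ≥0 → State) (s t : ℝ≥0) : ℝ≥0∞ := ∫⁻ τ in Ioc s t, (Z Ψ τ : ℝ≥0∞)⁻¹ ∂lebesgue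

/-- The set `A_y + a`, where `A_y = (y, ∞)`; it is empty if `a = ∞`. -/
def shiftedTail (y : ℝ≥0) (a : ℝ≥0∞) : Set ℝ≥0 := {x | (y : ℝ≥0∞) + a < x}

/-- `Ψ` is a solution, with initial condition `(ξ, μ)`, to the fluid model `(K, λ, ν)` (in the
critically loaded case). The integral `∫₀ᵗ … dB(s)` is taken over `[0, t]` against the
Lebesgue–Stieltjes measure of `B`, which gives `{0}` mass zero because `B(0-) = B(0)`; as `B` is
right-continuous, `mono.stieltjesFunction` is `B` itself. -/
structure IsFluidSolution (K lam : ℝ≥0) (ν : ProbabilityMeasure ℝ≥0) (ξ μ : FinMeas)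
    (Ψ : ℝ≥0 → State) : Prop where
  cadlag : IsCadlag Ψ
  init : Ψ 0 = State.mk ξ μ
  server_zero : ∀ t, (Ψ t).server {0} = 0
  buffer_dynamics : ∀ t y, ((Ψ t).buffer (Ioi y) : ℝ) =
    ξ (Ioi y) + ((Q Ψ t : ℝ) - Q Ψ 0) * ν (Ioi y)
  mono : Monotone (B lam Ψ)
  server_dynamics : ∀ t y, ((Ψ t).server : Measure ℝ≥0) (Ioi y) =
    (μ : Measure ℝ≥0) (shiftedTail y (S Ψ 0 t)) +
      ∫⁻ s in Iic t, (ν : Measure ℝ≥0) (shiftedTail y (S Ψ s t)) ∂mono.stieltjesFunction.measure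
  policy_buffer : ∀ t, Q Ψ t = X Ψ t - K
  policy_server : ∀ t, Z Ψ t = min (X Ψ t) K

end

end LPS

namespace LPS

/-! In the time scale u = S(0,t) of the clock every job in service is worked on at unit rate. Let
x(u) be the total mass at clock time u and G = ξ + μ. An integration by parts turns the fluid
equations into the closed nonlinear renewal equation x(u) = G((u,∞)) + ∫₀ᵘ (x(u-v)-K)⁺ dν(v) + ∫₀ᵘ
(x(u-v)∧K) dν_e(v) (`tail_formula`, `clockSolution_of`). Because λβ = 1, both kernels are
probability measures, and the two nonlinearities add up to the identity.

Limit. Integrating the renewal equation gives a conservation law (`RenewalSolution.conservation`),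
which says that work is preserved: if x tends to X, then (X-K)⁺β + (X∧K)β_e = w, and the left side
is strictly increasing in X. To get convergence, let Y be the upper limit of x. At a late time when
x is near Y, the equation forces x to be near Y at earlier times too, one increment from the support
of the active kernel back (`propagate_upper`). That kernel is not lattice, so sums of such
increments become dense and x is near Y on arbitrarily long windows (`exists_window`). Conservation
over such a window shows that Y carries at most the work w (`limsup_workload_le`). The lower limit
is treated symmetrically (`le_liminf_workload`), and strict monotonicity identifies both limits
(`tendsto_renewal`). If β_e = ∞, the upper estimate alone gives Y = 0. The server measure then
converges by its own convolution formula (`tendsto_profile`).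

Uniformity. All limits are taken along L ×ˢ atTop for a family of solutions indexed by a filter L. A
failure of uniformity would produce a sequence of solutions with convergent workloads; the moment of
order 1 + p makes their tails uniformly small, and the family version `tendsto_fluid` gives a
contradiction.

Existence and uniqueness. Workload is conserved while the clock is finite, and this excludes an
explosion of the clock when w > 0 (`IsFluidSolution.S_ne_top`); when w = 0 the solution is zero. A
solution with w > 0 is determined by x, and the renewal equation has one solution
(`RenewalSolution.unique`). For existence, Picard iteration in an exponentially weighted norm yields
mass and input in clock time (`exists_mass_input`), real time is recovered as ∫ (x∧K), and the
server measures are residuals of a fixed measure of (arrival, departure) pairs, which makes the path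
càdlàg. -/

/-! ### Lebesgue measure on the half-line: reflection, convolution, change of variables. -/

theorem lebesgue_Ioc (a b : ℝ≥0) : lebesgue (Ioc a b) = (b - a : ℝ≥0) := by
  rw [lebesgue, measurableEmbedding_coe.comap_apply]
  have h : ((↑) : ℝ≥0 → ℝ) '' Ioc a b = Ioc (a : ℝ) b := by
    ext r
    constructor
    · rintro ⟨y, hy, rfl⟩
      exact ⟨by exact_mod_cast hy.1, by exact_mod_cast hy.2⟩
    · rintro ⟨h0, h1⟩
      exact ⟨⟨r, a.2.trans h0.le⟩, ⟨h0, h1⟩, rfl⟩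
  rw [h, Real.volume_Ioc, ENNReal.ofReal]
  rfl

instance : NullSingletonClass lebesgue :=
  ⟨fun x => by
    rw [lebesgue, measurableEmbedding_coe.comap_apply, image_singleton, Real.volume_singleton]⟩

theorem lebesgue_Iic (x : ℝ≥0) : lebesgue (Iic x) = x := by
  rw [← lebesgue_Iio, measure_congr Iio_ae_eq_Iic]

theorem lebesgue_Icc (a b : ℝ≥0) : lebesgue (Icc a b) = (b - a : ℝ≥0) := by
  rw [← lebesgue_Ioc, measure_congr Ioc_ae_eq_Icc]

instance : SigmaFinite lebesgue := inferInstance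

/-- Reflection of Lebesgue measure on an initial interval. -/
theorem lintegral_Iic_reflect (U : ℝ≥0) {f : ℝ≥0 → ℝ≥0∞} (hf : Measurable f) :
    ∫⁻ s in Iic U, f (U - s) ∂lebesgue = ∫⁻ s in Iic U, f s ∂lebesgue := by
  have hfin : IsFiniteMeasure (lebesgue.restrict (Iic U)) :=
    ⟨by rw [Measure.restrict_apply_univ, lebesgue_Iic]; exact ENNReal.coe_lt_top⟩
  have hm : Measurable fun s : ℝ≥0 => U - s := by fun_prop
  have key : (lebesgue.restrict (Iic U)).map (fun s => U - s) = lebesgue.restrict (Iic U) := by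
    refine Measure.ext_of_Iic _ _ fun a => ?_
    rw [Measure.map_apply hm measurableSet_Iic,
      Measure.restrict_apply (hm measurableSet_Iic), Measure.restrict_apply measurableSet_Iic,
      Iic_inter_Iic]
    have : (fun s => U - s) ⁻¹' Iic a ∩ Iic U = Icc (U - a) U := by
      ext s
      simp only [mem_inter_iff, mem_preimage, mem_Iic, mem_Icc, tsub_le_iff_right, add_comm]
    rw [this, lebesgue_Icc, lebesgue_Iic]
    congr 1
    rcases le_total a U with h | h
    · rw [tsub_tsub_cancel_of_le h, min_eq_left h]
    · rw [tsub_eq_zero_of_le h, tsub_zero, min_eq_right h]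
  conv_rhs => rw [← key]
  rw [lintegral_map hf hm]

/-- Translation of Lebesgue measure. -/
theorem lintegral_Icc_translate {v U : ℝ≥0} {f : ℝ≥0 → ℝ≥0∞} (hf : Measurable f) :
    ∫⁻ u in Icc v U, f (u - v) ∂lebesgue = ∫⁻ s in Iic (U - v), f s ∂lebesgue := by
  have hfin : IsFiniteMeasure (lebesgue.restrict (Icc v U)) :=
    ⟨by rw [Measure.restrict_apply_univ, lebesgue_Icc]; exact ENNReal.coe_lt_top⟩
  have hm : Measurable fun s : ℝ≥0 => s - v := by fun_prop
  have key : (lebesgue.restrict (Icc v U)).map (fun s => s - v) =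
      lebesgue.restrict (Iic (U - v)) := by
    refine Measure.ext_of_Iic _ _ fun a => ?_
    rw [Measure.map_apply hm measurableSet_Iic,
      Measure.restrict_apply (hm measurableSet_Iic), Measure.restrict_apply measurableSet_Iic,
      Iic_inter_Iic]
    have : (fun s => s - v) ⁻¹' Iic a ∩ Icc v U = Icc v (min (a + v) U) := by
      ext s
      simp only [mem_inter_iff, mem_preimage, mem_Iic, mem_Icc, tsub_le_iff_right, le_min_iff]
      tauto
    rw [this, lebesgue_Icc, lebesgue_Iic]
    congr 1
    rcases le_total (a + v) U with h | h
    · rw [min_eq_left h, add_tsub_cancel_right, min_eq_left (le_tsub_of_add_le_right h)]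
    · rw [min_eq_right h, min_eq_right (tsub_le_iff_right.2 h)]
  rw [← key, lintegral_map hf hm]

/-- Integral over an initial interval of a convolution. -/
theorem lintegral_convolution (n : Measure ℝ≥0) [IsFiniteMeasure n] {f : ℝ≥0 → ℝ≥0∞}
    (hf : Measurable f) (U : ℝ≥0) :
    ∫⁻ u in Iic U, ∫⁻ v in Iic u, f (u - v) ∂n ∂lebesgue =
      ∫⁻ s in Iic U, f (U - s) * n (Iic s) ∂lebesgue := by
  have hle : MeasurableSet {p : ℝ≥0 × ℝ≥0 | p.2 ≤ p.1} :=
    measurableSet_le measurable_snd measurable_fst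
  have swap (g : ℝ≥0 → ℝ≥0 → ℝ≥0∞) (hg : Measurable (Function.uncurry g)) :
      ∫⁻ u in Iic U, ∫⁻ v in Iic u, g u v ∂n ∂lebesgue =
        ∫⁻ v in Iic U, ∫⁻ u in Icc v U, g u v ∂lebesgue ∂n := by
    have e1 : ∀ u, ∫⁻ v in Iic u, g u v ∂n =
        ∫⁻ v, {p : ℝ≥0 × ℝ≥0 | p.2 ≤ p.1}.indicator (Function.uncurry g) (u, v) ∂n := fun u => by
      rw [← lintegral_indicator measurableSet_Iic]; rfl
    simp_rw [e1]
    rw [lintegral_lintegral_swap (f := fun u v => {p : ℝ≥0 × ℝ≥0 | p.2 ≤ p.1}.indicator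
      (Function.uncurry g) (u, v)) (hg.indicator hle).aemeasurable,
      ← lintegral_indicator measurableSet_Iic]
    refine lintegral_congr fun v => ?_
    by_cases hv : v ≤ U
    · rw [indicator_of_mem (by exact hv), ← lintegral_indicator measurableSet_Icc,
        ← lintegral_indicator measurableSet_Iic]
      refine lintegral_congr fun u => ?_
      simp only [indicator, mem_Iic, mem_ofPred_eq, mem_Icc, Function.uncurry]
      by_cases h1 : u ≤ U <;> by_cases h2 : v ≤ u <;> simp [h1, h2]
    · rw [indicator_of_notMem (by exact hv), ← lintegral_indicator measurableSet_Iic]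
      refine (lintegral_eq_zero_iff' ?_).2 ?_
      · refine Measurable.aemeasurable ?_
        exact ((hg.indicator hle).comp measurable_prodMk_right).indicator measurableSet_Iic
      · refine Eventually.of_forall fun u => ?_
        simp only [indicator, mem_Iic, mem_ofPred_eq, Pi.zero_apply]
        by_cases h1 : u ≤ U
        · simp [not_le.2 (h1.trans_lt (not_le.1 hv))]
        · simp [h1]
  rw [swap (fun u v => f (u - v)) (hf.comp (f := fun p : ℝ≥0 × ℝ≥0 => p.1 - p.2) (by fun_prop))]
  -- Writing the distribution function as an integral turns the right side into a double integral
  -- over the same triangle. The inner integrals over [v, U] then agree by reflection.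
  have e2 : ∀ s, f (U - s) * n (Iic s) = ∫⁻ _ in Iic s, f (U - s) ∂n := fun s => by
    rw [lintegral_const, Measure.restrict_apply_univ]
  simp_rw [e2]
  rw [swap (fun s _ => f (U - s)) (hf.comp (f := fun p : ℝ≥0 × ℝ≥0 => U - p.1) (by fun_prop))]
  refine setLIntegral_congr_fun measurableSet_Iic fun v hv => ?_
  rw [lintegral_Icc_translate hf,
    ← lintegral_Iic_reflect (U - v) hf, ← lintegral_Icc_translate
      (f := fun s => f (U - v - s)) (hf.comp (by fun_prop))]
  refine setLIntegral_congr_fun measurableSet_Icc fun u hu => ?_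
  rw [tsub_tsub, add_tsub_cancel_of_le hu.1]

/-- Integration by parts for the convolution of a tail with a measure. -/
theorem lintegral_tail_add_lintegral_cdf (n m : Measure ℝ≥0) [IsFiniteMeasure n]
    [SFinite m] (y u : ℝ≥0) :
    ∫⁻ v in Iic u, n (Ioi (y + (u - v))) ∂m + ∫⁻ r in Ioc y (y + u), m (Iic (y + u - r)) ∂n =
      m (Iic u) * n (Ioi y) := by
  have hs : MeasurableSet {p : ℝ≥0 × ℝ≥0 | y + (u - p.1) < p.2} :=
    measurableSet_lt (by fun_prop) measurable_snd
  have h1 := Measure.prod_apply (μ := m.restrict (Iic u)) (ν := n) hs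
  have h2 := Measure.prod_apply_symm (μ := m.restrict (Iic u)) (ν := n) hs
  have e1 : ∫⁻ v in Iic u, n (Ioi (y + (u - v))) ∂m =
      ∫⁻ r, (m.restrict (Iic u)) {v | y + (u - v) < r} ∂n := h1.symm.trans h2
  rw [e1, ← lintegral_indicator measurableSet_Ioc, ← lintegral_add_left (by
    exact measurable_measure_prodMk_right hs)]
  have e3 : m (Iic u) * n (Ioi y) = ∫⁻ r, (Ioi y).indicator (fun _ => m (Iic u)) r ∂n := by
    rw [lintegral_indicator measurableSet_Ioi, lintegral_const, Measure.restrict_apply_univ]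
  rw [e3]
  refine lintegral_congr fun r => ?_
  have hms : MeasurableSet {v : ℝ≥0 | y + (u - v) < r} :=
    measurableSet_lt (by fun_prop) measurable_const
  rw [Measure.restrict_apply hms]
  by_cases hr : y < r
  · rw [indicator_of_mem (s := Ioi y) hr]
    -- For y < r ≤ y + u the points v ≤ u split at y + u - r between the two integrals. For r > y +
    -- u every v ≤ u belongs to the first one.
    by_cases hr2 : r ≤ y + u
    · rw [indicator_of_mem (s := Ioc y (y + u)) ⟨hr, hr2⟩, ← measure_union]
      · congr 1
        ext v
        simp only [mem_union, mem_inter_iff, mem_ofPred_eq, mem_Iic]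
        constructor
        · rintro (h | h)
          · exact h.2
          · exact h.trans (tsub_le_iff_right.2 (by rw [add_comm u r]; gcongr))
        · intro hv
          by_cases hvr : v ≤ y + u - r
          · exact Or.inr hvr
          · refine Or.inl ⟨?_, hv⟩
            rw [not_le, tsub_lt_iff_right hr2] at hvr
            rw [← add_tsub_assoc_of_le hv, tsub_lt_iff_right (hv.trans le_add_self), add_comm r v]
            exact hvr
      · rw [Set.disjoint_left]
        rintro v ⟨hv1, hv2⟩ hv3
        simp only [mem_ofPred_eq, mem_Iic] at hv1 hv2 hv3
        rw [← add_tsub_assoc_of_le hv2, tsub_lt_iff_right (hv2.trans le_add_self)] at hv1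
        rw [le_tsub_iff_right hr2, add_comm v r] at hv3
        exact absurd hv1 (not_lt.2 hv3)
      · exact measurableSet_Iic
    · rw [indicator_of_notMem (s := Ioc y (y + u)) (fun h => hr2 h.2), add_zero]
      congr 1
      refine inter_eq_right.2 fun v _ => ?_
      exact (add_le_add_right tsub_le_self y).trans_lt (not_le.1 hr2)
  · rw [indicator_of_notMem (s := Ioi y) hr,
      indicator_of_notMem (s := Ioc y (y + u)) (fun h => hr h.1), add_zero]
    have : {v : ℝ≥0 | y + (u - v) < r} = ∅ := by
      ext v
      simp only [mem_ofPred_eq, mem_empty_iff_false, iff_false, not_lt]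
      exact (not_lt.1 hr).trans le_self_add
    rw [this, empty_inter, measure_empty]

/-- Change of variables along an increasing bijection with a density. -/
theorem lintegral_Iic_comp_orderIso (σ : ℝ≥0 ≃o ℝ≥0) {f : ℝ≥0 → ℝ≥0∞} (hf : Measurable f)
    (hσ : ∀ t, (σ t : ℝ≥0∞) = ∫⁻ s in Iic t, f s ∂lebesgue) {g : ℝ≥0 → ℝ≥0∞} (hg : Measurable g)
    (t : ℝ≥0) :
    ∫⁻ s in Iic t, f s * g (σ s) ∂lebesgue = ∫⁻ u in Iic (σ t), g u ∂lebesgue := by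
  have hm : Measurable σ := σ.continuous.measurable
  have hfin : IsFiniteMeasure (lebesgue.restrict (Iic (σ t))) :=
    ⟨by rw [Measure.restrict_apply_univ, lebesgue_Iic]; exact ENNReal.coe_lt_top⟩
  have key : ((lebesgue.restrict (Iic t)).withDensity f).map σ = lebesgue.restrict (Iic (σ t)) := by
    symm
    refine Measure.ext_of_Iic _ _ fun a => ?_
    rw [Measure.map_apply hm measurableSet_Iic,
      withDensity_apply _ (hm measurableSet_Iic), Measure.restrict_apply measurableSet_Iic,
      Measure.restrict_restrict (hm measurableSet_Iic), Iic_inter_Iic, lebesgue_Iic]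
    have : σ ⁻¹' Iic a ∩ Iic t = Iic (min (σ.symm a) t) := by
      ext s
      simp [OrderIso.le_symm_apply]
    rw [this, ← hσ, σ.monotone.map_min, σ.apply_symm_apply]
  rw [← key, lintegral_map hg hm]
  exact (lintegral_withDensity_eq_lintegral_mul _ hf (hg.comp hm)).symm

/-! ### Prohorov distance: couplings, grids and tails. -/

/-- Prohorov distance between two images of restrictions of the same measure. -/
theorem levyProkhorovEDist_map_restrict_le {Ω : Type*} [MeasurableSpace Ω] (ρ : Measure Ω)
    {E E' : Set Ω} (hE : MeasurableSet E) (hE' : MeasurableSet E') {f f' : Ω → ℝ≥0}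
    (hf : Measurable f) (hf' : Measurable f') (η : ℝ≥0∞)
    (hff : ∀ ω ∈ E ∪ E', edist (f ω) (f' ω) ≤ η) (h1 : ρ (E \ E') ≤ η) (h2 : ρ (E' \ E) ≤ η) :
    levyProkhorovEDist ((ρ.restrict E).map f) ((ρ.restrict E').map f') ≤ η := by
  -- The common part of E and E' is a coupling that moves points by at most η; the mass of E \ E'
  -- goes into the additive error.
  have half {E E' : Set Ω} (hE : MeasurableSet E) (hE' : MeasurableSet E') {f f' : Ω → ℝ≥0}
      (hf : Measurable f) (hf' : Measurable f') (hff : ∀ ω ∈ E, edist (f ω) (f' ω) ≤ η)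
      (h1 : ρ (E \ E') ≤ η) (ε : ℝ≥0∞) (A : Set ℝ≥0) (hε : η < ε) (hε' : ε < ∞)
      (hA : MeasurableSet A) : ((ρ.restrict E).map f) A ≤
        ((ρ.restrict E').map f') (Metric.thickening ε.toReal A) + ε := by
    have hT : MeasurableSet (Metric.thickening ε.toReal A) := Metric.isOpen_thickening.measurableSet
    rw [Measure.map_apply hf hA, Measure.map_apply hf' hT, Measure.restrict_apply (hf hA),
      Measure.restrict_apply (hf' hT)]
    refine (measure_mono (t := (f' ⁻¹' Metric.thickening ε.toReal A ∩ E') ∪ (E \ E')) ?_).trans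
      ((measure_union_le _ _).trans (add_le_add le_rfl (h1.trans hε.le)))
    rintro ω ⟨hω, hωE⟩
    by_cases h : ω ∈ E'
    · refine Or.inl ⟨?_, h⟩
      rw [mem_preimage, Metric.mem_thickening_iff_exists_edist_lt]
      refine ⟨f ω, hω, ?_⟩
      rw [ENNReal.ofReal_toReal hε'.ne, edist_comm]
      exact (hff ω hωE).trans_lt hε
    · exact Or.inr ⟨hωE, h⟩
  refine levyProkhorovEDist_le_of_forall _ _ _ fun ε A hε hε' hA => ⟨?_, ?_⟩
  · exact half hE hE' hf hf' (fun ω h => hff ω (Or.inl h)) h1 ε A hε hε' hA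
  · exact half hE' hE hf' hf (fun ω h => by rw [edist_comm]; exact hff ω (Or.inr h)) h2 ε A hε hε' hA

/-- Comparison of two measures that nearly agree on the cells of a grid of width `h`. -/
theorem measure_le_thickening_of_cells {m₁ m₂ : Measure ℝ≥0} {h : ℝ≥0} {N : ℕ} {ε δ η : ℝ≥0∞}
    (hh : 0 < h) (hε : (h : ℝ≥0∞) < ε) (hε' : ε < ∞) (h0 : m₁ {0} = 0)
    (hcell : ∀ j < N, m₁ (Ioc (j * h) ((j + 1) * h)) ≤ m₂ (Ioc (j * h) ((j + 1) * h)) + δ)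
    (htail : m₁ (Ioi (N * h)) ≤ η) (hsum : N * δ + η ≤ ε) (A : Set ℝ≥0) :
    m₁ A ≤ m₂ (Metric.thickening ε.toReal A) + ε := by
  classical
  let C : ℕ → Set ℝ≥0 := fun j => Ioc (j * h) ((j + 1) * h)
  -- Only cells that meet A matter. Each lies in the ε-thickening of A because h < ε, and at most N
  -- of them cost δ each. The half-open cells miss 0, hence the separate assumption there.
  let J : Finset ℕ := (Finset.range N).filter fun j => (C j ∩ A).Nonempty
  have hcover : A ⊆ {0} ∪ ((⋃ j ∈ J, C j) ∪ Ioi (N * h)) := by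
    intro x hx
    rcases eq_or_ne x 0 with rfl | hx0
    · exact Or.inl rfl
    refine Or.inr ?_
    by_cases hxN : N * h < x
    · exact Or.inr hxN
    refine Or.inl ?_
    have hxpos : 0 < x := pos_iff_ne_zero.2 hx0
    obtain ⟨j, hj⟩ : ∃ j : ℕ, x ∈ C j := by
      have hc : 0 < ⌈x / h⌉₊ := Nat.ceil_pos.2 (div_pos hxpos hh)
      refine ⟨⌈x / h⌉₊ - 1, ?_, ?_⟩
      · rw [← lt_div_iff₀ hh]
        exact Nat.lt_ceil.1 (Nat.sub_lt hc one_pos)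
      · rw [← div_le_iff₀ hh]
        have : ((⌈x / h⌉₊ - 1 : ℕ) : ℝ≥0) + 1 = ⌈x / h⌉₊ := by
          exact_mod_cast Nat.succ_pred_eq_of_pos hc
        rw [this]
        exact Nat.le_ceil _
    refine mem_iUnion₂.2 ⟨j, Finset.mem_filter.2 ⟨Finset.mem_range.2 ?_, x, hj, hx⟩, hj⟩
    by_contra hjN
    have : (N : ℝ≥0) ≤ j := by exact_mod_cast not_lt.1 hjN
    exact hxN ((mul_le_mul_left this h).trans_lt hj.1)
  have hdisj : (J : Set ℕ).PairwiseDisjoint C := by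
    have hlt : ∀ i j : ℕ, i < j → Disjoint (C i) (C j) := fun i j hij => by
      rw [Set.disjoint_left]
      rintro x ⟨_, h1⟩ ⟨h2, _⟩
      have : ((i : ℝ≥0) + 1) ≤ j := by exact_mod_cast hij
      exact absurd (h1.trans (mul_le_mul_left this h)) (not_le.2 h2)
    intro i _ j _ hij
    rcases lt_or_gt_of_ne hij with h | h
    · exact hlt i j h
    · exact (hlt j i h).symm
  have hthick : (⋃ j ∈ J, C j) ⊆ Metric.thickening ε.toReal A := by
    intro x hx
    obtain ⟨j, hj, hxj⟩ := mem_iUnion₂.1 hx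
    obtain ⟨a, haC, haA⟩ := (Finset.mem_filter.1 hj).2
    rw [Metric.mem_thickening_iff]
    refine ⟨a, haA, ?_⟩
    have hhe : (h : ℝ) < ε.toReal := by
      have := (ENNReal.toReal_lt_toReal ENNReal.coe_ne_top hε'.ne).2 hε
      simpa using this
    have c1 : (j * h : ℝ) < x := by exact_mod_cast hxj.1
    have c2 : (x : ℝ) ≤ (j + 1) * h := by exact_mod_cast hxj.2
    have c3 : (j * h : ℝ) < a := by exact_mod_cast haC.1
    have c4 : (a : ℝ) ≤ (j + 1) * h := by exact_mod_cast haC.2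
    rw [NNReal.dist_eq, abs_lt]
    constructor <;> nlinarith
  calc m₁ A ≤ m₁ {0} + (m₁ (⋃ j ∈ J, C j) + m₁ (Ioi (N * h))) :=
        (measure_mono hcover).trans ((measure_union_le _ _).trans
          (add_le_add le_rfl (measure_union_le _ _)))
    _ ≤ (∑ j ∈ J, m₁ (C j)) + η := by
        rw [h0, zero_add]
        exact add_le_add (measure_biUnion_finset_le _ _) htail
    _ ≤ (∑ j ∈ J, (m₂ (C j) + δ)) + η := by
        gcongr with j hj
        exact hcell j (Finset.mem_range.1 (Finset.mem_filter.1 hj).1)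
    _ = m₂ (⋃ j ∈ J, C j) + (J.card * δ + η) := by
        rw [Finset.sum_add_distrib, measure_biUnion_finset hdisj (fun _ _ => measurableSet_Ioc),
          Finset.sum_const, nsmul_eq_mul, add_assoc]
    _ ≤ m₂ (Metric.thickening ε.toReal A) + ε := by
        refine add_le_add (measure_mono hthick) (le_trans ?_ hsum)
        gcongr
        exact (Finset.card_filter_le _ _).trans (Finset.card_range N).le

/-- Pointwise convergence of tails implies convergence in the Prohorov metric. -/
theorem tendsto_levyProkhorovEDist_of_tails {ι : Type*} {l : Filter ι} {m : ι → Measure ℝ≥0}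
    {n : Measure ℝ≥0} [∀ i, IsFiniteMeasure (m i)] [IsFiniteMeasure n]
    (hm0 : ∀ i, m i {0} = 0) (hn0 : n {0} = 0)
    (h : ∀ y, Tendsto (fun i => m i (Ioi y)) l (𝓝 (n (Ioi y)))) :
    Tendsto (fun i => levyProkhorovEDist (m i) n) l (𝓝 0) := by
  have hcellLim : ∀ a b : ℝ≥0, a ≤ b →
      Tendsto (fun i => m i (Ioc a b)) l (𝓝 (n (Ioc a b))) := by
    intro a b hab
    have e : ∀ k : Measure ℝ≥0, IsFiniteMeasure k → k (Ioc a b) = k (Ioi a) - k (Ioi b) := by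
      intro k hk
      rw [← measure_sdiff (Ioi_subset_Ioi hab) measurableSet_Ioi.nullMeasurableSet
        (measure_ne_top k _), Ioi_sdiff_Ioi]
    rw [e n inferInstance]
    simp_rw [fun i => e (m i) inferInstance]
    exact ENNReal.Tendsto.sub (h a) (h b) (Or.inl (measure_ne_top n _))
  rw [ENNReal.tendsto_nhds_zero]
  intro ε₀ hε₀
  obtain ⟨e, he, hele⟩ : ∃ e : ℝ≥0, 0 < e ∧ (e : ℝ≥0∞) ≤ ε₀ := by
    rcases eq_or_ne ε₀ ∞ with rfl | hne
    · exact ⟨1, one_pos, le_top⟩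
    · lift ε₀ to ℝ≥0 using hne
      exact ⟨ε₀, by exact_mod_cast hε₀, le_rfl⟩
  -- Half of e is reserved for the mass beyond N cells and half for the N cell errors d; the mesh e
  -- / 2 stays below every ε > e.
  set h₀ : ℝ≥0 := e / 2 with hh0
  have hh : 0 < h₀ := by positivity
  have htail : Tendsto (fun N : ℕ => n (Ioi (N * h₀))) atTop (𝓝 0) := by
    have h1 : Tendsto (fun N : ℕ => (N : ℝ≥0) * h₀) atTop atTop :=
      tendsto_natCast_atTop_atTop.atTop_mul_const hh
    have h2 : Tendsto (fun y : ℝ≥0 => n (Ioi y)) atTop (𝓝 0) := by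
      have := tendsto_measure_iInter_atTop (μ := n) (s := fun y : ℝ≥0 => Ioi y)
        (fun y => measurableSet_Ioi.nullMeasurableSet) (fun a b hab => Ioi_subset_Ioi hab)
        ⟨0, measure_ne_top n _⟩
      have he : (⋂ y : ℝ≥0, Ioi y) = ∅ := by
        ext x
        simp only [mem_iInter, mem_Ioi, mem_empty_iff_false, iff_false, not_forall, not_lt]
        exact ⟨x, le_rfl⟩
      rwa [he, measure_empty] at this
    exact h2.comp h1
  have hq : (0 : ℝ≥0∞) < (e / 2 : ℝ≥0) := by exact_mod_cast hh
  obtain ⟨N, hN⟩ := ((tendsto_order.1 htail).2 _ hq).exists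
  set d : ℝ≥0 := e / 2 / (N + 1) with hd
  have hdpos : 0 < d := by positivity
  have hdE : (0 : ℝ≥0∞) < d := by exact_mod_cast hdpos
  have hsum : (N : ℝ≥0∞) * d + (e / 2 : ℝ≥0) ≤ e := by
    have : (N : ℝ≥0) * d + e / 2 ≤ e := by
      have h1 : (N : ℝ≥0) * d ≤ e / 2 := by
        rw [hd, mul_div_assoc', div_le_iff₀ (by positivity), mul_comm]
        gcongr
        simp
      calc (N : ℝ≥0) * d + e / 2 ≤ e / 2 + e / 2 := by gcongr
        _ = e := add_halves e
    exact_mod_cast this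
  have hc1 : ∀ᶠ i in l, ∀ j ∈ Finset.range N,
      m i (Ioc (j * h₀) ((j + 1) * h₀)) ≤ n (Ioc (j * h₀) ((j + 1) * h₀)) + d ∧
      n (Ioc (j * h₀) ((j + 1) * h₀)) ≤ m i (Ioc (j * h₀) ((j + 1) * h₀)) + d := by
    rw [Filter.eventually_all_finset]
    intro j _
    have hlim := hcellLim (j * h₀) ((j + 1) * h₀) (by gcongr; simp)
    have := (ENNReal.tendsto_nhds (measure_ne_top n _)).1 hlim d hdE
    filter_upwards [this] with i hi
    exact ⟨hi.2, tsub_le_iff_right.1 hi.1⟩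
  have hc2 : ∀ᶠ i in l, m i (Ioi (N * h₀)) < (e / 2 : ℝ≥0) := (tendsto_order.1 (h _)).2 _ hN
  filter_upwards [hc1, hc2] with i hi1 hi2
  refine le_trans (levyProkhorovEDist_le_of_forall _ _ e fun ε A hε hε' hA => ?_) hele
  have hhe : (h₀ : ℝ≥0∞) < ε := lt_of_le_of_lt (by
    have : h₀ ≤ e := by rw [hh0]; exact half_le_self zero_le
    exact_mod_cast this) hε
  exact ⟨measure_le_thickening_of_cells hh hhe hε' (hm0 i)
      (fun j hj => (hi1 j (Finset.mem_range.2 hj)).1) hi2.le (hsum.trans hε.le) A,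
    measure_le_thickening_of_cells hh hhe hε' hn0
      (fun j hj => (hi1 j (Finset.mem_range.2 hj)).2) hN.le (hsum.trans hε.le) A⟩

/-! ### Nonlattice measures and propagation to long windows. -/

/-- A measure on `[0, ∞)` that is not concentrated on any lattice `{0, d, 2d, …}`. -/
def NotLattice (n : Measure ℝ≥0) : Prop :=
  ∀ d : ℝ≥0, 0 < d → n (range fun k : ℕ => (k : ℝ≥0) * d)ᶜ ≠ 0

/-- The points all of whose neighbourhoods are charged. -/
def chargedPoints (n : Measure ℝ≥0) : Set ℝ≥0 :=
  {v | ∀ η : ℝ, 0 < η → 0 < n (Metric.ball v η)}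

theorem measure_compl_chargedPoints (n : Measure ℝ≥0) : n (chargedPoints n)ᶜ = 0 := by
  refine measure_null_of_locally_null _ fun v hv => ?_
  simp only [chargedPoints, mem_compl_iff, mem_ofPred_eq, not_forall, not_lt,
    nonpos_iff_eq_zero] at hv
  obtain ⟨η, hη, h0⟩ := hv
  exact ⟨_, mem_nhdsWithin_of_mem_nhds (Metric.ball_mem_nhds v hη), h0⟩

/-- A submonoid of `[0, ∞)` that is not contained in a lattice is eventually `η`-dense. -/
theorem eventually_dense_of_not_lattice (Γ : AddSubmonoid ℝ≥0)
    (hΓ : ∀ d : ℝ≥0, 0 < d → ¬ (Γ : Set ℝ≥0) ⊆ range fun k : ℕ => (k : ℝ≥0) * d)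
    {η : ℝ≥0} (hη : 0 < η) : ∃ V : ℝ≥0, ∀ v, V ≤ v → ∃ s ∈ Γ, v ≤ s ∧ s ≤ v + η := by
  -- The group of differences of Γ is dense or cyclic. If cyclic, Γ would lie in a lattice; if
  -- dense, there are a, b in Γ with 0 < a - b ≤ η.
  let H : AddSubgroup ℝ :=
    { carrier := {r | ∃ a ∈ Γ, ∃ b ∈ Γ, r = (a : ℝ) - b}
      add_mem' := by
        rintro _ _ ⟨a, ha, b, hb, rfl⟩ ⟨c, hc, d, hd, rfl⟩
        exact ⟨a + c, Γ.add_mem ha hc, b + d, Γ.add_mem hb hd, by push_cast; ring⟩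
      zero_mem' := ⟨0, Γ.zero_mem, 0, Γ.zero_mem, by simp⟩
      neg_mem' := by
        rintro _ ⟨a, ha, b, hb, rfl⟩
        exact ⟨b, hb, a, ha, by ring⟩ }
  have hsub : ∀ a ∈ Γ, (a : ℝ) ∈ H := fun a ha => ⟨a, ha, 0, Γ.zero_mem, by simp⟩
  obtain ⟨a, ha, b, hb, hlt, hle⟩ : ∃ a ∈ Γ, ∃ b ∈ Γ, b < a ∧ a ≤ b + η := by
    rcases H.dense_or_cyclic with hd | ⟨c, hc⟩
    · obtain ⟨r, hr, hrI⟩ := hd.exists_mem_open (isOpen_Ioo (a := (0 : ℝ)) (b := η))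
        ⟨η / 2, by have : (0 : ℝ) < η := hη
                   constructor <;> linarith⟩
      obtain ⟨a, ha, b, hb, rfl⟩ := hr
      refine ⟨a, ha, b, hb, ?_, ?_⟩
      · rw [← NNReal.coe_lt_coe]; linarith [hrI.1]
      · rw [← NNReal.coe_le_coe]; push_cast; linarith [hrI.2]
    · exfalso
      rw [← AddSubgroup.zmultiples_eq_closure] at hc
      have key : ∀ d : ℝ≥0, 0 < d → (∃ z : ℤ, (c : ℝ) = z * d) →
          (Γ : Set ℝ≥0) ⊆ range fun k : ℕ => (k : ℝ≥0) * d := by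
        rintro d hd ⟨z, hz⟩ a ha
        have := hsub a ha
        rw [hc, AddSubgroup.mem_zmultiples_iff] at this
        obtain ⟨k, hk⟩ := this
        have hk' : (a : ℝ) = ((k * z : ℤ) : ℝ) * d := by
          rw [← hk, hz, zsmul_eq_mul]; push_cast; ring
        have hnn : 0 ≤ k * z := by
          by_contra hneg
          have h1 : ((k * z : ℤ) : ℝ) < 0 := by exact_mod_cast not_le.1 hneg
          have h2 : (0 : ℝ) < d := hd
          have : (a : ℝ) < 0 := by rw [hk']; exact mul_neg_of_neg_of_pos h1 h2
          exact absurd a.2 (not_le.2 this)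
        obtain ⟨N, hN⟩ := Int.eq_ofNat_of_zero_le hnn
        refine ⟨N, ?_⟩
        rw [← NNReal.coe_inj]
        rw [hN] at hk'
        push_cast at hk' ⊢
        exact hk'.symm
      rcases eq_or_ne c 0 with rfl | hc0
      · exact hΓ 1 one_pos (key 1 one_pos ⟨0, by simp⟩)
      · refine hΓ ‖c‖₊ (nnnorm_pos.2 hc0) (key _ (nnnorm_pos.2 hc0) ?_)
        rcases le_total 0 c with h | h
        · exact ⟨1, by simp [abs_of_nonneg h]⟩
        · exact ⟨-1, by simp [abs_of_nonpos h]⟩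
  set θ : ℝ≥0 := a - b with hθ
  have hθpos : 0 < θ := tsub_pos_of_lt hlt
  have hab : a = b + θ := (add_tsub_cancel_of_le hlt.le).symm
  have hθη : θ ≤ η := tsub_le_iff_left.2 hle
  -- The points n b + k θ with k ≤ n lie in Γ and cover [n b, n b + n θ] with mesh θ. From n ≥ b / θ
  -- on, these blocks reach the start of the next one.
  obtain ⟨N, hN⟩ := exists_nat_ge (b / θ)
  rw [div_le_iff₀ hθpos] at hN
  have hmem : ∀ n k : ℕ, k ≤ n → (n : ℝ≥0) * b + k * θ ∈ Γ := by
    intro n k hk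
    have : (n : ℝ≥0) * b + k * θ = (n - k : ℕ) • b + k • a := by
      rw [hab, nsmul_eq_mul, nsmul_eq_mul, mul_add, ← add_assoc, ← add_mul]
      congr 2
      exact_mod_cast (Nat.sub_add_cancel hk).symm
    rw [this]
    exact Γ.add_mem (Γ.nsmul_mem hb _) (Γ.nsmul_mem ha _)
  refine ⟨N * b, fun v hv => ?_⟩
  have hcell : ∀ n : ℕ, ∀ s, (n : ℝ≥0) * b ≤ s → s ≤ n * b + n * θ →
      ∃ g ∈ Γ, s ≤ g ∧ g ≤ s + η := by
    intro n s hs1 hs2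
    set j := ⌈(s - n * b) / θ⌉₊ with hj
    have hjle : j ≤ n := by
      rw [hj, Nat.ceil_le, div_le_iff₀ hθpos]
      exact tsub_le_iff_left.2 hs2
    refine ⟨n * b + j * θ, hmem n j hjle, ?_, ?_⟩
    · have := Nat.le_ceil ((s - n * b) / θ)
      rw [div_le_iff₀ hθpos] at this
      exact tsub_le_iff_left.1 this
    · have := (Nat.ceil_lt_add_one (a := (s - n * b) / θ) zero_le).le
      calc n * b + j * θ ≤ n * b + ((s - n * b) / θ + 1) * θ := by gcongr
        _ = (n * b + (s - n * b)) + θ := by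
          rw [add_mul, div_mul_cancel₀ _ hθpos.ne', one_mul, add_assoc]
        _ ≤ s + η := by rw [add_tsub_cancel_of_le hs1]; gcongr
  -- For b = 0 the blocks all start at 0 and one long progression suffices; otherwise the block
  -- index is ⌊v / b⌋.
  rcases eq_or_ne b 0 with hb0 | hb0
  · obtain ⟨n, hn⟩ := exists_nat_ge (v / θ)
    rw [div_le_iff₀ hθpos] at hn
    refine hcell n v (by simp [hb0]) (by simpa [hb0] using hn)
  · have hbpos : 0 < b := pos_iff_ne_zero.2 hb0
    have h1 : (⌊v / b⌋₊ : ℝ≥0) * b ≤ v := by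
      rw [← le_div_iff₀ hbpos]; exact Nat.floor_le zero_le
    have h2 : v ≤ ((⌊v / b⌋₊ : ℝ≥0) + 1) * b := by
      rw [← div_le_iff₀ hbpos]; exact (Nat.lt_floor_add_one _).le
    have h3 : N ≤ ⌊v / b⌋₊ := Nat.le_floor (by rwa [le_div_iff₀ hbpos])
    have h3' : (N : ℝ≥0) ≤ ⌊v / b⌋₊ := by exact_mod_cast h3
    refine hcell _ v h1 (h2.trans ?_)
    rw [add_mul, one_mul]
    gcongr
    exact hN.trans (by gcongr)

/-- Suppose that a family `y i` of functions, Lipschitz in one direction, has upper limit at most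
`Y`, and that values near `Y` propagate backwards along some increment near each point charged by
`n`. If `n` is not lattice, then values near `Y` propagate to arbitrarily long windows. -/
theorem exists_window {ι : Type*} {L : Filter ι} {n : Measure ℝ≥0} (hn : NotLattice n)
    {y : ι → ℝ≥0 → ℝ} {Y Λ : ℝ} (hΛ : 0 ≤ Λ)
    (hlip : (∀ i u v, v ≤ u → y i u - Λ * (u - v) ≤ y i v) ∨
      (∀ i u v, u ≤ v → y i u - Λ * (v - u) ≤ y i v))
    (hprop : ∀ v₀ ∈ chargedPoints n, ∀ η : ℝ, 0 < η → ∀ ε : ℝ, 0 < ε → ∃ ε' : ℝ, 0 < ε' ∧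
      ∀ᶠ p in L ×ˢ (atTop : Filter ℝ≥0), Y - ε' ≤ y p.1 p.2 →
        ∃ v, dist v v₀ < η ∧ Y - ε ≤ y p.1 (p.2 - v))
    (W : ℝ≥0) {ε : ℝ} (hε : 0 < ε) :
    ∃ ε' : ℝ, 0 < ε' ∧ ∃ V : ℝ≥0, ∀ᶠ p in L ×ˢ (atTop : Filter ℝ≥0), Y - ε' ≤ y p.1 p.2 →
      ∀ r ≤ W, Y - ε ≤ y p.1 (p.2 - V - r) := by
  have hlarge : ∀ V : ℝ≥0, ∀ᶠ p in L ×ˢ (atTop : Filter ℝ≥0), V ≤ p.2 := fun V =>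
    tendsto_snd.eventually (eventually_ge_atTop V)
  have hshift : ∀ V : ℝ≥0, Tendsto (fun p : ι × ℝ≥0 => (p.1, p.2 - V))
      (L ×ˢ (atTop : Filter ℝ≥0)) (L ×ˢ atTop) := fun V =>
    tendsto_fst.prodMk ((tendsto_atTop_mono (fun x => le_rfl)
      (tendsto_atTop.2 fun b => (eventually_ge_atTop (b + V)).mono fun x hx =>
        le_tsub_of_add_le_right hx)).comp tendsto_snd)
  -- These are the increments along which near-maximality propagates, up to an arbitrarily small
  -- displacement to a v' that no longer depends on p. Composing two steps makes the set a
  -- submonoid.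
  let Good : Set ℝ≥0 := {v | ∀ ε : ℝ, 0 < ε → ∃ ε' : ℝ, 0 < ε' ∧ ∃ v' : ℝ≥0, dist v' v ≤ ε ∧
    ∀ᶠ p in L ×ˢ (atTop : Filter ℝ≥0), Y - ε' ≤ y p.1 p.2 → Y - ε ≤ y p.1 (p.2 - v')}
  have hcharged : chargedPoints n ⊆ Good := by
    intro v₀ hv₀ ε hε
    have hη : 0 < min ε (ε / (4 * (Λ + 1))) := lt_min hε (by positivity)
    set η : ℝ := min ε (ε / (4 * (Λ + 1))) with hηdef
    have hηε : η ≤ ε := min_le_left _ _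
    have hηΛ : Λ * (2 * η) ≤ ε / 2 := by
      have h1 : η ≤ ε / (4 * (Λ + 1)) := min_le_right _ _
      rw [le_div_iff₀ (by positivity)] at h1
      nlinarith
    lift η to ℝ≥0 using hη.le with ηn hηn
    obtain ⟨ε', hε', hev⟩ := hprop v₀ hv₀ ηn hη (ε / 2) (half_pos hε)
    -- The increment v found in the ball depends on p. The one-sided Lipschitz bound carries the
    -- value to a fixed end of the ball, the far end v₀ + η or the near end v₀ - η according to its
    -- direction.
    rcases hlip with hl | hl
    · refine ⟨ε', hε', v₀ + ηn, ?_, ?_⟩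
      · rw [NNReal.dist_eq]; push_cast; rwa [add_sub_cancel_left, abs_of_nonneg hη.le]
      filter_upwards [hev, hlarge (v₀ + ηn)] with p hp hpl hy
      obtain ⟨v, hv, hyv⟩ := hp hy
      rw [NNReal.dist_eq, abs_lt] at hv
      have hvle : v ≤ v₀ + ηn := by
        rw [← NNReal.coe_le_coe]; push_cast; linarith
      have := hl p.1 (p.2 - v) (p.2 - (v₀ + ηn)) (tsub_le_tsub_left hvle _)
      rw [NNReal.coe_sub (hvle.trans hpl), NNReal.coe_sub hpl] at this
      push_cast at this
      nlinarith [mul_le_mul_of_nonneg_left (show (v₀ + ηn - v : ℝ) ≤ 2 * ηn by linarith) hΛ]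
    · refine ⟨ε', hε', v₀ - ηn, ?_, ?_⟩
      · rw [NNReal.dist_eq, abs_le]
        have h1 : ((v₀ - ηn : ℝ≥0) : ℝ) ≤ v₀ := by exact_mod_cast tsub_le_self
        have h2 : (v₀ : ℝ) ≤ (v₀ - ηn : ℝ≥0) + ηn := by exact_mod_cast le_tsub_add
        constructor <;> linarith
      filter_upwards [hev, hlarge (v₀ + ηn)] with p hp hpl hy
      obtain ⟨v, hv, hyv⟩ := hp hy
      rw [NNReal.dist_eq, abs_lt] at hv
      have hvle : v ≤ v₀ + ηn := by
        rw [← NNReal.coe_le_coe]; push_cast; linarith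
      have hvge : v₀ - ηn ≤ v := by
        rw [tsub_le_iff_right, ← NNReal.coe_le_coe]; push_cast; linarith
      have := hl p.1 (p.2 - v) (p.2 - (v₀ - ηn)) (tsub_le_tsub_left hvge _)
      rw [NNReal.coe_sub (hvle.trans hpl),
        NNReal.coe_sub (tsub_le_self.trans (le_self_add.trans hpl))] at this
      have h2 : (v₀ : ℝ) ≤ (v₀ - ηn : ℝ≥0) + ηn := by exact_mod_cast le_tsub_add
      nlinarith [mul_le_mul_of_nonneg_left
        (show (v - (v₀ - ηn : ℝ≥0) : ℝ) ≤ 2 * ηn by linarith) hΛ]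
  let Γ : AddSubmonoid ℝ≥0 :=
    { carrier := Good
      zero_mem' := fun ε hε => ⟨ε, hε, 0, by simpa using hε.le, Eventually.of_forall fun p hp => by
        simpa using hp⟩
      add_mem' := by
        intro v₁ v₂ h₁ h₂ ε hε
        obtain ⟨ε₂, hε₂, w₂, hw₂, hev₂⟩ := h₂ (ε / 2) (half_pos hε)
        obtain ⟨ε₁, hε₁, w₁, hw₁, hev₁⟩ := h₁ (min ε₂ (ε / 2)) (lt_min hε₂ (half_pos hε))
        refine ⟨ε₁, hε₁, w₁ + w₂, ?_, ?_⟩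
        · have h3 := hw₁.trans (min_le_right _ _)
          rw [NNReal.dist_eq, abs_le] at h3 hw₂ ⊢
          push_cast
          constructor <;> linarith
        · filter_upwards [hev₁, (hshift w₁).eventually hev₂] with p hp1 hp2 hy
          have h3 := hp2 ((sub_le_sub_left (min_le_left _ _) _).trans (hp1 hy))
          rw [tsub_tsub] at h3
          linarith }
  -- The charged points have full measure, so a lattice containing Γ would carry n.
  have hΓ : ∀ d : ℝ≥0, 0 < d → ¬ (Γ : Set ℝ≥0) ⊆ range fun k : ℕ => (k : ℝ≥0) * d := by
    intro d hd hsub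
    refine hn d hd (measure_mono_null ?_ (measure_compl_chargedPoints n))
    exact compl_subset_compl.2 (hcharged.trans hsub)
  obtain ⟨η, hη, hηΛ⟩ : ∃ η : ℝ≥0, 0 < η ∧ Λ * (4 * η) ≤ ε / 2 := by
    have h0 : 0 < ε / (8 * (Λ + 1)) := by positivity
    have : (ε / (8 * (Λ + 1))) * (8 * (Λ + 1)) = ε := div_mul_cancel₀ _ (by positivity)
    refine ⟨(ε / (8 * (Λ + 1))).toNNReal, Real.toNNReal_pos.2 h0, ?_⟩
    rw [Real.coe_toNNReal _ h0.le]
    nlinarith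
  obtain ⟨V, hV⟩ := eventually_dense_of_not_lattice Γ hΓ hη
  obtain ⟨N, hN⟩ := exists_nat_ge (W / η)
  have hgrid : ∀ j : ℕ, ∃ ε' : ℝ, 0 < ε' ∧ ∃ v' : ℝ≥0,
      (V + j * η : ℝ) - η ≤ v' ∧ (v' : ℝ) ≤ V + j * η + 2 * η ∧
      ∀ᶠ p in L ×ˢ (atTop : Filter ℝ≥0), Y - ε' ≤ y p.1 p.2 → Y - ε / 2 ≤ y p.1 (p.2 - v') := by
    intro j
    obtain ⟨s, hs, hs1, hs2⟩ := hV (V + j * η) le_self_add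
    obtain ⟨ε', hε', v', hv', hev⟩ := hs (min η (ε / 2))
      (lt_min (NNReal.coe_pos.2 hη) (half_pos hε))
    have h1 := hv'.trans (min_le_left _ _)
    rw [NNReal.dist_eq, abs_le] at h1
    have hs1' : (V + j * η : ℝ) ≤ s := by exact_mod_cast hs1
    have hs2' : (s : ℝ) ≤ V + j * η + η := by exact_mod_cast hs2
    refine ⟨ε', hε', v', by linarith, by linarith, ?_⟩
    filter_upwards [hev] with p hp hy
    have := hp hy
    have := min_le_right (η : ℝ) (ε / 2)
    linarith
  choose e he w hw1 hw2 hw3 using hgrid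
  -- The index used for r is ⌊r / η⌋ ≤ N when values are carried backwards in time. It is 4 larger
  -- when they are carried forwards, since w j may fall short of V + j η by η while the target is V
  -- + 2 η + r.
  have hne : (Finset.range (N + 5)).Nonempty := ⟨0, by simp⟩
  refine ⟨(Finset.range (N + 5)).inf' hne e, (Finset.lt_inf'_iff hne).2 fun j _ => he j,
    V + 2 * η, ?_⟩
  have hall : ∀ᶠ p in L ×ˢ (atTop : Filter ℝ≥0), ∀ j ∈ Finset.range (N + 5),
      Y - e j ≤ y p.1 p.2 → Y - ε / 2 ≤ y p.1 (p.2 - w j) :=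
    (Filter.eventually_all_finset _).2 fun j _ => hw3 j
  filter_upwards [hall, hlarge (V + (N + 5) * η + 2 * η + W)] with p hp hpl hy r hr
  have hpl' : (V + (N + 5) * η + 2 * η + W : ℝ) ≤ p.2 := by exact_mod_cast hpl
  have hrW : (r : ℝ) ≤ W := by exact_mod_cast hr
  have hj1 : (⌊r / η⌋₊ : ℝ) * η ≤ r := by
    have : (⌊r / η⌋₊ : ℝ≥0) * η ≤ r := by
      rw [← le_div_iff₀ hη]; exact Nat.floor_le zero_le
    exact_mod_cast this
  have hj2 : (r : ℝ) ≤ (⌊r / η⌋₊ : ℝ) * η + η := by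
    have : r ≤ ((⌊r / η⌋₊ : ℝ≥0) + 1) * η := by
      rw [← div_le_iff₀ hη]; exact (Nat.lt_floor_add_one _).le
    have h2 : (r : ℝ) ≤ ((⌊r / η⌋₊ : ℝ) + 1) * η := by exact_mod_cast this
    linarith
  have hjN : ⌊r / η⌋₊ ≤ N := by
    have : (⌊r / η⌋₊ : ℝ≥0) ≤ N := (Nat.floor_le zero_le).trans
      ((div_le_div_of_nonneg_right hr zero_le).trans hN)
    exact_mod_cast this
  have hjNr : (⌊r / η⌋₊ : ℝ) ≤ N := by exact_mod_cast hjN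
  have hη' : (0 : ℝ) < η := hη
  have hjη : (⌊r / η⌋₊ : ℝ) * η ≤ N * η := by gcongr
  have htot : V + 2 * η + r ≤ p.2 := by
    rw [← NNReal.coe_le_coe]; push_cast
    nlinarith [W.2, V.2]
  have happ : ∀ j, j < N + 5 → Y - ε / 2 ≤ y p.1 (p.2 - w j) := fun j hj =>
    hp j (Finset.mem_range.2 hj) (le_trans (sub_le_sub_left
      (Finset.inf'_le _ (Finset.mem_range.2 hj)) _) hy)
  rw [tsub_tsub]
  have hcast : ((p.2 - (V + 2 * η + r) : ℝ≥0) : ℝ) = p.2 - (V + 2 * η + r) := by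
    rw [NNReal.coe_sub htot]; push_cast; ring
  rcases hlip with hl | hl
  · have h1 := hw1 ⌊r / η⌋₊
    have h2 := hw2 ⌊r / η⌋₊
    have hwle : w ⌊r / η⌋₊ ≤ V + 2 * η + r := by
      rw [← NNReal.coe_le_coe]; push_cast; linarith
    have h3 := happ ⌊r / η⌋₊ (by omega)
    have h4 := hl p.1 (p.2 - w ⌊r / η⌋₊) (p.2 - (V + 2 * η + r)) (tsub_le_tsub_left hwle _)
    rw [hcast, NNReal.coe_sub (hwle.trans htot)] at h4
    nlinarith [mul_le_mul_of_nonneg_left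
      (show (V + 2 * η + r - w ⌊r / η⌋₊ : ℝ) ≤ 4 * η by linarith) hΛ]
  · have h1 := hw1 (⌊r / η⌋₊ + 4)
    have h2 := hw2 (⌊r / η⌋₊ + 4)
    push_cast at h1 h2
    have hwge : V + 2 * η + r ≤ w (⌊r / η⌋₊ + 4) := by
      rw [← NNReal.coe_le_coe]; push_cast; linarith
    have hwp : w (⌊r / η⌋₊ + 4) ≤ p.2 := by
      rw [← NNReal.coe_le_coe]; nlinarith [W.2]
    have h3 := happ (⌊r / η⌋₊ + 4) (by omega)
    have h4 := hl p.1 (p.2 - w (⌊r / η⌋₊ + 4)) (p.2 - (V + 2 * η + r)) (tsub_le_tsub_left hwge _)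
    rw [hcast, NNReal.coe_sub hwp] at h4
    nlinarith [mul_le_mul_of_nonneg_left
      (show (w (⌊r / η⌋₊ + 4) - (V + 2 * η + r) : ℝ) ≤ 4 * η by linarith) hΛ]

/-! ### Propagation of near-extremal values through a renewal equation. -/

section Convolution

variable (n : Measure ℝ≥0) [IsProbabilityMeasure n]

/-- The constants are the bound in the bulk, the better bound on A, and the crude bound for
increments beyond R. The gain (c₁ - c₂) n(A) is what drives the propagation. -/
theorem convolution_le {φ : ℝ≥0 → ℝ≥0} {u R c₁ c₂ C : ℝ≥0} {A : Set ℝ≥0} (hA : MeasurableSet A)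
    (h₁ : ∀ v ≤ u, v ≤ R → φ v ≤ c₁) (h₂ : ∀ v ≤ u, v ∈ A → φ v ≤ c₂) (hC : ∀ v, φ v ≤ C) :
    (∫⁻ v in Iic u, φ v ∂n).toReal ≤
      c₁ * (1 - n.real A) + c₂ * n.real A + C * n.real (Ioi R) := by
  have hle : ∫⁻ v in Iic u, (φ v : ℝ≥0∞) ∂n ≤ c₁ * n Aᶜ + c₂ * n A + C * n (Ioi R) := by
    rw [← lintegral_indicator measurableSet_Iic, ← lintegral_indicator_const hA.compl,
      ← lintegral_indicator_const hA, ← lintegral_indicator_const measurableSet_Ioi,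
      ← lintegral_add_left (measurable_const.indicator hA.compl),
      ← lintegral_add_right _ (measurable_const.indicator measurableSet_Ioi)]
    refine lintegral_mono fun v => ?_
    by_cases hu : v ≤ u
    · rw [indicator_of_mem (s := Iic u) hu]
      by_cases hvA : v ∈ A
      · rw [indicator_of_mem hvA]
        refine le_trans ?_ (le_self_add.trans' le_add_self)
        exact ENNReal.coe_le_coe.2 (h₂ v hu hvA)
      · by_cases hR : v ≤ R
        · rw [indicator_of_mem (s := Aᶜ) hvA]
          refine le_trans ?_ (le_self_add.trans' le_self_add)
          exact ENNReal.coe_le_coe.2 (h₁ v hu hR)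
        · rw [indicator_of_mem (s := Ioi R) (not_le.1 hR)]
          refine le_trans ?_ le_add_self
          exact ENNReal.coe_le_coe.2 (hC v)
    · rw [indicator_of_notMem (s := Iic u) hu]
      exact zero_le
  have := ENNReal.toReal_mono (by finiteness) hle
  refine this.trans (le_of_eq ?_)
  rw [ENNReal.toReal_add (by finiteness) (by finiteness),
    ENNReal.toReal_add (by finiteness) (by finiteness), ENNReal.toReal_mul, ENNReal.toReal_mul,
    ENNReal.toReal_mul, ← probReal_compl_eq_one_sub hA]
  rfl

theorem le_convolution {φ : ℝ≥0 → ℝ≥0} {u R c₁ c₂ C : ℝ≥0} {A : Set ℝ≥0} (hA : MeasurableSet A)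
    (hR : R ≤ u) (h₁ : ∀ v ≤ R, c₁ ≤ φ v) (h₂ : ∀ v ∈ A, v ≤ R → c₂ ≤ φ v)
    (hC : ∀ v, φ v ≤ C) :
    c₁ * (1 - n.real A) + c₂ * n.real A ≤
      (∫⁻ v in Iic u, φ v ∂n).toReal + (c₁ + c₂) * n.real (Ioi R) := by
  have hle : c₁ * n Aᶜ + c₂ * n A ≤
      ∫⁻ v in Iic u, (φ v : ℝ≥0∞) ∂n + (c₁ + c₂ : ℝ≥0) * n (Ioi R) := by
    rw [← lintegral_indicator measurableSet_Iic, ← lintegral_indicator_const hA.compl,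
      ← lintegral_indicator_const hA, ← lintegral_indicator_const measurableSet_Ioi,
      ← lintegral_add_left (measurable_const.indicator hA.compl),
      ← lintegral_add_right _ (measurable_const.indicator measurableSet_Ioi)]
    refine lintegral_mono fun v => ?_
    by_cases hv : v ≤ R
    · rw [indicator_of_mem (s := Iic u) (hv.trans hR)]
      refine le_trans ?_ le_self_add
      by_cases hvA : v ∈ A
      · rw [indicator_of_mem hvA, indicator_of_notMem (s := Aᶜ) (by simpa using hvA), zero_add]
        exact ENNReal.coe_le_coe.2 (h₂ v hvA hv)
      · rw [indicator_of_notMem hvA, indicator_of_mem (s := Aᶜ) hvA, add_zero]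
        exact ENNReal.coe_le_coe.2 (h₁ v hv)
    · rw [indicator_of_mem (s := Ioi R) (not_le.1 hv)]
      refine le_trans ?_ le_add_self
      push_cast
      exact add_le_add (indicator_le_self _ _ _) (indicator_le_self _ _ _)
  have hfin : ∫⁻ v in Iic u, (φ v : ℝ≥0∞) ∂n ≠ ∞ := by
    refine ((lintegral_mono fun v => ENNReal.coe_le_coe.2 (hC v)).trans_lt ?_).ne
    rw [lintegral_const]
    finiteness
  have := ENNReal.toReal_mono (by finiteness) hle
  rw [ENNReal.toReal_add (by finiteness) (by finiteness),
    ENNReal.toReal_add (by finiteness) (by finiteness), ENNReal.toReal_mul, ENNReal.toReal_mul,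
    ENNReal.toReal_mul] at this
  rw [← probReal_compl_eq_one_sub hA]
  exact this

theorem exists_tail_lt {ρ : ℝ} (hρ : 0 < ρ) : ∃ R : ℝ≥0, n.real (Ioi R) < ρ := by
  have h2 : Tendsto (fun y : ℝ≥0 => n (Ioi y)) atTop (𝓝 0) := by
    have := tendsto_measure_iInter_atTop (μ := n) (s := fun y : ℝ≥0 => Ioi y)
      (fun y => measurableSet_Ioi.nullMeasurableSet) (fun a b hab => Ioi_subset_Ioi hab)
      ⟨0, measure_ne_top n _⟩
    have he : (⋂ y : ℝ≥0, Ioi y) = ∅ := by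
      ext x
      simp only [mem_iInter, mem_Ioi, mem_empty_iff_false, iff_false, not_forall, not_lt]
      exact ⟨x, le_rfl⟩
    rwa [he, measure_empty] at this
  have h3 := (ENNReal.tendsto_toReal ENNReal.zero_ne_top).comp h2
  exact ((tendsto_order.1 h3).2 ρ (by simpa using hρ)).exists

end Convolution

section Propagation

variable {ι : Type*} {L : Filter ι} {n₁ n₂ : Measure ℝ≥0} {f₁ f₂ : ℝ≥0 → ℝ≥0} {x : ι → ℝ≥0 → ℝ≥0} {g : ι → ℝ≥0 → ℝ≥0∞}
  {C Y : ℝ≥0}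

theorem renewal_toReal (heq : ∀ i u, (x i u : ℝ≥0∞) = g i u + ∫⁻ v in Iic u, f₁ (x i (u - v)) ∂n₁ +
      ∫⁻ v in Iic u, f₂ (x i (u - v)) ∂n₂) (i : ι) (u : ℝ≥0) :
    (x i u : ℝ) = (g i u).toReal + (∫⁻ v in Iic u, f₁ (x i (u - v)) ∂n₁).toReal +
      (∫⁻ v in Iic u, f₂ (x i (u - v)) ∂n₂).toReal := by
  have h := heq i u
  have hne : g i u + ∫⁻ v in Iic u, f₁ (x i (u - v)) ∂n₁ +
      ∫⁻ v in Iic u, f₂ (x i (u - v)) ∂n₂ ≠ ∞ := by rw [← h]; exact ENNReal.coe_ne_top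
  rw [ENNReal.add_ne_top, ENNReal.add_ne_top] at hne
  rw [← ENNReal.coe_toReal, h, ENNReal.toReal_add (by simp [hne]) hne.2,
    ENNReal.toReal_add hne.1.1 hne.1.2]

/-- Allows an eventual bound to be used simultaneously at all times p.2 - v with v in a bounded
window, as the convolution requires. -/
theorem eventually_prod_sub {P : ι × ℝ≥0 → Prop} (h : ∀ᶠ p in L ×ˢ (atTop : Filter ℝ≥0), P p)
    (R : ℝ≥0) : ∀ᶠ p in L ×ˢ (atTop : Filter ℝ≥0), R ≤ p.2 ∧ ∀ v ≤ R, P (p.1, p.2 - v) := by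
  obtain ⟨pa, hpa, pb, hpb, hP⟩ := eventually_prod_iff.1 h
  obtain ⟨U, hU⟩ := eventually_atTop.1 hpb
  refine (hpa.prod_mk (eventually_ge_atTop (U + R))).mono fun p hp => ⟨le_add_self.trans hp.2, ?_⟩
  intro v hv
  refine hP hp.1 (hU _ (le_tsub_of_add_le_right ((add_le_add_right hv U).trans hp.2)))

variable [IsProbabilityMeasure n₁] [IsProbabilityMeasure n₂]

/-- If no increment in the ball A around v₀ led back to a value near Y, the first convolution would
lose a multiple of n₁(A), while everything else is asymptotically at most Y; then x could not be
near Y. The hypothesis `hf` says that f₁ has slope one just below Y, so that the loss is not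
absorbed. -/
theorem propagate_upper (hsum : ∀ r, f₁ r + f₂ r = r) (hf₁ : Monotone f₁) (hf₂ : Monotone f₂)
    (hC : ∀ i u, x i u ≤ C)
    (heq : ∀ i u, (x i u : ℝ≥0∞) = g i u + ∫⁻ v in Iic u, f₁ (x i (u - v)) ∂n₁ +
      ∫⁻ v in Iic u, f₂ (x i (u - v)) ∂n₂)
    (hg : Tendsto (fun p : ι × ℝ≥0 => (g p.1 p.2).toReal) (L ×ˢ atTop) (𝓝 0))
    (hY : ∀ δ : ℝ≥0, 0 < δ → ∀ᶠ p in L ×ˢ (atTop : Filter ℝ≥0), x p.1 p.2 ≤ Y + δ)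
    (hf : ∃ ε₀ : ℝ≥0, 0 < ε₀ ∧ ε₀ ≤ Y ∧ ∀ e ≤ ε₀, f₁ (Y - e) + e ≤ f₁ Y) :
    ∀ v₀ ∈ chargedPoints n₁, ∀ η : ℝ, 0 < η → ∀ ε : ℝ, 0 < ε → ∃ ε' : ℝ, 0 < ε' ∧
      ∀ᶠ p in L ×ˢ (atTop : Filter ℝ≥0), (Y : ℝ) - ε' ≤ x p.1 p.2 →
        ∃ v, dist v v₀ < η ∧ (Y : ℝ) - ε ≤ x p.1 (p.2 - v) := by
  intro v₀ hv₀ η hη ε hε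
  obtain ⟨ε₀, hε₀, hε₀Y, hf⟩ := hf
  set A := Metric.ball v₀ η with hAdef
  have hA : MeasurableSet A := Metric.isOpen_ball.measurableSet
  set c : ℝ := n₁.real A with hc
  have hcpos : 0 < c := ENNReal.toReal_pos (hv₀ η hη).ne' (measure_ne_top _ _)
  have hc1 : c ≤ 1 := measureReal_le_one
  obtain ⟨e, he, heε₀, heε⟩ : ∃ e : ℝ≥0, 0 < e ∧ e ≤ ε₀ ∧ (e : ℝ) ≤ ε :=
    ⟨min ε₀ ε.toNNReal, lt_min hε₀ (Real.toNNReal_pos.2 hε), min_le_left _ _, by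
      have : min ε₀ ε.toNNReal ≤ ε.toNNReal := min_le_right _ _
      exact (NNReal.coe_le_coe.2 this).trans (Real.coe_toNNReal _ hε.le).le⟩
  have he' : (0 : ℝ) < e := he
  have hce : 0 < c * e := by positivity
  obtain ⟨R₁, hR₁⟩ := exists_tail_lt n₁ (ρ := c * e / (8 * (C + 1))) (by positivity)
  obtain ⟨R₂, hR₂⟩ := exists_tail_lt n₂ (ρ := c * e / (8 * (C + 1))) (by positivity)
  have tail : ∀ t : ℝ, 0 ≤ t → t < c * e / (8 * (C + 1)) → C * t ≤ c * e / 8 := by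
    intro t ht0 ht
    rw [lt_div_iff₀ (by positivity)] at ht
    have : (0 : ℝ) ≤ C := C.2
    nlinarith
  set δ : ℝ≥0 := (c * e / 8).toNNReal with hδ
  have hδpos : 0 < δ := Real.toNNReal_pos.2 (by positivity)
  have hδr : (δ : ℝ) = c * e / 8 := Real.coe_toNNReal _ (by positivity)
  -- The loss is c e. The forcing term, δ and the two tails each cost at most c e / 8, which leaves
  -- a deficit of c e / 2 > c e / 4.
  refine ⟨c * e / 4, by positivity, ?_⟩
  have hgs : ∀ᶠ p in L ×ˢ (atTop : Filter ℝ≥0), (g p.1 p.2).toReal < c * e / 8 :=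
    (tendsto_order.1 hg).2 _ (by positivity)
  filter_upwards [hgs, eventually_prod_sub (hY δ hδpos) (max R₁ R₂)] with p hgp hp hx
  by_contra hno
  push Not at hno
  have hA' : ∀ v ≤ p.2, v ∈ A → f₁ (x p.1 (p.2 - v)) ≤ f₁ (Y - e) := by
    intro v _ hvA
    refine hf₁ ?_
    have := hno v hvA
    rw [← NNReal.coe_le_coe, NNReal.coe_sub (heε₀.trans hε₀Y)]
    linarith
  have hb₁ : ∀ r, f₁ r ≤ r := fun r => le_self_add.trans (hsum r).le
  have hb₂ : ∀ r, f₂ r ≤ r := fun r => le_add_self.trans (hsum r).le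
  have i1 := convolution_le n₁ (φ := fun v => f₁ (x p.1 (p.2 - v))) (u := p.2) (R := R₁)
    (c₁ := f₁ (Y + δ)) (C := C) hA
    (fun v _ hvR => hf₁ (hp.2 v (hvR.trans (le_max_left _ _)))) hA'
    (fun v => (hb₁ _).trans (hC _ _))
  have i2 := convolution_le n₂ (φ := fun v => f₂ (x p.1 (p.2 - v))) (u := p.2) (R := R₂)
    (c₁ := f₂ (Y + δ)) (c₂ := 0) (C := C) MeasurableSet.empty
    (fun v _ hvR => hf₂ (hp.2 v (hvR.trans (le_max_right _ _)))) (fun v _ h => absurd h (by simp))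
    (fun v => (hb₂ _).trans (hC _ _))
  have heqr := renewal_toReal heq p.1 p.2
  have t1 := tail _ measureReal_nonneg hR₁
  have t2 := tail _ measureReal_nonneg hR₂
  have hs : (f₁ (Y + δ) : ℝ) + f₂ (Y + δ) = Y + δ := by exact_mod_cast hsum (Y + δ)
  have hm : (f₁ (Y - e) : ℝ) + e ≤ f₁ (Y + δ) := by
    exact_mod_cast (hf e heε₀).trans (hf₁ le_self_add)
  simp only [measureReal_empty, sub_zero, mul_one, mul_zero, add_zero] at i2
  have hm' := mul_le_mul_of_nonneg_right hm hcpos.le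
  have : (x p.1 p.2 : ℝ) ≤ Y - c * e / 2 := by
    rw [heqr]
    nlinarith
  linarith

/-- The mirror image of `propagate_upper`, written for -x so that `exists_window` applies to it. The
forcing term is nonnegative and can be dropped, so its decay is not needed. -/
theorem propagate_lower (hsum : ∀ r, f₁ r + f₂ r = r) (hf₁ : Monotone f₁) (hf₂ : Monotone f₂)
    (hC : ∀ i u, x i u ≤ C)
    (heq : ∀ i u, (x i u : ℝ≥0∞) = g i u + ∫⁻ v in Iic u, f₁ (x i (u - v)) ∂n₁ +
      ∫⁻ v in Iic u, f₂ (x i (u - v)) ∂n₂)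
    (hY : ∀ δ : ℝ≥0, 0 < δ → ∀ᶠ p in L ×ˢ (atTop : Filter ℝ≥0), Y - δ ≤ x p.1 p.2)
    (hf : ∃ ε₀ : ℝ≥0, 0 < ε₀ ∧ ∀ e ≤ ε₀, f₁ Y + e ≤ f₁ (Y + e)) :
    ∀ v₀ ∈ chargedPoints n₁, ∀ η : ℝ, 0 < η → ∀ ε : ℝ, 0 < ε → ∃ ε' : ℝ, 0 < ε' ∧
      ∀ᶠ p in L ×ˢ (atTop : Filter ℝ≥0), -(Y : ℝ) - ε' ≤ -x p.1 p.2 →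
        ∃ v, dist v v₀ < η ∧ -(Y : ℝ) - ε ≤ -x p.1 (p.2 - v) := by
  intro v₀ hv₀ η hη ε hε
  obtain ⟨ε₀, hε₀, hf⟩ := hf
  set A := Metric.ball v₀ η with hAdef
  have hA : MeasurableSet A := Metric.isOpen_ball.measurableSet
  set c : ℝ := n₁.real A with hc
  have hcpos : 0 < c := ENNReal.toReal_pos (hv₀ η hη).ne' (measure_ne_top _ _)
  have hc1 : c ≤ 1 := measureReal_le_one
  obtain ⟨e, he, heε₀, heε⟩ : ∃ e : ℝ≥0, 0 < e ∧ e ≤ ε₀ ∧ (e : ℝ) ≤ ε :=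
    ⟨min ε₀ ε.toNNReal, lt_min hε₀ (Real.toNNReal_pos.2 hε), min_le_left _ _, by
      have : min ε₀ ε.toNNReal ≤ ε.toNNReal := min_le_right _ _
      exact (NNReal.coe_le_coe.2 this).trans (Real.coe_toNNReal _ hε.le).le⟩
  have he' : (0 : ℝ) < e := he
  have hce : 0 < c * e := by positivity
  -- Since f₁ and f₂ lie below the identity, D dominates the sum c₁ + c₂ that multiplies the tails
  -- in `le_convolution`.
  set D : ℝ := 2 * (Y + ε₀) + 1 with hD
  have hDpos : 0 < D := by positivity
  obtain ⟨R₁, hR₁⟩ := exists_tail_lt n₁ (ρ := c * e / (8 * D)) (by positivity)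
  obtain ⟨R₂, hR₂⟩ := exists_tail_lt n₂ (ρ := c * e / (8 * D)) (by positivity)
  have tail : ∀ d t : ℝ, 0 ≤ t → t < c * e / (8 * D) → d ≤ D → d * t ≤ c * e / 8 := by
    intro d t ht0 ht hd
    rw [lt_div_iff₀ (by positivity)] at ht
    nlinarith [mul_le_mul_of_nonneg_right hd ht0]
  set δ : ℝ≥0 := (c * e / 8).toNNReal with hδ
  have hδpos : 0 < δ := Real.toNNReal_pos.2 (by positivity)
  have hδr : (δ : ℝ) = c * e / 8 := Real.coe_toNNReal _ (by positivity)
  refine ⟨c * e / 4, by positivity, ?_⟩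
  filter_upwards [eventually_prod_sub (hY δ hδpos) (max R₁ R₂)] with p hp hx
  by_contra hno
  push Not at hno
  have hA' : ∀ v ∈ A, v ≤ R₁ → f₁ (Y + e) ≤ f₁ (x p.1 (p.2 - v)) := by
    intro v hvA _
    refine hf₁ ?_
    have := hno v hvA
    rw [← NNReal.coe_le_coe, NNReal.coe_add]
    linarith
  have hb₁ : ∀ r, f₁ r ≤ r := fun r => le_self_add.trans (hsum r).le
  have hb₂ : ∀ r, f₂ r ≤ r := fun r => le_add_self.trans (hsum r).le
  have i1 := le_convolution n₁ (φ := fun v => f₁ (x p.1 (p.2 - v))) (u := p.2) (R := R₁)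
    (c₁ := f₁ (Y - δ)) (C := C) hA ((le_max_left _ _).trans hp.1)
    (fun v hvR => hf₁ (hp.2 v (hvR.trans (le_max_left _ _)))) hA'
    (fun v => (hb₁ _).trans (hC _ _))
  have i2 := le_convolution n₂ (φ := fun v => f₂ (x p.1 (p.2 - v))) (u := p.2) (R := R₂)
    (c₁ := f₂ (Y - δ)) (c₂ := 0) (C := C) MeasurableSet.empty ((le_max_right _ _).trans hp.1)
    (fun v hvR => hf₂ (hp.2 v (hvR.trans (le_max_right _ _)))) (fun v h => absurd h (by simp))
    (fun v => (hb₂ _).trans (hC _ _))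
  have heqr := renewal_toReal heq p.1 p.2
  have hs : (f₁ (Y - δ) : ℝ) + f₂ (Y - δ) = (Y - δ : ℝ≥0) := by exact_mod_cast hsum (Y - δ)
  have hYδ : (Y : ℝ) ≤ (Y - δ : ℝ≥0) + δ := by exact_mod_cast le_tsub_add
  have hYδ' : ((Y - δ : ℝ≥0) : ℝ) ≤ Y := by exact_mod_cast tsub_le_self
  have b1 : (f₁ (Y - δ) : ℝ) ≤ (Y - δ : ℝ≥0) := by exact_mod_cast hb₁ _
  have b2 : (f₂ (Y - δ) : ℝ) ≤ (Y - δ : ℝ≥0) := by exact_mod_cast hb₂ _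
  have b3 : (f₁ (Y + e) : ℝ) ≤ Y + e := by exact_mod_cast hb₁ _
  have b4 : (e : ℝ) ≤ ε₀ := by exact_mod_cast heε₀
  have hY0 : (0 : ℝ) ≤ Y := Y.2
  have hm : (f₁ (Y - δ) : ℝ) + e ≤ f₁ (Y + e) := by
    exact_mod_cast (add_le_add_left (hf₁ tsub_le_self) e).trans (hf e heε₀)
  have t1 := tail (f₁ (Y - δ) + f₁ (Y + e)) _ measureReal_nonneg hR₁ (by linarith)
  have t2 := tail (f₂ (Y - δ)) _ measureReal_nonneg hR₂ (by linarith)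
  simp only [measureReal_empty, sub_zero, mul_one, mul_zero, add_zero, NNReal.coe_zero] at i2
  have hm' := mul_le_mul_of_nonneg_right hm hcpos.le
  have hg0 : 0 ≤ (g p.1 p.2).toReal := ENNReal.toReal_nonneg
  have : (Y : ℝ) + c * e / 2 ≤ x p.1 p.2 := by
    rw [heqr]
    nlinarith
  linarith

end Propagation

/-! ### The nonlinear renewal equation: conservation and a priori bound. -/

/-- Solutions of the nonlinear renewal equation
`x(u) = G((u,∞)) + ∫₀ᵘ (x(u-v) - K)⁺ dn₁(v) + ∫₀ᵘ (x(u-v) ∧ K) dn₂(v)`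
whose increments are bounded above. -/
structure RenewalSolution (K Λ : ℝ≥0) (n₁ n₂ G : Measure ℝ≥0) (x : ℝ≥0 → ℝ≥0) : Prop where
  measurable : Measurable x
  renewal : ∀ u, (x u : ℝ≥0∞) = G (Ioi u) + ∫⁻ v in Iic u, (x (u - v) - K : ℝ≥0) ∂n₁ +
    ∫⁻ v in Iic u, (min (x (u - v)) K : ℝ≥0) ∂n₂
  growth : ∀ u v, u ≤ v → x v ≤ x u + Λ * (v - u)

theorem tsub_add_min_self (r K : ℝ≥0) : (r - K) + min r K = r := by
  rcases le_total r K with h | h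
  · rw [tsub_eq_zero_of_le h, min_eq_left h, zero_add]
  · rw [min_eq_right h, tsub_add_cancel_of_le h]

/-- Integrate the renewal equation over [0, U] and split ∫ f into the integrated convolution with n
plus ∫ f(U - s) n((s,∞)) ds. Since x = (x-K)⁺ + x∧K, the convolutions cancel; the growth bound makes
them finite. As U grows, the right side tends to the total initial work. -/
theorem RenewalSolution.conservation {K Λ : ℝ≥0} {n₁ n₂ G : Measure ℝ≥0} {x : ℝ≥0 → ℝ≥0}
    [IsProbabilityMeasure n₁] [IsProbabilityMeasure n₂]
    (h : RenewalSolution K Λ n₁ n₂ G x) (U : ℝ≥0) :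
    ∫⁻ s in Iic U, (x (U - s) - K : ℝ≥0) * n₁ (Ioi s) ∂lebesgue +
      ∫⁻ s in Iic U, (min (x (U - s)) K : ℝ≥0) * n₂ (Ioi s) ∂lebesgue =
      ∫⁻ s in Iic U, G (Ioi s) ∂lebesgue := by
  have hxm := h.measurable
  have hf₁ : Measurable fun s => ((x s - K : ℝ≥0) : ℝ≥0∞) := by fun_prop
  have hf₂ : Measurable fun s => ((min (x s) K : ℝ≥0) : ℝ≥0∞) := by fun_prop
  have hcdf : ∀ (n : Measure ℝ≥0), Measurable fun s => n (Iic s) := fun n =>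
    Monotone.measurable fun _ _ hab => measure_mono (Iic_subset_Iic.2 hab)
  have split : ∀ (n : Measure ℝ≥0) [IsProbabilityMeasure n] (f : ℝ≥0 → ℝ≥0∞), Measurable f →
      ∫⁻ s in Iic U, f s ∂lebesgue = ∫⁻ u in Iic U, ∫⁻ v in Iic u, f (u - v) ∂n ∂lebesgue +
        ∫⁻ s in Iic U, f (U - s) * n (Ioi s) ∂lebesgue := by
    intro n _ f hf
    have hf' : Measurable fun s => f (U - s) := hf.comp (by fun_prop)
    rw [lintegral_convolution n hf,
      ← lintegral_add_left (f := fun s => f (U - s) * n (Iic s)) (hf'.mul (hcdf n)),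
      ← lintegral_Iic_reflect U hf]
    refine lintegral_congr fun s => ?_
    rw [← mul_add, ← compl_Iic, measure_add_measure_compl measurableSet_Iic, measure_univ, mul_one]
  have hconvm : ∀ (n : Measure ℝ≥0) [IsProbabilityMeasure n] (f : ℝ≥0 → ℝ≥0∞), Measurable f →
      Measurable fun u => ∫⁻ v in Iic u, f (u - v) ∂n := by
    intro n _ f hf
    have : (fun u => ∫⁻ v in Iic u, f (u - v) ∂n) = fun u => ∫⁻ v,
        {p : ℝ≥0 × ℝ≥0 | p.2 ≤ p.1}.indicator (fun p => f (p.1 - p.2)) (u, v) ∂n := by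
      funext u
      rw [← lintegral_indicator measurableSet_Iic]
      rfl
    rw [this]
    exact Measurable.lintegral_prod_right' (ν := n) ((hf.comp (f := fun p : ℝ≥0 × ℝ≥0 => p.1 - p.2)
      (by fun_prop)).indicator (measurableSet_le measurable_snd measurable_fst))
  have e1 : ∫⁻ s in Iic U, (x s : ℝ≥0∞) ∂lebesgue =
      ∫⁻ s in Iic U, ((x s - K : ℝ≥0) : ℝ≥0∞) ∂lebesgue +
        ∫⁻ s in Iic U, ((min (x s) K : ℝ≥0) : ℝ≥0∞) ∂lebesgue := by
    rw [← lintegral_add_left hf₁]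
    refine lintegral_congr fun s => ?_
    rw [← ENNReal.coe_add, tsub_add_min_self]
  have e2 : ∫⁻ s in Iic U, (x s : ℝ≥0∞) ∂lebesgue = ∫⁻ s in Iic U, G (Ioi s) ∂lebesgue +
      ∫⁻ u in Iic U, ∫⁻ v in Iic u, (x (u - v) - K : ℝ≥0) ∂n₁ ∂lebesgue +
      ∫⁻ u in Iic U, ∫⁻ v in Iic u, (min (x (u - v)) K : ℝ≥0) ∂n₂ ∂lebesgue := by
    rw [← lintegral_add_left (measurable_tail G), ← lintegral_add_left
      (f := fun u => G (Ioi u) + ∫⁻ v in Iic u, (x (u - v) - K : ℝ≥0) ∂n₁)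
      ((measurable_tail G).add (hconvm n₁ _ hf₁))]
    exact lintegral_congr h.renewal
  have hfin : ∫⁻ s in Iic U, (x s : ℝ≥0∞) ∂lebesgue ≠ ∞ := by
    have : ∫⁻ s in Iic U, (x s : ℝ≥0∞) ∂lebesgue ≤
        ∫⁻ s in Iic U, (x 0 + Λ * U : ℝ≥0) ∂lebesgue := by
      refine setLIntegral_mono measurable_const fun s hs => ENNReal.coe_le_coe.2 ?_
      refine (h.growth 0 s zero_le).trans ?_
      rw [tsub_zero]
      gcongr
      exact hs
    refine (this.trans_lt ?_).ne
    rw [lintegral_const, Measure.restrict_apply_univ, lebesgue_Iic]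
    finiteness
  have key := e1.symm.trans e2
  rw [split n₁ _ hf₁, split n₂ _ hf₂] at key
  rw [e2] at hfin
  rw [ENNReal.add_ne_top, ENNReal.add_ne_top] at hfin
  have hc : ∫⁻ u in Iic U, ∫⁻ v in Iic u, (x (u - v) - K : ℝ≥0) ∂n₁ ∂lebesgue +
      ∫⁻ u in Iic U, ∫⁻ v in Iic u, (min (x (u - v)) K : ℝ≥0) ∂n₂ ∂lebesgue ≠ ∞ :=
    ENNReal.add_ne_top.2 ⟨hfin.1.2, hfin.2⟩
  refine (ENNReal.add_right_inj hc).1 ?_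
  rw [add_add_add_comm, key]
  ring

theorem exists_pos_tail {n : Measure ℝ≥0} (h : n (Ioi 0) ≠ 0) : ∃ c : ℝ≥0, 0 < c ∧ n (Ioi c) ≠ 0 := by
  by_contra! hno
  refine h (measure_mono_null (t := ⋃ k : ℕ, Ioi (1 / ((k : ℝ≥0) + 1))) ?_
    (measure_iUnion_null fun k => hno _ (by positivity)))
  intro x hx
  obtain ⟨k, hk⟩ := exists_nat_gt (1 / x)
  refine mem_iUnion.2 ⟨k, ?_⟩
  have hx0 : 0 < x := hx
  rw [mem_Ioi, div_lt_iff₀ (by positivity)]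
  rw [div_lt_iff₀ hx0] at hk
  calc (1 : ℝ≥0) < k * x := hk
    _ ≤ x * (k + 1) := by rw [mul_comm]; gcongr; simp

/-- A bound depending only on the workload and the initial value. -/
theorem RenewalSolution.exists_bound (K Λ M X₀ : ℝ≥0) {n₁ : Measure ℝ≥0} (n₂ : Measure ℝ≥0)
    [IsProbabilityMeasure n₁] [IsProbabilityMeasure n₂] (hn : n₁ (Ioi 0) ≠ 0) :
    ∃ C : ℝ≥0, ∀ (G : Measure ℝ≥0) (x : ℝ≥0 → ℝ≥0), RenewalSolution K Λ n₁ n₂ G x →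
      ∫⁻ s, G (Ioi s) ∂lebesgue ≤ M → x 0 ≤ X₀ → ∀ u, x u ≤ C := by
  obtain ⟨c, hc, hnc⟩ := exists_pos_tail hn
  set t : ℝ≥0 := (n₁ (Ioi c)).toNNReal with ht
  have htE : (t : ℝ≥0∞) = n₁ (Ioi c) := ENNReal.coe_toNNReal (measure_ne_top _ _)
  have htpos : 0 < t := by
    rw [pos_iff_ne_zero]
    intro h0
    rw [h0] at htE
    exact hnc htE.symm
  refine ⟨max (X₀ + Λ * c) (M / (t * c) + (Λ * c + K)), fun G x h hG hx0 u => ?_⟩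
  rcases le_total u c with hu | hu
  · refine le_trans ((h.growth 0 u zero_le).trans ?_) (le_max_left _ _)
    rw [tsub_zero]
    gcongr
  · refine le_trans ?_ (le_max_right _ _)
    -- Going back by s ≤ c, x loses at most Λ c, and n₁((s,∞)) ≥ n₁((c,∞)) there. A large x(u) would
    -- therefore exceed the work M allowed by conservation.
    have h1 : (x u - (Λ * c + K) : ℝ≥0) * n₁ (Ioi c) * c ≤ M := by
      calc ((x u - (Λ * c + K) : ℝ≥0) : ℝ≥0∞) * n₁ (Ioi c) * c
          = ∫⁻ s in Iic c, (x u - (Λ * c + K) : ℝ≥0) * n₁ (Ioi c) ∂lebesgue := by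
            rw [lintegral_const, Measure.restrict_apply_univ, lebesgue_Iic]
        _ ≤ ∫⁻ s in Iic c, (x (u - s) - K : ℝ≥0) * n₁ (Ioi s) ∂lebesgue := by
            refine lintegral_mono_ae ?_
            filter_upwards [ae_restrict_mem measurableSet_Iic] with s hs
            refine mul_le_mul' (ENNReal.coe_le_coe.2 ?_) (measure_mono (Ioi_subset_Ioi hs))
            have h2 := h.growth (u - s) u tsub_le_self
            rw [tsub_tsub_cancel_of_le (le_trans hs hu)] at h2
            rw [← tsub_tsub]
            refine tsub_le_tsub_right (tsub_le_iff_right.2 (h2.trans ?_)) K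
            gcongr
            exact hs
        _ ≤ ∫⁻ s in Iic u, (x (u - s) - K : ℝ≥0) * n₁ (Ioi s) ∂lebesgue :=
            lintegral_mono_set (Iic_subset_Iic.2 hu)
        _ ≤ ∫⁻ s in Iic u, G (Ioi s) ∂lebesgue := by rw [← h.conservation u]; exact le_self_add
        _ ≤ M := (setLIntegral_le_lintegral _ _).trans hG
    rw [← htE] at h1
    have h2 : (x u - (Λ * c + K)) * (t * c) ≤ M := by
      rw [← mul_assoc]
      exact_mod_cast h1
    exact tsub_le_iff_right.1 ((le_div_iff₀ (by positivity)).2 h2)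

/-! ### Limit of the renewal solutions, uniformly along a family. -/

section Limit

variable {ι : Type*} {L : Filter ι} {K Λ C Y : ℝ≥0} {n₁ n₂ : Measure ℝ≥0} {G : ι → Measure ℝ≥0}
  {x : ι → ℝ≥0 → ℝ≥0} {w : ℝ≥0∞}

theorem tendsto_lintegral_Iic {f : ℝ≥0 → ℝ≥0∞} (hf : Measurable f) :
    Tendsto (fun W => ∫⁻ s in Iic W, f s ∂lebesgue) atTop (𝓝 (∫⁻ s, f s ∂lebesgue)) :=
  (aecover_Iic tendsto_id).lintegral_tendsto_of_countably_generated hf.aemeasurable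

theorem renewal_swap (hx : ∀ i, RenewalSolution K Λ n₁ n₂ (G i) (x i)) (i : ι) (u : ℝ≥0) :
    (x i u : ℝ≥0∞) = G i (Ioi u) + ∫⁻ v in Iic u, (min (x i (u - v)) K : ℝ≥0) ∂n₂ +
      ∫⁻ v in Iic u, (x i (u - v) - K : ℝ≥0) ∂n₁ := by
  rw [(hx i).renewal u, add_right_comm]

theorem growth_real (hx : ∀ i, RenewalSolution K Λ n₁ n₂ (G i) (x i)) (i : ι) {u v : ℝ≥0}
    (huv : u ≤ v) : (x i v : ℝ) ≤ x i u + Λ * (v - u) := by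
  have := (hx i).growth u v huv
  rw [← NNReal.coe_le_coe] at this
  push_cast [huv] at this
  exact this

variable [IsProbabilityMeasure n₁] [IsProbabilityMeasure n₂]

/-- Values near Y recur at late times and persist on windows of any length W. Restricting the
conservation law to such a window bounds the work carried by Y - ε; then ε → 0 and W → ∞. Finiteness
of the means plays no role, so the case β_e = ∞ is covered. -/
theorem limsup_workload_le (hx : ∀ i, RenewalSolution K Λ n₁ n₂ (G i) (x i))
    (hn₁ : NotLattice n₁) (hn₂ : NotLattice n₂) (hC : ∀ i u, x i u ≤ C)
    (hw : Tendsto (fun i => ∫⁻ s, G i (Ioi s) ∂lebesgue) L (𝓝 w))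
    (hg : Tendsto (fun p : ι × ℝ≥0 => (G p.1 (Ioi p.2)).toReal) (L ×ˢ atTop) (𝓝 0))
    (hY : ∀ δ : ℝ≥0, 0 < δ → ∀ᶠ p in L ×ˢ (atTop : Filter ℝ≥0), x p.1 p.2 ≤ Y + δ)
    (hfreq : ∀ δ : ℝ, 0 < δ → ∃ᶠ p in L ×ˢ (atTop : Filter ℝ≥0), (Y : ℝ) - δ ≤ x p.1 p.2) :
    (Y - K : ℝ≥0) * ∫⁻ s, n₁ (Ioi s) ∂lebesgue + (min Y K : ℝ≥0) * ∫⁻ s, n₂ (Ioi s) ∂lebesgue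
      ≤ w := by
  rcases eq_or_ne Y 0 with rfl | hY0
  · simp
  have hYpos : 0 < Y := pos_iff_ne_zero.2 hY0
  have hmono₁ : Monotone fun r : ℝ≥0 => r - K := fun a b hab => tsub_le_tsub_right hab K
  have hmono₂ : Monotone fun r : ℝ≥0 => min r K := fun a b hab => min_le_min_right K hab
  have hlip : ∀ i u v, v ≤ u → (x i u : ℝ) - Λ * (u - v) ≤ x i v := fun i u v huv => by
    linarith [growth_real hx i huv]
  have window : ∀ (W : ℝ≥0) {ε : ℝ}, 0 < ε → ∃ ε' : ℝ, 0 < ε' ∧ ∃ V : ℝ≥0,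
      ∀ᶠ p in L ×ˢ (atTop : Filter ℝ≥0), (Y : ℝ) - ε' ≤ x p.1 p.2 →
        ∀ r ≤ W, (Y : ℝ) - ε ≤ x p.1 (p.2 - V - r) := by
    -- The nonlinearity that increases with slope one just below Y decides which kernel propagates:
    -- the excess (r-K)⁺ when Y > K, the served part r∧K when Y ≤ K.
    rcases lt_or_ge K Y with h | h
    · refine fun W ε hε => exists_window (y := fun i u => (x i u : ℝ)) hn₁ Λ.2 (Or.inl hlip) ?_ W hε
      refine propagate_upper (fun r => tsub_add_min_self r K) hmono₁ hmono₂ hC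
        (fun i => (hx i).renewal) hg hY ⟨Y - K, tsub_pos_of_lt h, tsub_le_self, fun e he => ?_⟩
      rw [tsub_right_comm, tsub_add_cancel_of_le he]
    · refine fun W ε hε => exists_window (y := fun i u => (x i u : ℝ)) hn₂ Λ.2 (Or.inl hlip) ?_ W hε
      refine propagate_upper (fun r => (add_comm _ _).trans (tsub_add_min_self r K)) hmono₂ hmono₁
        hC (renewal_swap hx) hg hY ⟨Y, hYpos, le_rfl, fun e he => ?_⟩
      rw [min_eq_left h, min_eq_left (tsub_le_self.trans h), tsub_add_cancel_of_le he]
  have step : ∀ W ε : ℝ≥0, 0 < ε →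
      (Y - ε - K : ℝ≥0) * ∫⁻ s in Iic W, n₁ (Ioi s) ∂lebesgue +
        (min (Y - ε) K : ℝ≥0) * ∫⁻ s in Iic W, n₂ (Ioi s) ∂lebesgue ≤ w := by
    intro W ε hε
    refine le_of_forall_gt_imp_ge_of_dense fun w' hw' => ?_
    obtain ⟨ε', hε', V, hwin⟩ := window W (NNReal.coe_pos.2 hε)
    have hlarge : ∀ᶠ p in L ×ˢ (atTop : Filter ℝ≥0), V + W ≤ p.2 :=
      tendsto_snd.eventually (eventually_ge_atTop _)
    have hwi : ∀ᶠ p in L ×ˢ (atTop : Filter ℝ≥0), ∫⁻ s, G p.1 (Ioi s) ∂lebesgue < w' :=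
      tendsto_fst.eventually ((tendsto_order.1 hw).2 w' hw')
    obtain ⟨p, hp1, hp2, hp3, hp4⟩ :=
      ((hfreq ε' hε').and_eventually (hwin.and (hlarge.and hwi))).exists
    refine le_trans ?_ hp4.le
    refine le_trans ?_ (setLIntegral_le_lintegral (Iic (p.2 - V)) _)
    have hWU : W ≤ p.2 - V := le_tsub_of_add_le_left hp3
    rw [← (hx p.1).conservation, ← lintegral_const_mul _ (measurable_tail n₁),
      ← lintegral_const_mul _ (measurable_tail n₂)]
    have hlow : ∀ s ∈ Iic W, Y - ε ≤ x p.1 (p.2 - V - s) := fun s hs => by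
      have := hp2 hp1 s hs
      rw [tsub_le_iff_right, ← NNReal.coe_le_coe, NNReal.coe_add]
      linarith
    refine add_le_add ?_ ?_
    · refine le_trans ?_ (lintegral_mono_set (Iic_subset_Iic.2 hWU))
      refine lintegral_mono_ae ?_
      filter_upwards [ae_restrict_mem measurableSet_Iic] with s hs
      gcongr
      exact hlow s hs
    · refine le_trans ?_ (lintegral_mono_set (Iic_subset_Iic.2 hWU))
      refine lintegral_mono_ae ?_
      filter_upwards [ae_restrict_mem measurableSet_Iic] with s hs
      gcongr
      exact hlow s hs
  have hfin : ∀ (n : Measure ℝ≥0) [IsProbabilityMeasure n] (W : ℝ≥0),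
      ∫⁻ s in Iic W, n (Ioi s) ∂lebesgue ≠ ∞ := by
    intro n _ W
    refine (lt_of_le_of_lt (lintegral_mono fun s => prob_le_one) ?_).ne
    simp [lebesgue_Iic]
  have hnn : (0 : ℝ≥0) = Y - Y := (tsub_self Y).symm
  have step2 : ∀ W : ℝ≥0, (Y - K : ℝ≥0) * ∫⁻ s in Iic W, n₁ (Ioi s) ∂lebesgue +
        (min Y K : ℝ≥0) * ∫⁻ s in Iic W, n₂ (Ioi s) ∂lebesgue ≤ w := by
    intro W
    have hne : NeBot (𝓝[>] (0 : ℝ≥0)) := inferInstance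
    have hl : Tendsto (fun ε : ℝ≥0 => ((Y - ε - K : ℝ≥0) : ℝ≥0∞) * ∫⁻ s in Iic W, n₁ (Ioi s) ∂lebesgue
        + (min (Y - ε) K : ℝ≥0) * ∫⁻ s in Iic W, n₂ (Ioi s) ∂lebesgue) (𝓝[>] 0)
        (𝓝 ((Y - 0 - K : ℝ≥0) * ∫⁻ s in Iic W, n₁ (Ioi s) ∂lebesgue
        + (min (Y - 0) K : ℝ≥0) * ∫⁻ s in Iic W, n₂ (Ioi s) ∂lebesgue)) := by
      refine Tendsto.mono_left ?_ nhdsWithin_le_nhds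
      refine Tendsto.add (ENNReal.Tendsto.mul_const (ENNReal.tendsto_coe.2 ?_) (Or.inr (hfin _ _)))
        (ENNReal.Tendsto.mul_const (ENNReal.tendsto_coe.2 ?_) (Or.inr (hfin _ _)))
      · exact Continuous.tendsto (f := fun ε : ℝ≥0 => Y - ε - K) (by fun_prop) 0
      · exact Continuous.tendsto (f := fun ε : ℝ≥0 => min (Y - ε) K) (by fun_prop) 0
    rw [tsub_zero] at hl
    exact le_of_tendsto hl (eventually_mem_nhdsWithin.mono fun ε hε => step W ε hε)
  refine le_of_tendsto' ((ENNReal.Tendsto.const_mul (tendsto_lintegral_Iic (measurable_tail n₁))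
    (Or.inr ENNReal.coe_ne_top)).add (ENNReal.Tendsto.const_mul
      (tendsto_lintegral_Iic (measurable_tail n₂)) (Or.inr ENNReal.coe_ne_top))) step2

/-- Here the conservation law must be bounded from above, so the part outside the window matters. It
is controlled by C times the integrated tails of the kernels, whence the finite means, and by the
integrated tail of G, whence `hG`. -/
theorem le_liminf_workload (hx : ∀ i, RenewalSolution K Λ n₁ n₂ (G i) (x i))
    (hn₁ : NotLattice n₁) (hn₂ : NotLattice n₂) (hC : ∀ i u, x i u ≤ C)
    (hβ₁ : ∫⁻ s, n₁ (Ioi s) ∂lebesgue ≠ ∞) (hβ₂ : ∫⁻ s, n₂ (Ioi s) ∂lebesgue ≠ ∞) (hwfin : w ≠ ∞)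
    (hw : Tendsto (fun i => ∫⁻ s, G i (Ioi s) ∂lebesgue) L (𝓝 w))
    (hG : Tendsto (fun p : ι × ℝ≥0 => ∫⁻ s in Ioi p.2, G p.1 (Ioi s) ∂lebesgue) (L ×ˢ atTop) (𝓝 0))
    (hY : ∀ δ : ℝ≥0, 0 < δ → ∀ᶠ p in L ×ˢ (atTop : Filter ℝ≥0), Y - δ ≤ x p.1 p.2)
    (hfreq : ∀ δ : ℝ, 0 < δ → ∃ᶠ p in L ×ˢ (atTop : Filter ℝ≥0), (x p.1 p.2 : ℝ) ≤ Y + δ) :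
    w ≤ (Y - K : ℝ≥0) * ∫⁻ s, n₁ (Ioi s) ∂lebesgue +
      (min Y K : ℝ≥0) * ∫⁻ s, n₂ (Ioi s) ∂lebesgue := by
  have hmono₁ : Monotone fun r : ℝ≥0 => r - K := fun a b hab => tsub_le_tsub_right hab K
  have hmono₂ : Monotone fun r : ℝ≥0 => min r K := fun a b hab => min_le_min_right K hab
  have hlip : ∀ i u v, u ≤ v → -(x i u : ℝ) - Λ * (v - u) ≤ -x i v := fun i u v huv => by
    linarith [growth_real hx i huv]
  have window : ∀ (W : ℝ≥0) {ε : ℝ}, 0 < ε → ∃ ε' : ℝ, 0 < ε' ∧ ∃ V : ℝ≥0,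
      ∀ᶠ p in L ×ˢ (atTop : Filter ℝ≥0), -(Y : ℝ) - ε' ≤ -x p.1 p.2 →
        ∀ r ≤ W, -(Y : ℝ) - ε ≤ -x p.1 (p.2 - V - r) := by
    rcases le_or_gt K Y with h | h
    · refine fun W ε hε => exists_window (y := fun i u => -(x i u : ℝ)) hn₁ Λ.2 (Or.inr hlip) ?_ W hε
      refine propagate_lower (fun r => tsub_add_min_self r K) hmono₁ hmono₂ hC
        (fun i => (hx i).renewal) hY ⟨1, one_pos, fun e _ => ?_⟩
      rw [tsub_add_eq_add_tsub h]
    · refine fun W ε hε => exists_window (y := fun i u => -(x i u : ℝ)) hn₂ Λ.2 (Or.inr hlip) ?_ W hε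
      refine propagate_lower (fun r => (add_comm _ _).trans (tsub_add_min_self r K)) hmono₂ hmono₁
        hC (renewal_swap hx) hY ⟨K - Y, tsub_pos_of_lt h, fun e he => ?_⟩
      have : Y + e ≤ K := by
        have := add_le_add_right he Y
        rwa [add_tsub_cancel_of_le h.le] at this
      rw [min_eq_left h.le, min_eq_left this]
  have bound : ∀ (n : Measure ℝ≥0) (φ : ℝ≥0 → ℝ≥0) (c U W : ℝ≥0), (∀ s ≤ W, φ s ≤ c) →
      (∀ s, φ s ≤ C) → ∫⁻ s in Iic U, φ s * n (Ioi s) ∂lebesgue ≤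
        c * ∫⁻ s, n (Ioi s) ∂lebesgue + C * ∫⁻ s in Ioi W, n (Ioi s) ∂lebesgue := by
    intro n φ c U W h1 h2
    rw [← lintegral_const_mul _ (measurable_tail n), ← lintegral_const_mul _ (measurable_tail n),
      ← lintegral_indicator measurableSet_Ioi, ← lintegral_add_left
        ((measurable_tail n).const_mul _)]
    refine (setLIntegral_le_lintegral _ _).trans (lintegral_mono fun s => ?_)
    rcases le_or_gt s W with h | h
    · refine le_trans ?_ le_self_add
      gcongr
      exact h1 s h
    · rw [indicator_of_mem (s := Ioi W) h]
      refine le_trans ?_ le_add_self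
      gcongr
      exact h2 s
  have step : ∀ W δ : ℝ≥0, 0 < δ → w ≤ (Y + δ - K : ℝ≥0) * ∫⁻ s, n₁ (Ioi s) ∂lebesgue +
      (min (Y + δ) K : ℝ≥0) * ∫⁻ s, n₂ (Ioi s) ∂lebesgue + 2 * δ +
      (C * ∫⁻ s in Ioi W, n₁ (Ioi s) ∂lebesgue + C * ∫⁻ s in Ioi W, n₂ (Ioi s) ∂lebesgue) := by
    intro W δ hδ
    obtain ⟨ε', hε', V, hwin⟩ := window W (NNReal.coe_pos.2 hδ)
    have hδE : (0 : ℝ≥0∞) < δ := ENNReal.coe_pos.2 hδ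
    have hwi : ∀ᶠ p in L ×ˢ (atTop : Filter ℝ≥0), w - δ ≤ ∫⁻ s, G p.1 (Ioi s) ∂lebesgue :=
      tendsto_fst.eventually (((ENNReal.tendsto_nhds hwfin).1 hw δ hδE).mono fun i hi => hi.1)
    have hshift : Tendsto (fun p : ι × ℝ≥0 => (p.1, p.2 - V))
        (L ×ˢ (atTop : Filter ℝ≥0)) (L ×ˢ atTop) :=
      tendsto_fst.prodMk ((tendsto_atTop_mono (fun x => le_rfl)
        (tendsto_atTop.2 fun b => (eventually_ge_atTop (b + V)).mono fun x hx =>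
          le_tsub_of_add_le_right hx)).comp tendsto_snd)
    have htail : ∀ᶠ p in L ×ˢ (atTop : Filter ℝ≥0),
        ∫⁻ s in Ioi (p.2 - V), G p.1 (Ioi s) ∂lebesgue ≤ δ :=
      hshift.eventually (ENNReal.tendsto_nhds_zero.1 hG δ hδE)
    obtain ⟨p, hp1, hp2, hp3, hp4⟩ :=
      ((hfreq ε' hε').and_eventually (hwin.and (hwi.and htail))).exists
    have hup : ∀ s ≤ W, x p.1 (p.2 - V - s) ≤ Y + δ := fun s hs => by
      have := hp2 (by linarith) s hs
      rw [← NNReal.coe_le_coe, NNReal.coe_add]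
      linarith
    have hsplit : ∫⁻ s, G p.1 (Ioi s) ∂lebesgue = ∫⁻ s in Iic (p.2 - V), G p.1 (Ioi s) ∂lebesgue +
        ∫⁻ s in Ioi (p.2 - V), G p.1 (Ioi s) ∂lebesgue := by
      rw [← lintegral_add_compl _ (measurableSet_Iic (a := p.2 - V)), compl_Iic]
    rw [hsplit, ← (hx p.1).conservation] at hp3
    have b1 := bound n₁ (fun s => x p.1 (p.2 - V - s) - K) (Y + δ - K) (p.2 - V) W
      (fun s hs => hmono₁ (hup s hs)) (fun s => tsub_le_self.trans (hC _ _))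
    have b2 := bound n₂ (fun s => min (x p.1 (p.2 - V - s)) K) (min (Y + δ) K) (p.2 - V) W
      (fun s hs => hmono₂ (hup s hs)) (fun s => (min_le_left _ _).trans (hC _ _))
    refine (tsub_le_iff_right.1 hp3).trans ((add_le_add_left (add_le_add (add_le_add b1 b2) hp4)
      _).trans (le_of_eq ?_))
    ring
  have htails : ∀ (n : Measure ℝ≥0), ∫⁻ s, n (Ioi s) ∂lebesgue ≠ ∞ →
      Tendsto (fun W => ∫⁻ s in Ioi W, n (Ioi s) ∂lebesgue) atTop (𝓝 0) := by
    intro n hn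
    have h1 := ENNReal.Tendsto.sub (tendsto_const_nhds (x := ∫⁻ s, n (Ioi s) ∂lebesgue))
      (tendsto_lintegral_Iic (measurable_tail n)) (Or.inl hn)
    rw [tsub_self] at h1
    refine h1.congr fun W => ?_
    have hne : ∫⁻ s in Iic W, n (Ioi s) ∂lebesgue ≠ ∞ :=
      ne_top_of_le_ne_top hn (setLIntegral_le_lintegral _ _)
    rw [← lintegral_add_compl _ (measurableSet_Iic (a := W)), compl_Iic,
      ENNReal.add_sub_cancel_left hne]
  have step2 : ∀ δ : ℝ≥0, 0 < δ → w ≤ (Y + δ - K : ℝ≥0) * ∫⁻ s, n₁ (Ioi s) ∂lebesgue +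
      (min (Y + δ) K : ℝ≥0) * ∫⁻ s, n₂ (Ioi s) ∂lebesgue + 2 * δ := by
    intro δ hδ
    have hl := (tendsto_const_nhds (x := (Y + δ - K : ℝ≥0) * ∫⁻ s, n₁ (Ioi s) ∂lebesgue +
      (min (Y + δ) K : ℝ≥0) * ∫⁻ s, n₂ (Ioi s) ∂lebesgue + 2 * δ)).add
      ((ENNReal.Tendsto.const_mul (htails n₁ hβ₁) (Or.inr (ENNReal.coe_ne_top (r := C)))).add
      (ENNReal.Tendsto.const_mul (htails n₂ hβ₂) (Or.inr (ENNReal.coe_ne_top (r := C)))))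
    simp only [mul_zero, add_zero] at hl
    exact ge_of_tendsto' hl fun W => step W δ hδ
  have hl : Tendsto (fun δ : ℝ≥0 => ((Y + δ - K : ℝ≥0) : ℝ≥0∞) * ∫⁻ s, n₁ (Ioi s) ∂lebesgue
      + (min (Y + δ) K : ℝ≥0) * ∫⁻ s, n₂ (Ioi s) ∂lebesgue + 2 * δ) (𝓝[>] 0)
      (𝓝 ((Y + 0 - K : ℝ≥0) * ∫⁻ s, n₁ (Ioi s) ∂lebesgue
      + (min (Y + 0) K : ℝ≥0) * ∫⁻ s, n₂ (Ioi s) ∂lebesgue + 2 * (0 : ℝ≥0))) := by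
    refine Tendsto.mono_left ?_ nhdsWithin_le_nhds
    refine Tendsto.add (Tendsto.add
      (ENNReal.Tendsto.mul_const (ENNReal.tendsto_coe.2 ?_) (Or.inr hβ₁))
      (ENNReal.Tendsto.mul_const (ENNReal.tendsto_coe.2 ?_) (Or.inr hβ₂)))
      (ENNReal.Tendsto.const_mul (ENNReal.tendsto_coe.2 tendsto_id) (Or.inr (by simp)))
    · exact Continuous.tendsto (f := fun ε : ℝ≥0 => Y + ε - K) (by fun_prop) 0
    · exact Continuous.tendsto (f := fun ε : ℝ≥0 => min (Y + ε) K) (by fun_prop) 0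
  simp only [add_zero, ENNReal.coe_zero, mul_zero] at hl
  exact ge_of_tendsto hl (eventually_mem_nhdsWithin.mono fun δ hδ => step2 δ hδ)

/-- With F(r) = (r-K)⁺β₁ + (r∧K)β₂, βᵢ being the mean of nᵢ, the two work estimates read F(limsup) ≤
w = F(X) ≤ F(liminf), and F is strictly increasing when β₂ is finite. When β₂ = ∞, the first
estimate alone forces limsup = 0. -/
theorem tendsto_renewal [NeBot L] (hx : ∀ i, RenewalSolution K Λ n₁ n₂ (G i) (x i))
    (hn₁ : NotLattice n₁) (hn₂ : NotLattice n₂) (hC : ∀ i u, x i u ≤ C) (hK : 0 < K)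
    (hβ₁ : ∫⁻ s, n₁ (Ioi s) ∂lebesgue ≠ ∞) (hβ₁0 : ∫⁻ s, n₁ (Ioi s) ∂lebesgue ≠ 0)
    (hβ₂0 : ∫⁻ s, n₂ (Ioi s) ∂lebesgue ≠ 0) (hwfin : w ≠ ∞)
    (hw : Tendsto (fun i => ∫⁻ s, G i (Ioi s) ∂lebesgue) L (𝓝 w))
    (hg : Tendsto (fun p : ι × ℝ≥0 => (G p.1 (Ioi p.2)).toReal) (L ×ˢ atTop) (𝓝 0))
    (hG : Tendsto (fun p : ι × ℝ≥0 => ∫⁻ s in Ioi p.2, G p.1 (Ioi s) ∂lebesgue) (L ×ˢ atTop) (𝓝 0))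
    {X : ℝ≥0} (hX : ∫⁻ s, n₂ (Ioi s) ∂lebesgue = ∞ → X = 0)
    (hX' : ∫⁻ s, n₂ (Ioi s) ∂lebesgue ≠ ∞ → (X - K : ℝ≥0) * ∫⁻ s, n₁ (Ioi s) ∂lebesgue +
      (min X K : ℝ≥0) * ∫⁻ s, n₂ (Ioi s) ∂lebesgue = w) :
    Tendsto (fun p : ι × ℝ≥0 => x p.1 p.2) (L ×ˢ atTop) (𝓝 X) := by
  set F := L ×ˢ (atTop : Filter ℝ≥0) with hF
  set f : ι × ℝ≥0 → ℝ≥0 := fun p => x p.1 p.2 with hf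
  have hbdd : IsBoundedUnder (· ≤ ·) F f := isBoundedUnder_of ⟨C, fun p => hC _ _⟩
  have hbdd' : IsBoundedUnder (· ≥ ·) F f := isBoundedUnder_of ⟨0, fun p => zero_le⟩
  set Y := limsup f F with hYdef
  set y := liminf f F with hydef
  have hyY : y ≤ Y := liminf_le_limsup hbdd hbdd'
  have hup : ∀ δ : ℝ≥0, 0 < δ → ∀ᶠ p in F, x p.1 p.2 ≤ Y + δ := fun δ hδ =>
    (eventually_lt_of_limsup_lt (lt_add_of_pos_right Y hδ) hbdd).mono fun p hp => hp.le
  have hupf : ∀ δ : ℝ, 0 < δ → ∃ᶠ p in F, (Y : ℝ) - δ ≤ x p.1 p.2 := fun δ hδ => by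
    rcases eq_or_ne Y 0 with h | h
    · refine (Eventually.of_forall fun p => ?_).frequently
      rw [h, NNReal.coe_zero]
      have : (0 : ℝ) ≤ x p.1 p.2 := (x p.1 p.2).2
      linarith
    · have hlt : Y - δ.toNNReal < Y :=
        tsub_lt_self (pos_iff_ne_zero.2 h) (Real.toNNReal_pos.2 hδ)
      refine (frequently_lt_of_lt_limsup hbdd'.isCoboundedUnder_le hlt).mono fun p hp => ?_
      have := NNReal.coe_le_coe.2 (tsub_le_iff_right.1 hp.le)
      rw [NNReal.coe_add, Real.coe_toNNReal _ hδ.le] at this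
      linarith
  have hlo : ∀ δ : ℝ≥0, 0 < δ → ∀ᶠ p in F, y - δ ≤ x p.1 p.2 := fun δ hδ => by
    rcases eq_or_ne y 0 with h | h
    · exact Eventually.of_forall fun p => by simp [h]
    · exact (eventually_lt_of_lt_liminf (tsub_lt_self (pos_iff_ne_zero.2 h) hδ) hbdd').mono
        fun p hp => hp.le
  have hlof : ∀ δ : ℝ, 0 < δ → ∃ᶠ p in F, (x p.1 p.2 : ℝ) ≤ y + δ := fun δ hδ => by
    have hlt : y < y + δ.toNNReal := lt_add_of_pos_right _ (Real.toNNReal_pos.2 hδ)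
    refine (frequently_lt_of_liminf_lt hbdd.isCoboundedUnder_ge hlt).mono fun p hp => ?_
    have := NNReal.coe_le_coe.2 hp.le
    rwa [NNReal.coe_add, Real.coe_toNNReal _ hδ.le] at this
  have h1 := limsup_workload_le hx hn₁ hn₂ hC hw hg hup hupf
  have hmonoY : Y ≤ X → X ≤ y → Tendsto f F (𝓝 X) := fun h2 h3 =>
    tendsto_of_liminf_eq_limsup (le_antisymm (hyY.trans h2) h3)
      (le_antisymm h2 (h3.trans hyY)) hbdd hbdd'
  by_cases hβ₂ : ∫⁻ s, n₂ (Ioi s) ∂lebesgue = ∞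
  · have hY0 : Y = 0 := by
      have h2 : (min Y K : ℝ≥0) * ∫⁻ s, n₂ (Ioi s) ∂lebesgue ≠ ∞ :=
        ne_top_of_le_ne_top hwfin (le_add_self.trans h1)
      rw [hβ₂] at h2
      by_contra hne
      refine h2 (ENNReal.mul_top ?_)
      rw [ENNReal.coe_ne_zero]
      exact (lt_min (pos_iff_ne_zero.2 hne) hK).ne'
    exact hmonoY (hY0.trans_le zero_le) ((hX hβ₂).trans_le zero_le)
  · have h2 := le_liminf_workload hx hn₁ hn₂ hC hβ₁ hβ₂ hwfin hw hG hlo hlof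
    have hstrict : ∀ a b : ℝ≥0, a < b → (a - K : ℝ≥0) * ∫⁻ s, n₁ (Ioi s) ∂lebesgue +
        (min a K : ℝ≥0) * ∫⁻ s, n₂ (Ioi s) ∂lebesgue < (b - K : ℝ≥0) * ∫⁻ s, n₁ (Ioi s) ∂lebesgue +
        (min b K : ℝ≥0) * ∫⁻ s, n₂ (Ioi s) ∂lebesgue := by
      intro a b hab
      rcases lt_or_ge a K with h | h
      · refine ENNReal.add_lt_add_of_le_of_lt (by finiteness) ?_ ?_
        · gcongr
        · rw [ENNReal.mul_lt_mul_iff_left hβ₂0 hβ₂, ENNReal.coe_lt_coe, min_eq_left h.le]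
          exact lt_min hab h
      · refine ENNReal.add_lt_add_of_lt_of_le (by finiteness) ?_ ?_
        · rw [ENNReal.mul_lt_mul_iff_left hβ₁0 hβ₁, ENNReal.coe_lt_coe]
          exact tsub_lt_tsub_right_of_le h hab
        · gcongr
    refine hmonoY (not_lt.1 fun h => ?_) (not_lt.1 fun h => ?_)
    · exact absurd (h1.trans (hX' hβ₂).ge) (not_le.2 (hstrict _ _ h))
    · exact absurd ((hX' hβ₂).le.trans h2) (not_le.2 (hstrict _ _ h))

end Limit

/-! ### The clock as a measure, and work done up to a clock level. -/

/-- Testing the Prohorov inequalities on the whole space. This passes one-sided limits of the state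
on to Q and Z. -/
theorem lipschitzWith_mass :
    LipschitzWith 1 fun s : LevyProkhorov FinMeas => s.toMeasure.mass := by
  intro a b
  rw [ENNReal.coe_one, one_mul]
  refine le_of_forall_gt_imp_ge_of_dense fun c hc => ?_
  have h1 := left_measure_le_of_levyProkhorovEDist_lt (B := univ) hc MeasurableSet.univ
  have h2 := right_measure_le_of_levyProkhorovEDist_lt (B := univ) hc MeasurableSet.univ
  have h1' : (a.toMeasure.mass : ℝ≥0∞) ≤ b.toMeasure.mass + c := by
    rw [FiniteMeasure.ennreal_mass, FiniteMeasure.ennreal_mass]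
    exact h1.trans (add_le_add (measure_mono (subset_univ _)) le_rfl)
  have h2' : (b.toMeasure.mass : ℝ≥0∞) ≤ a.toMeasure.mass + c := by
    rw [FiniteMeasure.ennreal_mass, FiniteMeasure.ennreal_mass]
    exact h2.trans (add_le_add (measure_mono (subset_univ _)) le_rfl)
  rcases eq_or_ne c ∞ with rfl | hcne
  · exact le_top
  lift c to ℝ≥0 using hcne
  rw [edist_nndist, ENNReal.coe_le_coe, ← NNReal.coe_le_coe, coe_nndist, NNReal.dist_eq, abs_le]
  have h1'' : a.toMeasure.mass ≤ b.toMeasure.mass + c := by exact_mod_cast h1'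
  have h2'' : b.toMeasure.mass ≤ a.toMeasure.mass + c := by exact_mod_cast h2'
  rw [← NNReal.coe_le_coe, NNReal.coe_add] at h1'' h2''
  constructor <;> linarith

theorem continuous_buffer_mass : Continuous fun s : State => s.buffer.mass :=
  lipschitzWith_mass.continuous.comp continuous_fst

theorem continuous_server_mass : Continuous fun s : State => s.server.mass :=
  lipschitzWith_mass.continuous.comp continuous_snd

/-- The tail of a measure, as a function on `[0, ∞]`. -/
noncomputable def tailAt (n : Measure ℝ≥0) (a : ℝ≥0∞) : ℝ≥0∞ := n {x : ℝ≥0 | a < x}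

theorem antitone_tailAt (n : Measure ℝ≥0) : Antitone (tailAt n) := fun _ _ hab =>
  measure_mono fun _ hx => hab.trans_lt hx

theorem measurable_tailAt (n : Measure ℝ≥0) : Measurable (tailAt n) := (antitone_tailAt n).measurable

theorem tailAt_coe (n : Measure ℝ≥0) (a : ℝ≥0) : tailAt n a = n (Ioi a) := by
  simp only [tailAt, ENNReal.coe_lt_coe]; rfl

theorem tailAt_top (n : Measure ℝ≥0) : tailAt n ∞ = 0 := by
  simp [tailAt]

/-- The expected residual `∫ (x - a)⁺ dn(x)` as an integral of tails. -/
theorem lintegral_tailAt_add (n : Measure ℝ≥0) [SFinite n] (a : ℝ≥0∞) :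
    ∫⁻ y : ℝ≥0, tailAt n (y + a) ∂lebesgue = ∫⁻ x : ℝ≥0, ((x : ℝ≥0∞) - a) ∂n := by
  have hs : MeasurableSet {p : ℝ≥0 × ℝ≥0 | (p.1 : ℝ≥0∞) + a < p.2} :=
    measurableSet_lt (by fun_prop) (by fun_prop)
  have h1 := Measure.prod_apply (μ := lebesgue) (ν := n) hs
  have h2 := Measure.prod_apply_symm (μ := lebesgue) (ν := n) hs
  refine (h1.symm.trans h2).trans (lintegral_congr fun x => ?_)
  change lebesgue {y : ℝ≥0 | (y : ℝ≥0∞) + a < x} = _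
  rcases eq_or_ne a ∞ with rfl | ha
  · simp
  lift a to ℝ≥0 using ha
  rw [← ENNReal.coe_sub, ← lebesgue_Iio (x - a)]
  refine congrArg lebesgue (Set.ext fun y => ?_)
  simp only [mem_ofPred_eq, mem_Iio]
  rw [← ENNReal.coe_add, ENNReal.coe_lt_coe, lt_tsub_iff_right]

section Clock

variable (Ψ : ℝ≥0 → State)

/-- The measure `φ(Z(τ)) dτ`. -/
noncomputable def clock : Measure ℝ≥0 := lebesgue.withDensity fun τ => (Z Ψ τ : ℝ≥0∞)⁻¹

/-- The density is infinite where Z = 0, so finiteness of the clock on bounded intervals is not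
available at this stage; s-finiteness is enough for Tonelli. -/
instance : SFinite (clock Ψ) := by unfold clock; infer_instance

theorem clock_Ioc (s t : ℝ≥0) : clock Ψ (Ioc s t) = S Ψ s t :=
  withDensity_apply _ measurableSet_Ioc

instance : NullSingletonClass (clock Ψ) := by unfold clock; infer_instance

theorem S_add {r s t : ℝ≥0} (hrs : r ≤ s) (hst : s ≤ t) : S Ψ r s + S Ψ s t = S Ψ r t := by
  rw [← clock_Ioc, ← clock_Ioc, ← clock_Ioc, ← measure_union
    (Set.disjoint_left.2 fun a ha hb => not_lt.2 ha.2 hb.1) measurableSet_Ioc,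
    Ioc_union_Ioc_eq_Ioc hrs hst]

theorem S_self (s : ℝ≥0) : S Ψ s s = 0 := by simp [S]

theorem monotone_S (s : ℝ≥0) : Monotone (S Ψ s) := fun _ _ h =>
  lintegral_mono_set (Ioc_subset_Ioc_right h)

theorem antitone_S (t : ℝ≥0) : Antitone fun s => S Ψ s t := fun _ _ h =>
  lintegral_mono_set (Ioc_subset_Ioc_left h)

/-- The set is an initial segment of (s, t]. If its supremum does not belong to it, it is exhausted
from the left by intervals of clock measure below x. This survives an explosion of the clock. -/
theorem clock_initial_le (s t : ℝ≥0) (x : ℝ≥0∞) :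
    clock Ψ (Ioc s t ∩ {r | S Ψ s r < x}) ≤ min x (S Ψ s t) := by
  refine le_min ?_ (by rw [← clock_Ioc]; exact measure_mono inter_subset_left)
  rcases le_or_gt t s with hts | hst
  · simp [Ioc_eq_empty_of_le hts]
  set E := Ioc s t ∩ {r | S Ψ s r < x} with hE
  have hsub : ∀ r ∈ E, Ioc s r ⊆ E := fun r hr q hq =>
    ⟨⟨hq.1, hq.2.trans hr.1.2⟩, lt_of_le_of_lt (monotone_S Ψ s hq.2) hr.2⟩
  rcases E.eq_empty_or_nonempty with he | hne
  · simp [he]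
  have hb : BddAbove E := ⟨t, fun r hr => hr.1.2⟩
  by_cases hmem : sSup E ∈ E
  · have : E = Ioc s (sSup E) := Subset.antisymm (fun r hr => ⟨hr.1.1, le_csSup hb hr⟩) (hsub _ hmem)
    rw [this, clock_Ioc]
    exact hmem.2.le
  · obtain ⟨a, ha⟩ := hne
    have hEeq : E = Ioo s (sSup E) := by
      refine Subset.antisymm (fun r hr => ⟨hr.1.1, lt_of_le_of_ne (le_csSup hb hr) ?_⟩) fun r hr => ?_
      · rintro rfl; exact hmem hr
      · obtain ⟨b, hb, hrb⟩ := exists_lt_of_lt_csSup ⟨a, ha⟩ hr.2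
        exact hsub b hb ⟨hr.1, hrb.le⟩
    have hslt : s < sSup E := ha.1.1.trans_le (le_csSup hb ha)
    obtain ⟨v, hvmono, hvlt, hvlim⟩ := exists_seq_strictMono_tendsto' hslt
    have hunion : E = ⋃ k, Ioc s (v k) := by
      rw [hEeq]
      ext r
      simp only [mem_Ioo, mem_iUnion, mem_Ioc, exists_and_left]
      constructor
      · rintro ⟨h1, h2⟩
        obtain ⟨k, hk⟩ := ((tendsto_order.1 hvlim).1 r h2).exists
        exact ⟨h1, k, hk.le⟩
      · rintro ⟨h1, k, hk⟩
        exact ⟨h1, hk.trans_lt (hvlt k).2⟩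
    rw [hunion, Monotone.measure_iUnion
      (fun i j hij => Ioc_subset_Ioc_right (hvmono.monotone hij))]
    refine iSup_le fun k => ?_
    rw [clock_Ioc]
    have : v k ∈ E := by rw [hEeq]; exact hvlt k
    exact this.2.le

/-- The complementary segment has clock measure at most S(s,t) - x, because its left end is
approached from within. Finiteness is essential: an exploding clock may jump over the level x to
infinity. -/
theorem clock_initial_eq {s t : ℝ≥0} (hfin : S Ψ s t ≠ ∞) (x : ℝ≥0∞) :
    clock Ψ (Ioc s t ∩ {r | S Ψ s r < x}) = min x (S Ψ s t) := by
  refine le_antisymm (clock_initial_le Ψ s t x) ?_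
  rcases lt_or_ge (S Ψ s t) x with hx | hx
  · have : Ioc s t ∩ {r | S Ψ s r < x} = Ioc s t :=
      inter_eq_left.2 fun r hr => (monotone_S Ψ s hr.2).trans_lt hx
    rw [this, clock_Ioc]
    exact min_le_right _ _
  rw [min_eq_left hx]
  rcases le_or_gt t s with hts | hst
  · have h0 : S Ψ s t = 0 := by simp [S, Ioc_eq_empty_of_le hts]
    rw [h0, nonpos_iff_eq_zero] at hx
    simp [hx]
  set D := Ioc s t ∩ {r | x ≤ S Ψ s r} with hD
  have hcompl : clock Ψ (Ioc s t ∩ {r | S Ψ s r < x}) + clock Ψ D = S Ψ s t := by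
    have hm : MeasurableSet {r | S Ψ s r < x} :=
      measurableSet_lt (monotone_S Ψ s).measurable measurable_const
    rw [← clock_Ioc, ← measure_inter_add_sdiff (Ioc s t) hm]
    congr 2
    ext r
    simp [hD]
  have hDle : clock Ψ D ≤ S Ψ s t - x := by
    have htD : t ∈ D := ⟨⟨hst, le_rfl⟩, hx⟩
    have key : ∀ r ∈ D, clock Ψ (Ioc r t) ≤ S Ψ s t - x := fun r hr => by
      rw [clock_Ioc]
      refine ENNReal.le_sub_of_add_le_left (ne_top_of_le_ne_top hfin hx) ?_
      rw [← S_add Ψ hr.1.1.le hr.1.2]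
      exact add_le_add hr.2 le_rfl
    have hb : BddBelow D := ⟨s, fun r hr => hr.1.1.le⟩
    have hIcc : ∀ r ∈ D, Icc r t ⊆ D := fun r hr q hq =>
      ⟨⟨hr.1.1.trans_le hq.1, hq.2⟩, le_trans hr.2 (monotone_S Ψ s hq.1)⟩
    by_cases hmem : sInf D ∈ D
    · have : D ⊆ Icc (sInf D) t := fun r hr => ⟨csInf_le hb hr, hr.1.2⟩
      refine (measure_mono this).trans ?_
      rw [← measure_congr Ioc_ae_eq_Icc]
      exact key _ hmem
    · have hlt : sInf D < t := lt_of_le_of_ne (csInf_le hb htD) fun h => hmem (h ▸ htD)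
      obtain ⟨v, hvanti, hvlt, hvlim⟩ := exists_seq_strictAnti_tendsto' hlt
      have hvD : ∀ k, v k ∈ D := fun k => by
        obtain ⟨b, hb', hbv⟩ := exists_lt_of_csInf_lt ⟨t, htD⟩ (hvlt k).1
        exact hIcc b hb' ⟨hbv.le, (hvlt k).2.le⟩
      have hsub : D ⊆ ⋃ k, Ioc (v k) t := fun r hr => by
        have : sInf D < r := lt_of_le_of_ne (csInf_le hb hr) fun h => hmem (h ▸ hr)
        obtain ⟨k, hk⟩ := ((tendsto_order.1 hvlim).2 r this).exists
        exact mem_iUnion.2 ⟨k, hk, hr.1.2⟩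
      refine (measure_mono hsub).trans ?_
      rw [Monotone.measure_iUnion (fun i j hij => Ioc_subset_Ioc_left (hvanti.antitone hij))]
      exact iSup_le fun k => key _ (hvD k)
  have hxne : x ≠ ∞ := ne_top_of_le_ne_top hfin hx
  have h3 : x + (S Ψ s t - x) ≤ clock Ψ (Ioc s t ∩ {r | S Ψ s r < x}) + (S Ψ s t - x) := by
    rw [add_tsub_cancel_of_le hx, ← hcompl]
    refine add_le_add le_rfl (hDle.trans ?_)
    rw [hcompl]
  exact (ENNReal.add_le_add_iff_right (ne_top_of_le_ne_top hfin tsub_le_self)).1 h3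

variable (n : Measure ℝ≥0) [SFinite n]

theorem lintegral_tail_clock (s t : ℝ≥0) :
    ∫⁻ r in Ioc s t, tailAt n (S Ψ s r) ∂clock Ψ =
      ∫⁻ x : ℝ≥0, clock Ψ (Ioc s t ∩ {r | S Ψ s r < x}) ∂n := by
  have hs : MeasurableSet {p : ℝ≥0 × ℝ≥0 | S Ψ s p.1 < p.2} :=
    measurableSet_lt ((monotone_S Ψ s).measurable.comp measurable_fst) (by fun_prop)
  have h1 := Measure.prod_apply (μ := (clock Ψ).restrict (Ioc s t)) (ν := n) hs
  have h2 := Measure.prod_apply_symm (μ := (clock Ψ).restrict (Ioc s t)) (ν := n) hs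
  refine (h1.symm.trans h2).trans (lintegral_congr fun x => ?_)
  rw [Measure.restrict_apply (measurable_prodMk_right hs), inter_comm]
  rfl

/-- Work done up to time `t` plus residual work. -/
theorem residual_add_work_le (s t : ℝ≥0) :
    ∫⁻ y : ℝ≥0, tailAt n (y + S Ψ s t) ∂lebesgue + ∫⁻ r in Ioc s t, tailAt n (S Ψ s r) ∂clock Ψ ≤
      ∫⁻ x : ℝ≥0, (x : ℝ≥0∞) ∂n := by
  rw [lintegral_tailAt_add, lintegral_tail_clock, ← lintegral_add_left (by fun_prop)]
  refine lintegral_mono fun x => (add_le_add le_rfl (clock_initial_le Ψ s t x)).trans ?_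
  rcases le_total (x : ℝ≥0∞) (S Ψ s t) with h | h
  · rw [tsub_eq_zero_of_le h, zero_add, min_eq_left h]
  · rw [min_eq_right h, tsub_add_cancel_of_le h]

theorem residual_add_work_eq {s t : ℝ≥0} (hfin : S Ψ s t ≠ ∞) :
    ∫⁻ y : ℝ≥0, tailAt n (y + S Ψ s t) ∂lebesgue + ∫⁻ r in Ioc s t, tailAt n (S Ψ s r) ∂clock Ψ =
      ∫⁻ x : ℝ≥0, (x : ℝ≥0∞) ∂n := by
  rw [lintegral_tailAt_add, lintegral_tail_clock, ← lintegral_add_left (by fun_prop)]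
  refine lintegral_congr fun x => ?_
  rw [clock_initial_eq Ψ hfin]
  rcases le_total (x : ℝ≥0∞) (S Ψ s t) with h | h
  · rw [tsub_eq_zero_of_le h, zero_add, min_eq_left h]
  · rw [min_eq_right h, tsub_add_cancel_of_le h]

end Clock

theorem measurable_S (Ψ : ℝ≥0 → State) (hZ : Measurable (Z Ψ)) :
    Measurable fun p : ℝ≥0 × ℝ≥0 => S Ψ p.1 p.2 := by
  have : (fun p : ℝ≥0 × ℝ≥0 => S Ψ p.1 p.2) = fun p : ℝ≥0 × ℝ≥0 => ∫⁻ τ,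
      {q : (ℝ≥0 × ℝ≥0) × ℝ≥0 | q.1.1 < q.2 ∧ q.2 ≤ q.1.2}.indicator
        (fun q => (Z Ψ q.2 : ℝ≥0∞)⁻¹) (p, τ) ∂lebesgue := by
    funext p
    rw [S, ← lintegral_indicator measurableSet_Ioc]
    rfl
  rw [this]
  refine Measurable.lintegral_prod_right' (ν := lebesgue) (Measurable.indicator ?_ ?_)
  · exact (measurable_coe_nnreal_ennreal.comp (hZ.comp measurable_snd)).inv
  · exact (measurableSet_lt (by fun_prop) (by fun_prop)).inter
      (measurableSet_le (by fun_prop) (by fun_prop))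

/-! ### Fluid solutions: inflow, growth and workload balance. -/

section Fluid

variable {K lam : ℝ≥0} {ν : ProbabilityMeasure ℝ≥0} {ξ μ : FinMeas} {Ψ : ℝ≥0 → State}

namespace IsFluidSolution

theorem continuousWithinAt_Q (h : IsFluidSolution K lam ν ξ μ Ψ) (t : ℝ≥0) :
    ContinuousWithinAt (Q Ψ) (Ici t) t :=
  continuous_buffer_mass.continuousAt.comp_continuousWithinAt (h.cadlag.1 t)

theorem continuousWithinAt_Z (h : IsFluidSolution K lam ν ξ μ Ψ) (t : ℝ≥0) :
    ContinuousWithinAt (Z Ψ) (Ici t) t :=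
  continuous_server_mass.continuousAt.comp_continuousWithinAt (h.cadlag.1 t)

theorem stieltjes_eq (h : IsFluidSolution K lam ν ξ μ Ψ) (t : ℝ≥0) :
    h.mono.stieltjesFunction t = B lam Ψ t := by
  have hc : ContinuousWithinAt (B lam Ψ) (Ici t) t := by
    refine ContinuousWithinAt.sub (by fun_prop) ?_
    exact (NNReal.continuous_coe.continuousAt).comp_continuousWithinAt (h.continuousWithinAt_Q t)
  rw [h.mono.stieltjesFunction_eq]
  exact h.mono.continuousWithinAt_Ioi_iff_rightLim_eq.1 (continuousWithinAt_Ioi_iff_Ici.2 hc)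

/-- The Lebesgue–Stieltjes measure `dB`. -/
noncomputable def inflow (h : IsFluidSolution K lam ν ξ μ Ψ) : Measure ℝ≥0 :=
  h.mono.stieltjesFunction.measure

instance (h : IsFluidSolution K lam ν ξ μ Ψ) : IsLocallyFiniteMeasure h.inflow := by
  unfold inflow; infer_instance

theorem inflow_Ioc_add (h : IsFluidSolution K lam ν ξ μ Ψ) {s t : ℝ≥0} (hst : s ≤ t) :
    h.inflow (Ioc s t) + Q Ψ t = lam * (t - s : ℝ≥0) + Q Ψ s := by
  rw [inflow, StieltjesFunction.measure_Ioc, h.stieltjes_eq, h.stieltjes_eq]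
  have hB := h.mono hst
  rw [← ENNReal.ofReal_coe_nnreal (p := Q Ψ t), ← ENNReal.ofReal_add (sub_nonneg.2 hB) (NNReal.coe_nonneg _),
    ← ENNReal.coe_mul, ← ENNReal.coe_add, ← ENNReal.ofReal_coe_nnreal]
  congr 1
  push_cast [hst]
  simp only [B]
  ring

theorem inflow_zero (h : IsFluidSolution K lam ν ξ μ Ψ) : h.inflow {0} = 0 := by
  have := h.mono.stieltjesFunction.measure_botSet
  rwa [botSet_eq_singleton_of_isBot (x := (0 : ℝ≥0)) (fun _ => zero_le)] at this

theorem inflow_Iic (h : IsFluidSolution K lam ν ξ μ Ψ) (t : ℝ≥0) :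
    h.inflow (Iic t) = h.inflow (Ioc 0 t) := by
  have : Iic t = {0} ∪ Ioc 0 t := by
    ext x
    simp only [mem_Iic, mem_union, mem_singleton_iff, mem_Ioc]
    constructor
    · intro hx
      rcases eq_or_ne x 0 with h0 | h0
      · exact Or.inl h0
      · exact Or.inr ⟨pos_iff_ne_zero.2 h0, hx⟩
    · rintro (rfl | hx)
      · exact zero_le
      · exact hx.2
  refine le_antisymm ?_ (measure_mono Ioc_subset_Iic_self)
  rw [this]
  refine (measure_union_le _ _).trans ?_
  rw [h.inflow_zero, zero_add]

theorem server_tailAt (h : IsFluidSolution K lam ν ξ μ Ψ) (t : ℝ≥0) (a : ℝ≥0∞) :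
    tailAt (Ψ t).server a = tailAt μ (a + S Ψ 0 t) +
      ∫⁻ s in Iic t, tailAt ν (a + S Ψ s t) ∂h.inflow := by
  rcases eq_or_ne a ∞ with rfl | ha
  · simp [tailAt_top]
  lift a to ℝ≥0 using ha
  rw [tailAt_coe, h.server_dynamics]
  rfl

/-- The semigroup property: the server equation may be restarted at any time s from the server
measure at s. -/
theorem server_tailAt_of_le (h : IsFluidSolution K lam ν ξ μ Ψ) {s t : ℝ≥0} (hst : s ≤ t)
    (a : ℝ≥0∞) : tailAt (Ψ t).server a = tailAt (Ψ s).server (a + S Ψ s t) +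
      ∫⁻ r in Ioc s t, tailAt ν (a + S Ψ r t) ∂h.inflow := by
  have hd : Disjoint (Iic s) (Ioc s t) := Set.disjoint_left.2 fun a ha hb => not_lt.2 ha hb.1
  rw [h.server_tailAt t, h.server_tailAt s, ← Iic_union_Ioc_eq_Iic hst,
    lintegral_union measurableSet_Ioc hd,
    ← add_assoc, add_assoc a (S Ψ s t), add_comm (S Ψ s t), S_add Ψ zero_le hst]
  congr 2
  refine setLIntegral_congr_fun measurableSet_Iic fun r hr => ?_
  rw [add_assoc, add_comm (S Ψ s t), S_add Ψ hr hst]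

theorem coe_Z (h : IsFluidSolution K lam ν ξ μ Ψ) (t : ℝ≥0) :
    (Z Ψ t : ℝ≥0∞) = tailAt (Ψ t).server 0 := by
  have h0 : ((Ψ t).server : Measure ℝ≥0) {0} = 0 := by
    have := h.server_zero t
    rwa [FiniteMeasure.null_iff_toMeasure_null] at this
  have e : (univ : Set ℝ≥0) = {0} ∪ Ioi 0 := by
    ext x
    simp
  have e2 := tailAt_coe (Ψ t).server 0
  rw [ENNReal.coe_zero] at e2
  rw [e2, Z, FiniteMeasure.ennreal_mass, e]
  refine le_antisymm ((measure_union_le _ _).trans (by rw [h0, zero_add]))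
    (measure_mono subset_union_right)

/-- Mass in service at t is at most the mass at s plus the inflow, and transfers from the buffer to
the server cancel in the total. Only exogenous arrivals at rate λ can increase X. -/
theorem X_add_le (h : IsFluidSolution K lam ν ξ μ Ψ) {s t : ℝ≥0} (hst : s ≤ t) :
    X Ψ t ≤ X Ψ s + lam * (t - s) := by
  have h1 : (Z Ψ t : ℝ≥0∞) ≤ Z Ψ s + h.inflow (Ioc s t) := by
    rw [h.coe_Z, h.coe_Z, h.server_tailAt_of_le hst]
    refine add_le_add (antitone_tailAt _ zero_le) ?_
    refine (lintegral_mono (g := fun _ => 1) fun r => prob_le_one).trans ?_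
    rw [lintegral_const, one_mul, Measure.restrict_apply_univ]
  have h2 := h.inflow_Ioc_add hst
  have h3 : (X Ψ t : ℝ≥0∞) ≤ X Ψ s + lam * (t - s : ℝ≥0) := by
    rw [X, X]
    push_cast
    calc (Q Ψ t : ℝ≥0∞) + Z Ψ t ≤ Q Ψ t + (Z Ψ s + h.inflow (Ioc s t)) := by gcongr
      _ = Z Ψ s + (h.inflow (Ioc s t) + Q Ψ t) := by ring
      _ = _ := by rw [h2]; push_cast; ring
  exact_mod_cast h3

/-- By `X_add_le`, X minus a linear function is antitone, hence measurable. -/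
theorem measurable_X (h : IsFluidSolution K lam ν ξ μ Ψ) : Measurable (X Ψ) := by
  have hanti : Antitone fun t => (X Ψ t : ℝ) - lam * t := by
    intro s t hst
    have := NNReal.coe_le_coe.2 (h.X_add_le hst)
    push_cast [hst] at this
    simp only
    linarith
  have h2 : Measurable fun t => (X Ψ t : ℝ) := by
    have e : (fun t => (X Ψ t : ℝ)) = fun t => ((X Ψ t : ℝ) - lam * t) + lam * t := by
      funext t; ring
    rw [e]
    exact hanti.measurable.add (by fun_prop)
  have e : X Ψ = fun t => ((X Ψ t : ℝ)).toNNReal := by funext t; simp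
  rw [e]
  exact h2.real_toNNReal

theorem measurable_Z (h : IsFluidSolution K lam ν ξ μ Ψ) : Measurable (Z Ψ) := by
  have : Z Ψ = fun t => min (X Ψ t) K := funext h.policy_server
  rw [this]
  exact h.measurable_X.min measurable_const

/-- The workload. -/
noncomputable def work (ν : ProbabilityMeasure ℝ≥0) (Ψ : ℝ≥0 → State) (t : ℝ≥0) : ℝ≥0∞ :=
  ∫⁻ x : ℝ≥0, (x : ℝ≥0∞) ∂((Ψ t).server : Measure ℝ≥0) + Q Ψ t * meanSize ν

theorem server_moment (h : IsFluidSolution K lam ν ξ μ Ψ) {s t : ℝ≥0} (hst : s ≤ t) :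
    ∫⁻ x : ℝ≥0, (x : ℝ≥0∞) ∂((Ψ t).server : Measure ℝ≥0) =
      ∫⁻ y : ℝ≥0, tailAt (Ψ s).server (y + S Ψ s t) ∂lebesgue +
        ∫⁻ v in Ioc s t, ∫⁻ y : ℝ≥0, tailAt ν (y + S Ψ v t) ∂lebesgue ∂h.inflow := by
  have hSt : Measurable fun v => S Ψ v t := (antitone_S Ψ t).measurable
  have hm1 : Measurable (Function.uncurry fun (y : ℝ≥0) v => tailAt ν (y + S Ψ v t)) :=
    (measurable_tailAt _).comp
      ((measurable_coe_nnreal_ennreal.comp measurable_fst).add (hSt.comp measurable_snd))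
  rw [← lintegral_tail]
  simp_rw [← tailAt_coe]
  rw [lintegral_lintegral_swap (f := fun (v y : ℝ≥0) => tailAt ν (y + S Ψ v t))
    (hm1.comp measurable_swap).aemeasurable,
    ← lintegral_add_left (f := fun y : ℝ≥0 => tailAt (Ψ s).server (y + S Ψ s t))
      ((measurable_tailAt _).comp (f := fun y : ℝ≥0 => (y : ℝ≥0∞) + S Ψ s t) (by fun_prop))]
  exact lintegral_congr fun y => h.server_tailAt_of_le hst y

/-- Apply Tonelli to the residual work at t and to the work done ∫ Z d(clock). Grouped by origin of
the mass, both become, for each job, residual size plus service received. -/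
theorem work_identity (h : IsFluidSolution K lam ν ξ μ Ψ) {s t : ℝ≥0} (hst : s ≤ t) :
    work ν Ψ t + ∫⁻ r in Ioc s t, Z Ψ r ∂clock Ψ =
      (∫⁻ y : ℝ≥0, tailAt (Ψ s).server (y + S Ψ s t) ∂lebesgue +
        ∫⁻ r in Ioc s t, tailAt (Ψ s).server (S Ψ s r) ∂clock Ψ) +
      ∫⁻ v in Ioc s t, (∫⁻ y : ℝ≥0, tailAt ν (y + S Ψ v t) ∂lebesgue +
        ∫⁻ r in Ioc v t, tailAt ν (S Ψ v r) ∂clock Ψ) ∂h.inflow + Q Ψ t * meanSize ν := by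
  have hSm := measurable_S Ψ h.measurable_Z
  have hTm := measurable_tailAt (ν : Measure ℝ≥0)
  have hSt : Measurable fun v => S Ψ v t := (antitone_S Ψ t).measurable
  have hm1 : Measurable (Function.uncurry fun (y : ℝ≥0) v => tailAt ν (y + S Ψ v t)) :=
    hTm.comp ((measurable_coe_nnreal_ennreal.comp measurable_fst).add (hSt.comp measurable_snd))
  have hm2 : Measurable (Function.uncurry fun (r v : ℝ≥0) => (Ioc s r).indicator
      (fun v => tailAt ν (S Ψ v r)) v) := by
    refine Measurable.indicator (s := {p : ℝ≥0 × ℝ≥0 | s < p.2 ∧ p.2 ≤ p.1})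
      (f := fun p => tailAt ν (S Ψ p.2 p.1)) (hTm.comp (hSm.comp measurable_swap)) ?_
    exact (measurableSet_lt (by fun_prop) (by fun_prop)).inter
      (measurableSet_le (by fun_prop) (by fun_prop))
  have e2 : ∫⁻ r in Ioc s t, Z Ψ r ∂clock Ψ = ∫⁻ r in Ioc s t, tailAt (Ψ s).server (S Ψ s r) ∂clock Ψ +
      ∫⁻ v in Ioc s t, ∫⁻ r in Ioc v t, tailAt ν (S Ψ v r) ∂clock Ψ ∂h.inflow := by
    have e3 : ∀ r ∈ Ioc s t, (Z Ψ r : ℝ≥0∞) = tailAt (Ψ s).server (S Ψ s r) +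
        ∫⁻ v in Ioc s t, (Ioc s r).indicator (fun v => tailAt ν (S Ψ v r)) v ∂h.inflow := by
      intro r hr
      rw [h.coe_Z, h.server_tailAt_of_le hr.1.le, zero_add,
        setLIntegral_indicator measurableSet_Ioc, inter_eq_left.2 (Ioc_subset_Ioc_right hr.2)]
      simp only [zero_add]
    rw [setLIntegral_congr_fun measurableSet_Ioc e3, lintegral_add_left
      (f := fun r => tailAt (Ψ s).server (S Ψ s r))
      ((measurable_tailAt _).comp (monotone_S Ψ s).measurable),
      lintegral_lintegral_swap hm2.aemeasurable]
    congr 1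
    refine setLIntegral_congr_fun measurableSet_Ioc fun v hv => ?_
    have : ∀ r, (Ioc s r).indicator (fun v => tailAt ν (S Ψ v r)) v =
        (Ici v).indicator (fun r => tailAt ν (S Ψ v r)) r := by
      intro r
      by_cases hvr : v ≤ r
      · rw [indicator_of_mem (s := Ioc s r) ⟨hv.1, hvr⟩, indicator_of_mem (s := Ici v) hvr]
      · rw [indicator_of_notMem (s := Ioc s r) (fun h => hvr h.2),
          indicator_of_notMem (s := Ici v) hvr]
    simp_rw [this]
    rw [setLIntegral_indicator measurableSet_Ici]
    have : Ici v ∩ Ioc s t = Icc v t := by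
      ext r
      simp only [mem_inter_iff, mem_Ici, mem_Ioc, mem_Icc]
      exact ⟨fun h => ⟨h.1, h.2.2⟩, fun h => ⟨h.1, hv.1.trans_le h.1, h.2⟩⟩
    rw [this]
    exact setLIntegral_congr Ioc_ae_eq_Icc.symm
  have hm3 : Measurable fun v => ∫⁻ y : ℝ≥0, tailAt ν (y + S Ψ v t) ∂lebesgue :=
    Measurable.lintegral_prod_right' (ν := lebesgue)
      (f := fun p : ℝ≥0 × ℝ≥0 => tailAt ν (p.2 + S Ψ p.1 t)) (hm1.comp measurable_swap)
  rw [work, h.server_moment hst, e2, lintegral_add_left hm3]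
  ring

theorem inflow_work (h : IsFluidSolution K lam ν ξ μ Ψ)
    (hload : (lam : ℝ≥0∞) * meanSize ν = 1) {s t : ℝ≥0} (hst : s ≤ t) :
    meanSize ν * h.inflow (Ioc s t) + Q Ψ t * meanSize ν = (t - s : ℝ≥0) + Q Ψ s * meanSize ν := by
  rw [mul_comm, ← add_mul, h.inflow_Ioc_add hst, add_mul, mul_right_comm, hload, one_mul]

/-- Each job contributes at most its size to residual plus service, and λβ = 1 makes work arrive at
unit rate. With a finite clock `work_eq` gives equality; the inequality is what remains when the
clock may be infinite. -/
theorem work_le (h : IsFluidSolution K lam ν ξ μ Ψ)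
    (hload : (lam : ℝ≥0∞) * meanSize ν = 1) {s t : ℝ≥0} (hst : s ≤ t) :
    work ν Ψ t + ∫⁻ r in Ioc s t, Z Ψ r ∂clock Ψ ≤ work ν Ψ s + (t - s : ℝ≥0) := by
  rw [h.work_identity hst]
  refine (add_le_add (add_le_add (residual_add_work_le Ψ _ s t) (lintegral_mono
    fun v => residual_add_work_le Ψ _ v t)) le_rfl).trans ?_
  rw [lintegral_const, Measure.restrict_apply_univ, add_assoc]
  change _ + (meanSize ν * _ + _) ≤ _
  rw [h.inflow_work hload hst, work, add_right_comm, add_assoc]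

theorem work_eq (h : IsFluidSolution K lam ν ξ μ Ψ)
    (hload : (lam : ℝ≥0∞) * meanSize ν = 1) {s t : ℝ≥0} (hst : s ≤ t)
    (hfin : S Ψ s t ≠ ∞) :
    work ν Ψ t + ∫⁻ r in Ioc s t, Z Ψ r ∂clock Ψ = work ν Ψ s + (t - s : ℝ≥0) := by
  rw [h.work_identity hst, residual_add_work_eq Ψ _ hfin, setLIntegral_congr_fun measurableSet_Ioc
    (fun v hv => residual_add_work_eq Ψ _ (ne_top_of_le_ne_top hfin (antitone_S Ψ t hv.1.le))),
    lintegral_const, Measure.restrict_apply_univ, add_assoc]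
  change _ + (meanSize ν * _ + _) = _
  rw [h.inflow_work hload hst, work, add_right_comm, add_assoc]

end IsFluidSolution

end Fluid

/-! ### The clock does not explode when there is work. -/

theorem clock_Ioo (Ψ : ℝ≥0 → State) (s t : ℝ≥0) : clock Ψ (Ioo s t) = S Ψ s t := by
  rw [← clock_Ioc, measure_congr Ioo_ae_eq_Ioc]

theorem tendsto_S_of_strictMono (Ψ : ℝ≥0 → State) {s t : ℝ≥0} {v : ℕ → ℝ≥0} (hv : StrictMono v)
    (hlt : ∀ k, v k < t) (hlim : Tendsto v atTop (𝓝 t)) :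
    Tendsto (fun k => S Ψ s (v k)) atTop (𝓝 (S Ψ s t)) := by
  have hu : (⋃ k, Ioc s (v k)) = Ioo s t := by
    ext r
    simp only [mem_iUnion, mem_Ioc, mem_Ioo, exists_and_left]
    constructor
    · rintro ⟨h1, k, hk⟩
      exact ⟨h1, hk.trans_lt (hlt k)⟩
    · rintro ⟨h1, h2⟩
      obtain ⟨k, hk⟩ := ((tendsto_order.1 hlim).1 r h2).exists
      exact ⟨h1, k, hk.le⟩
  have := tendsto_measure_iUnion_atTop (μ := clock Ψ) (s := fun k => Ioc s (v k))
    (fun i j hij => Ioc_subset_Ioc_right (hv.monotone hij))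
  rw [hu, clock_Ioo] at this
  simpa [Function.comp_def, clock_Ioc] using this

theorem tendsto_residual (n : Measure ℝ≥0) (hn : ∫⁻ x : ℝ≥0, (x : ℝ≥0∞) ∂n ≠ ∞) {a : ℕ → ℝ≥0∞}
    (ha : Tendsto a atTop (𝓝 ∞)) :
    Tendsto (fun k => ∫⁻ x : ℝ≥0, ((x : ℝ≥0∞) - a k) ∂n) atTop (𝓝 0) := by
  have := tendsto_lintegral_of_dominated_convergence (μ := n)
    (F := fun k (x : ℝ≥0) => (x : ℝ≥0∞) - a k) (f := fun _ => 0) (fun x : ℝ≥0 => (x : ℝ≥0∞))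
    (fun k => by fun_prop) (fun k => Eventually.of_forall fun x => tsub_le_self) hn
    (Eventually.of_forall fun x => ?_)
  · simpa using this
  · refine tendsto_const_nhds.congr' ?_
    filter_upwards [(tendsto_order.1 ha).1 (x : ℝ≥0∞) ENNReal.coe_lt_top] with k hk
    exact (tsub_eq_zero_of_le hk.le).symm

theorem work_of_mass_eq_zero (ν : ProbabilityMeasure ℝ≥0) (Ψ : ℝ≥0 → State) {t : ℝ≥0}
    (hZ : Z Ψ t = 0) (hQ : Q Ψ t = 0) : IsFluidSolution.work ν Ψ t = 0 := by
  have h0 : ((Ψ t).server : Measure ℝ≥0) = 0 := by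
    rw [← Measure.measure_univ_eq_zero, ← FiniteMeasure.ennreal_mass]
    exact_mod_cast hZ
  simp [IsFluidSolution.work, h0, hQ]

namespace IsFluidSolution

variable {K lam : ℝ≥0} {ν : ProbabilityMeasure ℝ≥0} {ξ μ : FinMeas} {Ψ : ℝ≥0 → State}

theorem Q_eq_zero_of_Z_eq_zero (h : IsFluidSolution K lam ν ξ μ Ψ) (hK : 0 < K) {t : ℝ≥0}
    (hZ : Z Ψ t = 0) : Q Ψ t = 0 := by
  have h1 := h.policy_server t
  rw [hZ] at h1
  have h2 : X Ψ t = 0 := by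
    by_contra hne
    exact (lt_min (pos_iff_ne_zero.2 hne) hK).ne h1
  have h3 := h.policy_buffer t
  rw [h3, h2, zero_tsub]

theorem Z_eq_K_of_Q_pos (h : IsFluidSolution K lam ν ξ μ Ψ) {t : ℝ≥0} (hQ : 0 < Q Ψ t) :
    Z Ψ t = K := by
  rw [h.policy_server, min_eq_right]
  rw [h.policy_buffer] at hQ
  exact (tsub_pos_iff_lt.1 hQ).le

theorem Z_le (h : IsFluidSolution K lam ν ξ μ Ψ) (t : ℝ≥0) : Z Ψ t ≤ K :=
  (h.policy_server t).trans_le (min_le_right _ _)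

theorem Z_eq_zero_of_work_eq_zero (h : IsFluidSolution K lam ν ξ μ Ψ) {t : ℝ≥0}
    (hw : work ν Ψ t = 0) : Z Ψ t = 0 := by
  have h1 : ∫⁻ x : ℝ≥0, (x : ℝ≥0∞) ∂((Ψ t).server : Measure ℝ≥0) = 0 :=
    (add_eq_zero.1 hw).1
  rw [lintegral_eq_zero_iff (by fun_prop)] at h1
  have h2 : ((Ψ t).server : Measure ℝ≥0) (Ioi 0) = 0 := by
    refine measure_mono_null (fun x hx => ?_) h1
    simpa using (ne_of_gt hx)
  have h3 := h.coe_Z t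
  rw [← ENNReal.coe_zero, tailAt_coe, h2] at h3
  exact_mod_cast h3

theorem init_server (h : IsFluidSolution K lam ν ξ μ Ψ) : (Ψ 0).server = μ := by
  rw [h.init]; rfl

theorem init_buffer (h : IsFluidSolution K lam ν ξ μ Ψ) : (Ψ 0).buffer = ξ := by
  rw [h.init]; rfl

end IsFluidSolution

theorem firstMoment_add (a b : FinMeas) : firstMoment (a + b) = firstMoment a + firstMoment b := by
  rw [firstMoment, FiniteMeasure.toMeasure_add, lintegral_add_measure]; rfl

theorem firstMoment_smul (c : ℝ≥0) (a : FinMeas) : firstMoment (c • a) = c * firstMoment a := by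
  rw [firstMoment, FiniteMeasure.toMeasure_smul, lintegral_smul_measure]; rfl

theorem mass_smul_probability (c : ℝ≥0) (ν : ProbabilityMeasure ℝ≥0) :
    (c • ν.toFiniteMeasure).mass = c := by
  rw [FiniteMeasure.mass, FiniteMeasure.smul_apply]
  simp

namespace IsValid

variable {K : ℝ≥0} {ν : ProbabilityMeasure ℝ≥0} {ξ μ : FinMeas}

theorem eq_smul (hv : IsValid K ν ξ μ) : ξ = ξ.mass • ν.toFiniteMeasure := by
  have h1 := hv.buffer_eq
  have h2 : ξ.mass = ξ.mass + μ.mass - K := by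
    conv_lhs => rw [h1, mass_smul_probability]
  rw [← h2] at h1
  exact h1

theorem firstMoment_add (hv : IsValid K ν ξ μ) :
    firstMoment (ξ + μ) = firstMoment μ + ξ.mass * meanSize ν := by
  rw [LPS.firstMoment_add, add_comm]
  conv_lhs => rw [hv.eq_smul, firstMoment_smul]
  rfl

end IsValid

namespace IsFluidSolution

variable {K lam : ℝ≥0} {ν : ProbabilityMeasure ℝ≥0} {ξ μ : FinMeas} {Ψ : ℝ≥0 → State}

theorem work_init (h : IsFluidSolution K lam ν ξ μ Ψ) (hv : IsValid K ν ξ μ) :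
    work ν Ψ 0 = firstMoment (ξ + μ) := by
  rw [hv.firstMoment_add, work, h.init_server, Q, h.init_buffer]
  rfl

theorem lintegral_clock_Z (h : IsFluidSolution K lam ν ξ μ Ψ) {E : Set ℝ≥0} (hE : MeasurableSet E) :
    ∫⁻ r in E, Z Ψ r ∂clock Ψ = ∫⁻ r in E, (Z Ψ r : ℝ≥0∞)⁻¹ * Z Ψ r ∂lebesgue := by
  have hZm : Measurable fun r => (Z Ψ r : ℝ≥0∞) := h.measurable_Z.coe_nnreal_ennreal
  exact setLIntegral_withDensity_eq_setLIntegral_mul _ hZm.inv hZm hE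

theorem le_lintegral_clock_Z (h : IsFluidSolution K lam ν ξ μ Ψ) {s t : ℝ≥0}
    (hZ : ∀ r ∈ Ioc s t, Z Ψ r ≠ 0) : (t - s : ℝ≥0) ≤ ∫⁻ r in Ioc s t, Z Ψ r ∂clock Ψ := by
  rw [h.lintegral_clock_Z measurableSet_Ioc, ← lebesgue_Ioc, ← setLIntegral_one]
  refine lintegral_mono_ae ?_
  filter_upwards [ae_restrict_mem measurableSet_Ioc] with r hr
  rw [ENNReal.inv_mul_cancel (by exact_mod_cast hZ r hr) ENNReal.coe_ne_top]

theorem lintegral_clock_Z_eq (h : IsFluidSolution K lam ν ξ μ Ψ) {s t : ℝ≥0} (hfin : S Ψ s t ≠ ∞) :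
    ∫⁻ r in Ioc s t, Z Ψ r ∂clock Ψ = (t - s : ℝ≥0) := by
  have hZm : Measurable fun r => (Z Ψ r : ℝ≥0∞) := h.measurable_Z.coe_nnreal_ennreal
  rw [h.lintegral_clock_Z measurableSet_Ioc, ← lebesgue_Ioc, ← setLIntegral_one]
  refine lintegral_congr_ae ?_
  filter_upwards [ae_lt_top hZm.inv hfin] with r hr
  have : (Z Ψ r : ℝ≥0∞) ≠ 0 := fun h0 => by simp [h0] at hr
  rw [ENNReal.inv_mul_cancel this ENNReal.coe_ne_top]

/-- With no initial work the fluid solution vanishes. -/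
theorem mass_eq_zero (h : IsFluidSolution K lam ν ξ μ Ψ) (hK : 0 < K)
    (hload : (lam : ℝ≥0∞) * meanSize ν = 1) (hv : IsValid K ν ξ μ)
    (hw : firstMoment (ξ + μ) = 0) (t : ℝ≥0) : Z Ψ t = 0 ∧ Q Ψ t = 0 := by
  suffices hwt : work ν Ψ t = 0 by
    have := h.Z_eq_zero_of_work_eq_zero hwt
    exact ⟨this, h.Q_eq_zero_of_Z_eq_zero hK this⟩
  set A : Set ℝ≥0 := {s | s ≤ t ∧ Z Ψ s = 0} with hA
  have h0 : (0 : ℝ≥0) ∈ A := ⟨zero_le, h.Z_eq_zero_of_work_eq_zero ((h.work_init hv).trans hw)⟩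
  have hb : BddAbove A := ⟨t, fun s hs => hs.1⟩
  have hsup : sSup A ≤ t := csSup_le ⟨0, h0⟩ fun s hs => hs.1
  -- After the last zero of Z the server is always busy, so at least t - sup A of work is done,
  -- whereas t - s arrives. Zeros s close to sup A then leave no work at t; the supremum itself need
  -- not be a zero.
  have key : ∀ s ∈ A, work ν Ψ t ≤ (sSup A - s : ℝ≥0) := by
    intro s hs
    have h1 := h.work_le hload hs.1
    rw [work_of_mass_eq_zero ν Ψ hs.2 (h.Q_eq_zero_of_Z_eq_zero hK hs.2), zero_add] at h1
    have h2 : ((t - sSup A : ℝ≥0) : ℝ≥0∞) ≤ ∫⁻ r in Ioc s t, Z Ψ r ∂clock Ψ := by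
      refine (h.le_lintegral_clock_Z fun r hr hZ => ?_).trans
        (lintegral_mono_set (Ioc_subset_Ioc_left (le_csSup hb hs)))
      exact not_lt.2 (le_csSup hb ⟨hr.2, hZ⟩) hr.1
    have h3 : work ν Ψ t + (t - sSup A : ℝ≥0) ≤ (sSup A - s : ℝ≥0) + (t - sSup A : ℝ≥0) := by
      refine (add_le_add le_rfl h2).trans (h1.trans ?_)
      rw [← ENNReal.coe_add, add_comm, tsub_add_tsub_cancel hsup (le_csSup hb hs)]
    exact (ENNReal.add_le_add_iff_right ENNReal.coe_ne_top).1 h3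
  refine le_antisymm (ENNReal.le_of_forall_pos_le_add fun ε hε _ => ?_) zero_le
  rw [zero_add]
  rcases eq_or_ne (sSup A) 0 with hs0 | hs0
  · have := key 0 h0
    rw [hs0] at this
    exact this.trans (by simp)
  · obtain ⟨s, hs, hlt⟩ := exists_lt_of_lt_csSup ⟨0, h0⟩ (tsub_lt_self (pos_iff_ne_zero.2 hs0) hε)
    refine (key s hs).trans (ENNReal.coe_le_coe.2 ?_)
    rw [tsub_le_iff_left, ← tsub_le_iff_right]
    exact hlt.le

theorem work_const (h : IsFluidSolution K lam ν ξ μ Ψ) (hload : (lam : ℝ≥0∞) * meanSize ν = 1)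
    (hv : IsValid K ν ξ μ) {t : ℝ≥0} (hfin : S Ψ 0 t ≠ ∞) : work ν Ψ t = firstMoment (ξ + μ) := by
  have h1 := h.work_eq hload zero_le hfin
  rw [h.lintegral_clock_Z_eq hfin, h.work_init hv] at h1
  exact (ENNReal.add_left_inj ENNReal.coe_ne_top).1 h1

theorem S_ne_top_of_le {s t c : ℝ≥0} (hc : 0 < c)
    (hZ : ∀ r ∈ Ioo s t, c ≤ Z Ψ r) : S Ψ s t ≠ ∞ := by
  rw [S, ← setLIntegral_congr Ioo_ae_eq_Ioc]
  have : ∫⁻ r in Ioo s t, (Z Ψ r : ℝ≥0∞)⁻¹ ∂lebesgue ≤ ∫⁻ r in Ioo s t, (c : ℝ≥0∞)⁻¹ ∂lebesgue := by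
    refine lintegral_mono_ae ?_
    filter_upwards [ae_restrict_mem measurableSet_Ioo] with r hr
    exact ENNReal.inv_le_inv.2 (by exact_mod_cast hZ r hr)
  refine (this.trans_lt ?_).ne
  rw [lintegral_const, Measure.restrict_apply_univ, measure_congr Ioo_ae_eq_Ioc, lebesgue_Ioc]
  have : (c : ℝ≥0∞) ≠ 0 := by exact_mod_cast hc.ne'
  finiteness

/-- With positive initial work the clock never explodes. -/
theorem S_ne_top (h : IsFluidSolution K lam ν ξ μ Ψ) (hK : 0 < K)
    (hload : (lam : ℝ≥0∞) * meanSize ν = 1) (hmean : meanSize ν < ∞) (hv : IsValid K ν ξ μ)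
    (hw : firstMoment (ξ + μ) ≠ 0) (hwfin : firstMoment (ξ + μ) ≠ ∞) (t : ℝ≥0) : S Ψ 0 t ≠ ∞ := by
  intro htop
  set D : Set ℝ≥0 := {t | S Ψ 0 t = ∞} with hD
  have hb : BddBelow D := OrderBot.bddBelow D
  have hne : D.Nonempty := ⟨t, htop⟩
  have hfin : ∀ r < sInf D, S Ψ 0 r ≠ ∞ := fun r hr h0 => not_lt.2 (csInf_le hb h0) hr
  have hinf : ∀ r, sInf D < r → S Ψ 0 r = ∞ := fun r hr => by
    obtain ⟨d, hd, hdr⟩ := exists_lt_of_csInf_lt hne hr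
    exact top_le_iff.1 ((ge_of_eq hd).trans (monotone_S Ψ 0 hdr.le))
  set t₀ := sInf D with ht₀
  -- Either the clock already diverges on approaching its explosion time t₀ from the left, or it is
  -- finite at t₀ and infinite immediately afterwards.
  by_cases h0 : S Ψ 0 t₀ = ∞
  · have ht₀pos : 0 < t₀ := by
      rw [pos_iff_ne_zero]
      intro h1
      rw [h1, S_self] at h0
      exact ENNReal.zero_ne_top h0
    obtain ⟨v, hvmono, hvlt, hvlim⟩ := exists_seq_strictMono_tendsto' ht₀pos
    have hSv : ∀ r < t₀, S Ψ r t₀ = ∞ := fun r hr => by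
      have := S_add Ψ (zero_le (a := r)) hr.le
      rw [h0] at this
      exact (ENNReal.add_eq_top.1 this).resolve_left (hfin r hr)
    obtain ⟨l, hl⟩ := h.cadlag.2 t₀ ht₀pos
    have hQl : Tendsto (Q Ψ) (𝓝[<] t₀) (𝓝 l.buffer.mass) :=
      (continuous_buffer_mass.tendsto l).comp hl
    -- A positive left limit of Q would keep the server full, Z = K, just before t₀, and the clock
    -- would stay finite there.
    have hl0 : l.buffer.mass = 0 := by
      by_contra hpos
      have hev := (tendsto_order.1 hQl).1 0 (pos_iff_ne_zero.2 hpos)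
      obtain ⟨a, ha, hsub⟩ := (mem_nhdsLT_iff_exists_Ioo_subset' ht₀pos).1 hev
      refine S_ne_top_of_le hK (fun r hr => ?_) (hSv a ha)
      exact (h.Z_eq_K_of_Q_pos (hsub hr)).ge
    have hvw : Tendsto v atTop (𝓝[<] t₀) :=
      tendsto_nhdsWithin_iff.2 ⟨hvlim, Eventually.of_forall fun k => (hvlt k).2⟩
    have hlim1 := tendsto_residual (μ : Measure ℝ≥0)
      (ne_top_of_le_ne_top hwfin (by rw [hv.firstMoment_add]; exact le_self_add))
      (h0 ▸ tendsto_S_of_strictMono Ψ hvmono (fun k => (hvlt k).2) hvlim)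
    have hlim2 : Tendsto (fun k => ∫⁻ s in Ioc 0 (v k), ∫⁻ y : ℝ≥0,
        tailAt ν (y + S Ψ s (v k)) ∂lebesgue ∂h.inflow) atTop (𝓝 0) := by
      have hdom := tendsto_lintegral_of_dominated_convergence (μ := h.inflow)
        (F := fun k => (Ioc 0 (v k)).indicator fun s => ∫⁻ y : ℝ≥0,
          tailAt ν (y + S Ψ s (v k)) ∂lebesgue) (f := fun _ => 0)
        ((Iic t₀).indicator fun _ => meanSize ν) (fun k => ?_) (fun k => ?_) ?_ ?_
      · simp_rw [lintegral_indicator measurableSet_Ioc] at hdom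
        simpa using hdom
      · refine Measurable.indicator (Monotone.measurable fun a b hab => lintegral_mono fun y => ?_)
          measurableSet_Ioc
        exact antitone_tailAt _ (add_le_add le_rfl (antitone_S Ψ (v k) hab))
      · refine Eventually.of_forall fun s => ?_
        by_cases hs : s ∈ Ioc 0 (v k)
        · have hs' : s ∈ Iic t₀ := hs.2.trans (hvlt k).2.le
          rw [indicator_of_mem hs, indicator_of_mem hs', lintegral_tailAt_add]
          exact lintegral_mono fun x => tsub_le_self
        · rw [indicator_of_notMem hs]
          exact zero_le
      · rw [lintegral_indicator measurableSet_Iic, lintegral_const, Measure.restrict_apply_univ,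
          h.inflow_Iic]
        have := h.inflow_Ioc_add (zero_le (a := t₀))
        have h2 : h.inflow (Ioc 0 t₀) ≠ ∞ :=
          ne_top_of_le_ne_top (by finiteness) (le_self_add.trans this.le)
        finiteness
      · refine Eventually.of_forall fun s => ?_
        by_cases hs : s < t₀
        · have h1 := tendsto_residual (ν : Measure ℝ≥0) hmean.ne
            (hSv s hs ▸ tendsto_S_of_strictMono Ψ hvmono (fun k => (hvlt k).2) hvlim)
          refine tendsto_of_tendsto_of_tendsto_of_le_of_le tendsto_const_nhds h1
            (fun k => zero_le) fun k => ?_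
          simp only
          rw [← lintegral_tailAt_add]
          exact indicator_le_self _ _ _
        · refine tendsto_const_nhds.congr fun k => ?_
          rw [indicator_of_notMem]
          exact fun hs' => hs (hs'.2.trans_lt (hvlt k).2)
    have hlim3 : Tendsto (fun k => (Q Ψ (v k) : ℝ≥0∞) * meanSize ν) atTop (𝓝 0) := by
      have := ENNReal.Tendsto.mul_const (b := meanSize ν)
        (ENNReal.tendsto_coe.2 (hQl.comp hvw)) (Or.inr hmean.ne)
      simpa [hl0] using this
    have hall := (hlim1.add hlim2).add hlim3
    -- Just before t₀ the workload is still its initial value. It is also the sum of three parts,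
    -- all tending to 0, because every job receives unbounded service and the buffer empties.
    refine hw (tendsto_nhds_unique (tendsto_const_nhds.congr fun k => ?_) (by simpa using hall))
    rw [← h.work_const hload hv (hfin (v k) (hvlt k).2), work, h.server_moment zero_le,
      lintegral_tailAt_add, h.init_server]
  -- Positive work at t₀ means Z(t₀) > 0. By right-continuity Z exceeds half this value on some [t₀,
  -- b], so the clock is finite at b.
  · have hZ : Z Ψ t₀ ≠ 0 := fun hZ => hw (by
      rw [← h.work_const hload hv h0, work_of_mass_eq_zero ν Ψ hZ (h.Q_eq_zero_of_Z_eq_zero hK hZ)])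
    have hhalf : Z Ψ t₀ / 2 < Z Ψ t₀ := NNReal.half_lt_self hZ
    have hev := (tendsto_order.1 (h.continuousWithinAt_Z t₀)).1 _ hhalf
    obtain ⟨b, hb', hsub⟩ := (mem_nhdsGE_iff_exists_Icc_subset).1 hev
    have h1 : S Ψ t₀ b ≠ ∞ := S_ne_top_of_le (c := Z Ψ t₀ / 2)
      (half_pos (pos_iff_ne_zero.2 hZ)) fun r hr => le_of_lt (hsub ⟨hr.1.le, hr.2.le⟩)
    have h2 := hinf b hb'
    rw [← S_add Ψ zero_le (le_of_lt hb')] at h2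
    exact (ENNReal.add_ne_top.2 ⟨h0, h1⟩) h2

end IsFluidSolution

/-! ### From the fluid equations to the renewal equation in clock time. -/

section Equilibrium

variable {ν : ProbabilityMeasure ℝ≥0} {lam : ℝ≥0}

theorem lintegral_equilibrium (hload : (lam : ℝ≥0∞) * meanSize ν = 1) {E : Set ℝ≥0}
    (hE : MeasurableSet E) {f : ℝ≥0 → ℝ≥0∞} (hf : Measurable f) :
    ∫⁻ r in E, f r ∂(equilibriumMeasure ν : Measure ℝ≥0) =
      ∫⁻ r in E, lam * (ν : Measure ℝ≥0) (Ioi r) * f r ∂lebesgue := by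
  have hinv : (meanSize ν)⁻¹ = lam := by
    rw [← ENNReal.eq_inv_of_mul_eq_one_left hload]
  have hm : Measurable fun y => (ν : Measure ℝ≥0) (Ioi y) / meanSize ν :=
    (measurable_tail _).div_const _
  refine (setLIntegral_withDensity_eq_setLIntegral_mul _ hm hf hE).trans ?_
  refine lintegral_congr fun r => ?_
  rw [Pi.mul_apply, div_eq_mul_inv, hinv, mul_comm (lam : ℝ≥0∞)]

theorem equilibrium_univ (hload : (lam : ℝ≥0∞) * meanSize ν = 1) :
    (equilibriumMeasure ν : Measure ℝ≥0) univ = 1 := by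
  have := lintegral_equilibrium hload MeasurableSet.univ (f := fun _ => 1) measurable_const
  rw [setLIntegral_one] at this
  rw [this, Measure.restrict_univ]
  simp_rw [mul_one]
  rw [lintegral_const_mul _ (measurable_tail _), lintegral_tail]
  exact hload

theorem isProbabilityMeasure_equilibrium (hload : (lam : ℝ≥0∞) * meanSize ν = 1) :
    IsProbabilityMeasure (equilibriumMeasure ν : Measure ℝ≥0) := ⟨equilibrium_univ hload⟩

theorem equilibrium_countable {E : Set ℝ≥0} (hE : E.Countable) :
    (equilibriumMeasure ν : Measure ℝ≥0) E = 0 :=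
  (withDensity_absolutelyContinuous lebesgue _) (hE.measure_zero lebesgue)

end Equilibrium

/-- The tail equation behind both the renewal equation and the convergence of the profile. -/
theorem tail_formula {K lam Q₀ : ℝ≥0} {ν : ProbabilityMeasure ℝ≥0}
    (hload : (lam : ℝ≥0∞) * meanSize ν = 1) {x : ℝ≥0 → ℝ≥0} (hx : Measurable x)
    {m : Measure ℝ≥0} [SFinite m] {T : ℝ≥0 → ℝ≥0}
    (hT : ∀ u, (T u : ℝ≥0∞) = ∫⁻ v in Iic u, (min (x v) K : ℝ≥0) ∂lebesgue)
    (hm : ∀ u, m (Iic u) + (x u - K : ℝ≥0) = lam * T u + Q₀) (y u : ℝ≥0) :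
    ∫⁻ v in Iic u, (ν : Measure ℝ≥0) (Ioi (y + (u - v))) ∂m +
      (x u - K : ℝ≥0) * (ν : Measure ℝ≥0) (Ioi y) =
    Q₀ * (ν : Measure ℝ≥0) (Ioi (y + u)) +
      ∫⁻ r in Ioc y (y + u), (x (y + u - r) - K : ℝ≥0) ∂(ν : Measure ℝ≥0) +
      ∫⁻ r in Ioc y (y + u), (min (x (y + u - r)) K : ℝ≥0) ∂(equilibriumMeasure ν : Measure ℝ≥0) := by
  set n : Measure ℝ≥0 := (ν : Measure ℝ≥0) with hn
  have hz : Measurable fun v => ((lam * min (x v) K : ℝ≥0) : ℝ≥0∞) := by fun_prop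
  -- In clock time the exogenous arrivals have density λ(x∧K), and m differs from them only through
  -- the buffer. Convolving them with the tail of ν produces ν_e, whose density is that tail times
  -- λ.
  set m₂ : Measure ℝ≥0 := lebesgue.withDensity fun v => ((lam * min (x v) K : ℝ≥0) : ℝ≥0∞) with hm₂
  have hm₂Iic : ∀ s, m₂ (Iic s) = lam * T s := fun s => by
    rw [hm₂, withDensity_apply _ measurableSet_Iic, hT, ← lintegral_const_mul _ (by fun_prop)]
    simp only [ENNReal.coe_mul]
  have p1 := lintegral_tail_add_lintegral_cdf n m y u
  have p2 := lintegral_tail_add_lintegral_cdf n m₂ y u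
  have hI₂ : ∫⁻ v in Iic u, n (Ioi (y + (u - v))) ∂m₂ =
      ∫⁻ r in Ioc y (y + u), (min (x (y + u - r)) K : ℝ≥0) ∂(equilibriumMeasure ν : Measure ℝ≥0) := by
    have hmeas1 : Measurable fun v => n (Ioi (y + (u - v))) :=
      (measurable_tail n).comp (f := fun v : ℝ≥0 => y + (u - v)) (by fun_prop)
    have hmeas2 : Measurable fun s => (lam : ℝ≥0∞) * n (Ioi (y + s)) * (min (x (u - s)) K : ℝ≥0) :=
      (((measurable_tail n).comp (f := fun s : ℝ≥0 => y + s) (by fun_prop)).const_mul _).mul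
        (by fun_prop)
    rw [lintegral_equilibrium hload measurableSet_Ioc (by fun_prop),
      setLIntegral_withDensity_eq_setLIntegral_mul _ hz hmeas1 measurableSet_Iic,
      setLIntegral_congr Ioc_ae_eq_Icc]
    have e := lintegral_Icc_translate (v := y) (U := y + u) hmeas2
    rw [add_tsub_cancel_left, ← lintegral_Iic_reflect u hmeas2] at e
    refine Eq.trans (setLIntegral_congr_fun measurableSet_Iic fun v hv => ?_) (e.symm.trans
      (setLIntegral_congr_fun measurableSet_Icc fun r hr => ?_))
    · simp only [Pi.mul_apply]
      rw [tsub_tsub_cancel_of_le hv]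
      push_cast
      ring
    · have e3 : y + u - r = u - (r - y) := by
        conv_lhs => rw [← add_tsub_cancel_of_le hr.1, add_tsub_add_eq_tsub_left]
      rw [add_tsub_cancel_of_le hr.1, e3]
  have hmIic : ∀ s, m (Iic s) ≠ ∞ := fun s =>
    ne_top_of_le_ne_top (by finiteness) (le_self_add.trans (hm s).le)
  have hcdf : ∀ k : Measure ℝ≥0, Measurable fun r => k (Iic (y + u - r)) := fun k =>
    (Antitone.measurable fun a b hab => measure_mono (Iic_subset_Iic.2 (tsub_le_tsub_left hab _)))
  have hA : ∫⁻ r in Ioc y (y + u), m (Iic (y + u - r)) ∂n ≠ ∞ := by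
    refine ne_top_of_le_ne_top ?_ (le_add_self.trans p1.le)
    have := hmIic u
    finiteness
  have hB : ∫⁻ r in Ioc y (y + u), (x (y + u - r) - K : ℝ≥0) ∂n +
      ∫⁻ r in Ioc y (y + u), m (Iic (y + u - r)) ∂n =
      ∫⁻ r in Ioc y (y + u), m₂ (Iic (y + u - r)) ∂n + Q₀ * n (Ioc y (y + u)) := by
    rw [← lintegral_add_right _ (hcdf m), ← setLIntegral_const, ← lintegral_add_left (hcdf m₂)]
    refine lintegral_congr fun r => ?_
    rw [hm₂Iic, ← hm, add_comm]
  have hsplit : n (Ioi (y + u)) + n (Ioc y (y + u)) = n (Ioi y) := by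
    have hd : Disjoint (Ioc y (y + u)) (Ioi (y + u)) :=
      Set.disjoint_left.2 fun a ha hb => not_lt.2 ha.2 hb
    rw [add_comm, ← measure_union hd measurableSet_Ioi, Ioc_union_Ioi_eq_Ioi le_self_add]
  -- Adding the finite integral of the distribution function of m to both sides avoids subtraction
  -- in [0, ∞]; it is then exchanged for that of m₂ by `hB`.
  refine (ENNReal.add_left_inj hA).1 ?_
  calc _ = (∫⁻ v in Iic u, n (Ioi (y + (u - v))) ∂m +
        ∫⁻ r in Ioc y (y + u), m (Iic (y + u - r)) ∂n) + (x u - K : ℝ≥0) * n (Ioi y) := by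
        rw [add_right_comm]
    _ = m₂ (Iic u) * n (Ioi y) + Q₀ * n (Ioi y) := by
        rw [p1, ← add_mul, hm, hm₂Iic, add_mul]
    _ = Q₀ * (n (Ioi (y + u)) + n (Ioc y (y + u))) + (∫⁻ v in Iic u, n (Ioi (y + (u - v))) ∂m₂ +
        ∫⁻ r in Ioc y (y + u), m₂ (Iic (y + u - r)) ∂n) := by rw [hsplit, p2, add_comm]
    _ = Q₀ * n (Ioi (y + u)) + ∫⁻ v in Iic u, n (Ioi (y + (u - v))) ∂m₂ +
        (∫⁻ r in Ioc y (y + u), m₂ (Iic (y + u - r)) ∂n + Q₀ * n (Ioc y (y + u))) := by ring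
    _ = _ := by rw [← hB, hI₂]; ring

/-- A trajectory in the time scale of the clock: the profile `D u` of the server, the total mass
`x u`, and the real time `τ u`. -/
structure ClockSolution (K lam : ℝ≥0) (ν : ProbabilityMeasure ℝ≥0) (G : FinMeas) (x : ℝ≥0 → ℝ≥0)
    (D : ℝ≥0 → FinMeas) : Prop where
  renewal : RenewalSolution K (lam * K) ν (equilibriumMeasure ν : Measure ℝ≥0) G x
  profile : ∀ y u, (D u : Measure ℝ≥0) (Ioi y) + (x u - K : ℝ≥0) * (ν : Measure ℝ≥0) (Ioi y) =
    (G : Measure ℝ≥0) (Ioi (y + u)) +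
      ∫⁻ r in Ioc y (y + u), (x (y + u - r) - K : ℝ≥0) ∂(ν : Measure ℝ≥0) +
      ∫⁻ r in Ioc y (y + u), (min (x (y + u - r)) K : ℝ≥0) ∂(equilibriumMeasure ν : Measure ℝ≥0)

/-- Since Z ≤ K, the clock runs at rate at least 1 / K, so it is strictly increasing and unbounded.
Finiteness and the absence of atoms make it take every value. -/
theorem exists_clock (Ψ : ℝ≥0 → State) {K : ℝ≥0} (hK : 0 < K) (hZ : ∀ t, Z Ψ t ≤ K)
    (hfin : ∀ t, S Ψ 0 t ≠ ∞) : ∃ σ : ℝ≥0 ≃o ℝ≥0, ∀ t, (σ t : ℝ≥0∞) = S Ψ 0 t := by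
  have hcoe : ∀ t, ((S Ψ 0 t).toNNReal : ℝ≥0∞) = S Ψ 0 t := fun t => ENNReal.coe_toNNReal (hfin t)
  have hge : ∀ s t, ((t - s : ℝ≥0) : ℝ≥0∞) * (K : ℝ≥0∞)⁻¹ ≤ S Ψ s t := fun s t => by
    rw [← lebesgue_Ioc, mul_comm, ← setLIntegral_const]
    exact lintegral_mono fun r => ENNReal.inv_le_inv.2 (ENNReal.coe_le_coe.2 (hZ r))
  have hmono : StrictMono fun t => (S Ψ 0 t).toNNReal := by
    intro s t hst
    rw [← ENNReal.coe_lt_coe, hcoe, hcoe, ← S_add Ψ zero_le hst.le]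
    refine ENNReal.lt_add_right (hfin s) (ne_of_gt (lt_of_lt_of_le ?_ (hge s t)))
    refine ENNReal.mul_pos ?_ (by simp)
    exact_mod_cast (tsub_pos_of_lt hst).ne'
  have hsurj : Function.Surjective fun t => (S Ψ 0 t).toNNReal := by
    intro u
    rcases eq_or_ne u 0 with rfl | hu
    · exact ⟨0, by simp [S_self]⟩
    have hle : (u : ℝ≥0∞) ≤ S Ψ 0 (u * K) := by
      refine le_trans (le_of_eq ?_) (hge 0 (u * K))
      rw [tsub_zero, ENNReal.coe_mul, mul_assoc, ENNReal.mul_inv_cancel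
        (by exact_mod_cast hK.ne') ENNReal.coe_ne_top, mul_one]
    have h1 := clock_initial_eq Ψ (hfin (u * K)) u
    rw [min_eq_left hle] at h1
    set E := Ioc 0 (u * K) ∩ {r | S Ψ 0 r < u} with hE
    have hne : E.Nonempty := by
      rw [Set.nonempty_iff_ne_empty]
      intro h0
      rw [h0, measure_empty] at h1
      exact hu (by exact_mod_cast h1.symm)
    have hb : BddAbove E := ⟨u * K, fun r hr => hr.1.2⟩
    refine ⟨sSup E, ?_⟩
    rw [← ENNReal.coe_inj, hcoe, ← h1]
    refine le_antisymm ?_ ?_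
    · rw [← clock_Ioo]
      refine measure_mono fun r hr => ?_
      obtain ⟨b, hb', hrb⟩ := exists_lt_of_lt_csSup hne hr.2
      exact ⟨⟨hr.1, hrb.le.trans hb'.1.2⟩, (monotone_S Ψ 0 hrb.le).trans_lt hb'.2⟩
    · rw [← clock_Ioc]
      exact measure_mono fun r hr => ⟨hr.1.1, le_csSup hb hr⟩
  exact ⟨hmono.orderIsoOfSurjective _ hsurj, hcoe⟩

theorem lintegral_Ioc_zero {n : Measure ℝ≥0} (hn : n {0} = 0) (f : ℝ≥0 → ℝ≥0∞) (u : ℝ≥0) :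
    ∫⁻ r in Ioc 0 u, f r ∂n = ∫⁻ r in Iic u, f r ∂n := by
  refine setLIntegral_congr ?_
  refine (ae_eq_set.2 ⟨?_, ?_⟩)
  · rw [sdiff_eq_empty.2 Ioc_subset_Iic_self, measure_empty]
  · refine measure_mono_null (fun x hx => ?_) hn
    by_contra h0
    exact hx.2 ⟨pos_iff_ne_zero.2 h0, hx.1⟩

theorem measure_univ_eq_of_zero {n : Measure ℝ≥0} (hn : n {0} = 0) : n univ = n (Ioi 0) := by
  have h1 := measure_add_measure_compl (μ := n) (measurableSet_singleton (0 : ℝ≥0))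
  rw [hn, zero_add] at h1
  rw [← h1]
  congr 1
  ext r
  simp [pos_iff_ne_zero]

/-- Assembling a clock solution from its ingredients. -/
theorem clockSolution_of {K lam : ℝ≥0} {ν : ProbabilityMeasure ℝ≥0} {ξ μ : FinMeas}
    (hload : (lam : ℝ≥0∞) * meanSize ν = 1) (hν : (ν : Measure ℝ≥0) {0} = 0)
    (hv : IsValid K ν ξ μ) {x : ℝ≥0 → ℝ≥0} (hx : Measurable x) {D : ℝ≥0 → FinMeas}
    {m : Measure ℝ≥0} [SFinite m] {T : ℝ≥0 → ℝ≥0}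
    (hT : ∀ u, (T u : ℝ≥0∞) = ∫⁻ v in Iic u, (min (x v) K : ℝ≥0) ∂lebesgue)
    (hm : ∀ u, m (Iic u) + (x u - K : ℝ≥0) = lam * T u + ξ.mass)
    (hD : ∀ y u, (D u : Measure ℝ≥0) (Ioi y) = (μ : Measure ℝ≥0) (Ioi (y + u)) +
      ∫⁻ v in Iic u, (ν : Measure ℝ≥0) (Ioi (y + (u - v))) ∂m)
    (hD0 : ∀ u, (D u : Measure ℝ≥0) (Ioi 0) = (min (x u) K : ℝ≥0))
    (hgrowth : ∀ u v, u ≤ v → x v ≤ x u + lam * (T v - T u)) :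
    ClockSolution K lam ν (ξ + μ) x D := by
  have hG : ∀ a, ((ξ + μ : FinMeas) : Measure ℝ≥0) (Ioi a) =
      (μ : Measure ℝ≥0) (Ioi a) + ξ.mass * (ν : Measure ℝ≥0) (Ioi a) := by
    intro a
    rw [FiniteMeasure.toMeasure_add, Measure.add_apply, add_comm]
    congr 1
    conv_lhs => rw [hv.eq_smul]
    rfl
  have profile : ∀ y u, (D u : Measure ℝ≥0) (Ioi y) +
      (x u - K : ℝ≥0) * (ν : Measure ℝ≥0) (Ioi y) =
      ((ξ + μ : FinMeas) : Measure ℝ≥0) (Ioi (y + u)) +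
      ∫⁻ r in Ioc y (y + u), (x (y + u - r) - K : ℝ≥0) ∂(ν : Measure ℝ≥0) +
      ∫⁻ r in Ioc y (y + u), (min (x (y + u - r)) K : ℝ≥0)
        ∂(equilibriumMeasure ν : Measure ℝ≥0) := by
    intro y u
    rw [hD, add_assoc, tail_formula hload hx hT hm y u, hG]
    ring
  refine ⟨⟨hx, fun u => ?_, fun u v huv => ?_⟩, profile⟩
  · have h0 := profile 0 u
    have hν1 : (ν : Measure ℝ≥0) (Ioi 0) = 1 := by
      rw [← measure_univ_eq_of_zero hν, measure_univ]
    rw [hD0, hν1, mul_one, ← ENNReal.coe_add, add_comm (min (x u) K), tsub_add_min_self,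
      zero_add, lintegral_Ioc_zero hν, lintegral_Ioc_zero (equilibrium_countable
        (countable_singleton 0))] at h0
    exact h0
  · refine (hgrowth u v huv).trans ?_
    rw [mul_assoc]
    gcongr
    rw [tsub_le_iff_left, ← ENNReal.coe_le_coe, ENNReal.coe_add, hT, hT]
    rw [← Iic_union_Ioc_eq_Iic huv]
    refine (lintegral_union_le _ _ _).trans (add_le_add le_rfl ?_)
    refine (setLIntegral_mono (g := fun _ => (K : ℝ≥0∞)) measurable_const
      fun r _ => ENNReal.coe_le_coe.2 (min_le_right _ _)).trans ?_
    rw [setLIntegral_const, lebesgue_Ioc, ENNReal.coe_mul]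

/-- A fluid solution with positive workload, in the time scale of its clock. -/
theorem IsFluidSolution.exists_clockSolution {K lam : ℝ≥0} {ν : ProbabilityMeasure ℝ≥0}
    {ξ μ : FinMeas} {Ψ : ℝ≥0 → State} (h : IsFluidSolution K lam ν ξ μ Ψ) (hK : 0 < K)
    (hload : (lam : ℝ≥0∞) * meanSize ν = 1) (hmean : meanSize ν < ∞)
    (hν : (ν : Measure ℝ≥0) {0} = 0) (hv : IsValid K ν ξ μ)
    (hw : firstMoment (ξ + μ) ≠ 0) (hwfin : firstMoment (ξ + μ) ≠ ∞) :
    ∃ σ : ℝ≥0 ≃o ℝ≥0, (∀ t, (σ t : ℝ≥0∞) = S Ψ 0 t) ∧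
      (∀ u, (σ.symm u : ℝ≥0∞) = ∫⁻ v in Iic u, (min (X Ψ (σ.symm v)) K : ℝ≥0) ∂lebesgue) ∧
      ClockSolution K lam ν (ξ + μ) (fun u => X Ψ (σ.symm u)) (fun u => (Ψ (σ.symm u)).server) := by
  have hfin := h.S_ne_top hK hload hmean hv hw hwfin
  obtain ⟨σ, hσ⟩ := exists_clock Ψ hK h.Z_le hfin
  have hxm : Measurable fun u => X Ψ (σ.symm u) :=
    h.measurable_X.comp σ.symm.continuous.measurable
  -- Workload is a nonzero constant, so the system is never empty; this is what allows division by Z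
  -- in the change of time.
  have hZpos : ∀ t, Z Ψ t ≠ 0 := fun t hZ => hw (by
    rw [← h.work_const hload hv (hfin t),
      work_of_mass_eq_zero ν Ψ hZ (h.Q_eq_zero_of_Z_eq_zero hK hZ)])
  have hT : ∀ u, (σ.symm u : ℝ≥0∞) =
      ∫⁻ v in Iic u, (min (X Ψ (σ.symm v)) K : ℝ≥0) ∂lebesgue := by
    intro u
    have h1 := lintegral_Iic_comp_orderIso σ (f := fun τ => (Z Ψ τ : ℝ≥0∞)⁻¹)
      h.measurable_Z.coe_nnreal_ennreal.inv (fun t => by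
        rw [hσ, S, lintegral_Ioc_zero (measure_singleton 0)])
      (g := fun v => (min (X Ψ (σ.symm v)) K : ℝ≥0)) (by fun_prop) (σ.symm u)
    rw [σ.apply_symm_apply] at h1
    rw [← h1, ← lebesgue_Iic, ← setLIntegral_one]
    refine lintegral_congr fun r => ?_
    rw [σ.symm_apply_apply, ← h.policy_server, ENNReal.inv_mul_cancel
      (by exact_mod_cast hZpos r) ENNReal.coe_ne_top]
  refine ⟨σ, hσ, hT, ?_⟩
  have hσm : Measurable σ := σ.continuous.measurable
  have hpre : ∀ u, σ ⁻¹' Iic u = Iic (σ.symm u) := fun u => by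
    ext s; simp [OrderIso.le_symm_apply]
  have hQ : ∀ t, X Ψ t - K = Q Ψ t := fun t => (h.policy_buffer t).symm
  refine clockSolution_of hload hν hv hxm (m := h.inflow.map σ) (T := σ.symm) hT (fun u => ?_)
    (fun y u => ?_) (fun u => ?_) (fun u v huv => ?_)
  · rw [Measure.map_apply hσm measurableSet_Iic, hpre, h.inflow_Iic, hQ, h.inflow_Ioc_add zero_le,
      tsub_zero, Q, h.init_buffer]
  · have h1 := h.server_tailAt (σ.symm u) y
    rw [← hσ, σ.apply_symm_apply, ← ENNReal.coe_add, tailAt_coe, tailAt_coe] at h1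
    rw [h1, setLIntegral_map (f := fun v => (ν : Measure ℝ≥0) (Ioi (y + (u - v))))
      measurableSet_Iic ((measurable_tail _).comp (f := fun v : ℝ≥0 => y + (u - v)) (by fun_prop))
      hσm, hpre]
    congr 1
    refine setLIntegral_congr_fun measurableSet_Iic fun s hs => ?_
    have h2 := S_add Ψ (zero_le (a := s)) hs
    have h3 : S Ψ s (σ.symm u) = (u - σ s : ℝ≥0) := by
      rw [← hσ, ← hσ, σ.apply_symm_apply] at h2
      rw [ENNReal.coe_sub, ← h2, ENNReal.add_sub_cancel_left ENNReal.coe_ne_top]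
    rw [h3, ← ENNReal.coe_add, tailAt_coe]
  · have := h.coe_Z (σ.symm u)
    rw [← ENNReal.coe_zero, tailAt_coe] at this
    rw [← this, h.policy_server]
  · exact h.X_add_le (σ.symm.monotone huv)

/-! ### Exponential weights, uniqueness for convolutions, weighted fixed points. -/

section Laplace

/-- A measure without an atom at `0` has arbitrarily small Laplace transform. -/
theorem exists_laplace_le {n : Measure ℝ≥0} (hn : n {0} = 0)
    (hfin : ∫⁻ v : ℝ≥0, ENNReal.ofReal (Real.exp (-v)) ∂n ≠ ∞) {ε : ℝ≥0∞} (hε : ε ≠ 0) :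
    ∃ α : ℝ, 1 ≤ α ∧ ∫⁻ v : ℝ≥0, ENNReal.ofReal (Real.exp (-(α * v))) ∂n ≤ ε := by
  have ht : Tendsto (fun k : ℕ => ∫⁻ v : ℝ≥0, ENNReal.ofReal (Real.exp (-(((k : ℝ) + 1) * v))) ∂n)
      atTop (𝓝 (∫⁻ _, 0 ∂n)) := by
    refine tendsto_lintegral_of_dominated_convergence
      (fun v : ℝ≥0 => ENNReal.ofReal (Real.exp (-v))) (fun k => by fun_prop) (fun k => ?_) hfin ?_
    · refine Eventually.of_forall fun v => ENNReal.ofReal_le_ofReal (Real.exp_le_exp.2 ?_)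
      have : (0 : ℝ) ≤ (k : ℝ) * v := by positivity
      linarith
    · have h0 : ∀ᵐ v ∂n, v ≠ 0 := by
        rw [ae_iff]; simpa using hn
      filter_upwards [h0] with v hv
      have hv' : (0 : ℝ) < v := by exact_mod_cast pos_iff_ne_zero.2 hv
      rw [← ENNReal.ofReal_zero]
      refine (ENNReal.continuous_ofReal.tendsto 0).comp ?_
      refine Real.tendsto_exp_neg_atTop_nhds_zero.comp ?_
      exact (tendsto_natCast_atTop_atTop.atTop_add tendsto_const_nhds).atTop_mul_const hv'
  rw [lintegral_zero] at ht
  obtain ⟨k, hk⟩ := (ht.eventually_lt_const (pos_iff_ne_zero.2 hε)).exists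
  exact ⟨k + 1, by simp, hk.le⟩

theorem lintegral_exp_neg_le (n : Measure ℝ≥0) :
    ∫⁻ v : ℝ≥0, ENNReal.ofReal (Real.exp (-v)) ∂n ≤ n univ := by
  rw [← setLIntegral_one, Measure.restrict_univ]
  refine lintegral_mono fun v => ?_
  rw [← ENNReal.ofReal_one]
  exact ENNReal.ofReal_le_ofReal (by simp)

theorem lintegral_exp_neg_lebesgue_ne_top :
    ∫⁻ v : ℝ≥0, ENNReal.ofReal (Real.exp (-v)) ∂lebesgue ≠ ∞ := by
  have h : ∫⁻ v : ℝ≥0, ENNReal.ofReal (Real.exp (-v)) ∂lebesgue =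
      ∫⁻ r in Ici (0 : ℝ), ENNReal.ofReal (Real.exp (-r)) := by
    have h1 := measurableEmbedding_coe.lintegral_map (μ := lebesgue)
      (fun r : ℝ => ENNReal.ofReal (Real.exp (-r)))
    rw [← h1, lebesgue, measurableEmbedding_coe.map_comap]
    congr 2
    exact Subtype.range_coe
  rw [h, setLIntegral_congr Ioi_ae_eq_Ici.symm]
  have hi : IntegrableOn (fun r : ℝ => Real.exp (-r)) (Ioi 0) := integrableOn_exp_neg_Ioi 0
  rw [← ofReal_integral_eq_lintegral_ofReal hi (Eventually.of_forall fun r => (Real.exp_pos _).le)]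
  exact ENNReal.ofReal_ne_top

/-- Uniqueness principle for convolution equations. -/
theorem eq_zero_of_le_convolution {n : Measure ℝ≥0} {α : ℝ} (hα : 0 ≤ α)
    (hn : ∫⁻ v : ℝ≥0, ENNReal.ofReal (Real.exp (-(α * v))) ∂n ≤ 2⁻¹) {d : ℝ≥0 → ℝ≥0∞}
    {U C : ℝ≥0} (hC : ∀ u ≤ U, d u ≤ C) (hd : ∀ u ≤ U, d u ≤ ∫⁻ v in Iic u, d (u - v) ∂n) :
    ∀ u ≤ U, d u = 0 := by
  -- Each use of the convolution inequality multiplies the bound relative to exp(α u) by the Laplace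
  -- transform, which is at most one half.
  have key : ∀ (k : ℕ), ∀ u ≤ U, d u ≤ C * (2⁻¹) ^ k * ENNReal.ofReal (Real.exp (α * u)) := by
    intro k
    induction k with
    | zero =>
      intro u hu
      rw [pow_zero, mul_one]
      refine (hC u hu).trans (le_mul_of_one_le_right zero_le ?_)
      rw [← ENNReal.ofReal_one]
      exact ENNReal.ofReal_le_ofReal (Real.one_le_exp (by positivity))
    | succ k ih =>
      intro u hu
      calc d u ≤ ∫⁻ v in Iic u, d (u - v) ∂n := hd u hu
        _ ≤ ∫⁻ v in Iic u, C * (2⁻¹) ^ k * ENNReal.ofReal (Real.exp (α * u)) *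
            ENNReal.ofReal (Real.exp (-(α * v))) ∂n := by
          refine setLIntegral_mono (by fun_prop) fun v hv => ?_
          refine (ih (u - v) (tsub_le_self.trans hu)).trans (le_of_eq ?_)
          rw [mul_assoc _ (ENNReal.ofReal _), ← ENNReal.ofReal_mul (Real.exp_pos _).le,
            ← Real.exp_add, NNReal.coe_sub hv]
          congr 3
          ring
        _ ≤ ∫⁻ v, C * (2⁻¹) ^ k * ENNReal.ofReal (Real.exp (α * u)) *
            ENNReal.ofReal (Real.exp (-(α * v))) ∂n := setLIntegral_le_lintegral _ _
        _ = C * (2⁻¹) ^ k * ENNReal.ofReal (Real.exp (α * u)) *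
            ∫⁻ v : ℝ≥0, ENNReal.ofReal (Real.exp (-(α * v))) ∂n := by
          rw [lintegral_const_mul _ (by fun_prop)]
        _ ≤ C * (2⁻¹) ^ k * ENNReal.ofReal (Real.exp (α * u)) * 2⁻¹ := by gcongr
        _ = _ := by rw [pow_succ]; ring
  intro u hu
  have hlim : Tendsto (fun k : ℕ => C * (2⁻¹) ^ k * ENNReal.ofReal (Real.exp (α * u))) atTop
      (𝓝 (C * 0 * ENNReal.ofReal (Real.exp (α * u)))) := by
    refine ENNReal.Tendsto.mul_const (ENNReal.Tendsto.const_mul ?_ (Or.inr ENNReal.coe_ne_top))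
      (Or.inr ENNReal.ofReal_ne_top)
    exact ENNReal.tendsto_pow_atTop_nhds_zero_of_lt_one (by norm_num)
  rw [mul_zero, zero_mul] at hlim
  exact le_antisymm (ge_of_tendsto hlim (Eventually.of_forall fun k => key k u hu)) zero_le

end Laplace

/-- A fixed point theorem for maps contracting a weighted supremum distance. -/
theorem exists_fixedPoint_of_weighted {T E : Type*} [NormedAddCommGroup E] [CompleteSpace E]
    {P : (T → E) → Prop} {Φ : (T → E) → T → E} {ω : T → ℝ} {f₀ : T → E} {C : ℝ} (h₀ : P f₀)
    (hΦ : ∀ f, P f → P (Φ f)) (hC : 0 ≤ C) (hstart : ∀ u, ‖f₀ u - Φ f₀ u‖ ≤ C * ω u)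
    (hcontr : ∀ f g c, P f → P g → 0 ≤ c → (∀ u, ‖f u - g u‖ ≤ c * ω u) →
      ∀ u, ‖Φ f u - Φ g u‖ ≤ c / 2 * ω u)
    (hclosed : ∀ (F : ℕ → T → E) f c, (∀ k, P (F k)) →
      (∀ k u, ‖F k u - f u‖ ≤ c / 2 ^ k * ω u) → P f) :
    ∃ f, P f ∧ Φ f = f := by
  set F : ℕ → T → E := fun k => Φ^[k] f₀ with hF
  have hsucc : ∀ k, F (k + 1) = Φ (F k) := fun k => Function.iterate_succ_apply' Φ k f₀
  have hP : ∀ k, P (F k) := by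
    intro k
    induction k with
    | zero => exact h₀
    | succ k ih => rw [hsucc]; exact hΦ _ ih
  have hstep : ∀ k u, ‖F k u - F (k + 1) u‖ ≤ C / 2 ^ k * ω u := by
    intro k
    induction k with
    | zero => simpa [hF] using hstart
    | succ k ih =>
      intro u
      have h1 := hcontr _ _ _ (hP k) (hP (k + 1)) (by positivity) ih u
      rw [← hsucc, ← hsucc] at h1
      rwa [pow_succ, ← div_div]
  have hgeo : ∀ u k, dist (F k u) (F (k + 1) u) ≤ (2 * C * ω u) / 2 / 2 ^ k := fun u k => by
    rw [dist_eq_norm]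
    refine (hstep k u).trans (le_of_eq ?_)
    ring
  choose f hf using fun u => cauchySeq_tendsto_of_complete (cauchySeq_of_le_geometric_two (hgeo u))
  have hdist : ∀ k u, ‖F k u - f u‖ ≤ 2 * C / 2 ^ k * ω u := fun k u => by
    have h1 := dist_le_of_le_geometric_two_of_tendsto (hgeo u) (hf u) k
    rw [dist_eq_norm] at h1
    refine h1.trans (le_of_eq ?_)
    ring
  have hPf : P f := hclosed F f (2 * C) hP hdist
  refine ⟨f, hPf, funext fun u => ?_⟩
  refine tendsto_nhds_unique ?_ ((tendsto_add_atTop_iff_nat 1).2 (hf u))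
  rw [tendsto_iff_norm_sub_tendsto_zero]
  have hb : ∀ k, ‖F (k + 1) u - Φ f u‖ ≤ 2 * C / 2 ^ k / 2 * ω u := fun k => by
    rw [hsucc]
    exact hcontr _ _ _ (hP k) hPf (by positivity) (hdist k) u
  refine squeeze_zero (fun _ => norm_nonneg _) hb ?_
  have h2 : Tendsto (fun k : ℕ => C * ω u * (1 / 2 : ℝ) ^ k) atTop (𝓝 (C * ω u * 0)) :=
    (tendsto_pow_atTop_nhds_zero_of_lt_one (by norm_num) (by norm_num)).const_mul _
  rw [mul_zero] at h2
  refine h2.congr fun k => ?_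
  rw [one_div, inv_pow]
  ring

section Weighted

variable {α : ℝ} {n : Measure ℝ≥0}

/-- Laplace transform. -/
noncomputable def laplace (n : Measure ℝ≥0) (α : ℝ) : ℝ≥0∞ :=
  ∫⁻ v : ℝ≥0, ENNReal.ofReal (Real.exp (-(α * v))) ∂n

/-- For v > u the truncated difference is 0, so `g 0 = 0` makes the integral over the whole
half-line a convolution over [0, u]. -/
theorem abs_integral_comp_tsub_le (hL : laplace n α ≠ ∞) {g : ℝ≥0 → ℝ} (hg0 : g 0 = 0) {c : ℝ}
    (hc : 0 ≤ c) (hg : ∀ v, |g v| ≤ c * Real.exp (α * v)) (u : ℝ≥0) :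
    |∫ v, g (u - v) ∂n| ≤ c * (laplace n α).toReal * Real.exp (α * u) := by
  have hpos : 0 ≤ c * Real.exp (α * u) := by positivity
  have h1 : ∫⁻ v, ENNReal.ofReal ‖g (u - v)‖ ∂n ≤
      ENNReal.ofReal (c * Real.exp (α * u)) * laplace n α := by
    rw [laplace, ← lintegral_const_mul _ (by fun_prop)]
    refine lintegral_mono fun v => ?_
    rw [← ENNReal.ofReal_mul hpos, mul_assoc, ← Real.exp_add, Real.norm_eq_abs]
    refine ENNReal.ofReal_le_ofReal ?_
    rcases le_total v u with h | h
    · refine (hg _).trans (le_of_eq ?_)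
      rw [NNReal.coe_sub h]
      ring_nf
    · rw [tsub_eq_zero_of_le h, hg0, abs_zero]
      positivity
  rw [← Real.norm_eq_abs]
  refine (norm_integral_le_lintegral_norm _).trans ((ENNReal.toReal_mono (by finiteness) h1).trans
    (le_of_eq ?_))
  rw [ENNReal.toReal_mul, ENNReal.toReal_ofReal hpos]
  ring

theorem abs_setIntegral_Iic_le (hL : laplace lebesgue α ≠ ∞) {g : ℝ≥0 → ℝ} {c : ℝ}
    (hc : 0 ≤ c) (hg : ∀ v, |g v| ≤ c * Real.exp (α * v)) (u : ℝ≥0) :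
    |∫ v in Iic u, g v ∂lebesgue| ≤ c * (laplace lebesgue α).toReal * Real.exp (α * u) := by
  have hpos : 0 ≤ c * Real.exp (α * u) := by positivity
  have h1 : ∫⁻ v in Iic u, ENNReal.ofReal ‖g v‖ ∂lebesgue ≤
      ENNReal.ofReal (c * Real.exp (α * u)) * laplace lebesgue α := by
    calc ∫⁻ v in Iic u, ENNReal.ofReal ‖g v‖ ∂lebesgue
        ≤ ∫⁻ v in Iic u, ENNReal.ofReal (c * Real.exp (α * v)) ∂lebesgue :=
          lintegral_mono fun v => ENNReal.ofReal_le_ofReal (hg v)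
      _ = ∫⁻ v in Iic u, ENNReal.ofReal (c * Real.exp (α * (u - v : ℝ≥0))) ∂lebesgue :=
          (lintegral_Iic_reflect u (f := fun v => ENNReal.ofReal (c * Real.exp (α * v)))
            (by fun_prop)).symm
      _ ≤ ∫⁻ v in Iic u, ENNReal.ofReal (c * Real.exp (α * u)) *
            ENNReal.ofReal (Real.exp (-(α * v))) ∂lebesgue := by
          refine setLIntegral_mono (by fun_prop) fun v hv => ?_
          rw [← ENNReal.ofReal_mul hpos, mul_assoc, ← Real.exp_add, NNReal.coe_sub hv]
          ring_nf
          exact le_rfl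
      _ ≤ ∫⁻ v, ENNReal.ofReal (c * Real.exp (α * u)) *
            ENNReal.ofReal (Real.exp (-(α * v))) ∂lebesgue := setLIntegral_le_lintegral _ _
      _ = _ := by rw [lintegral_const_mul _ (by fun_prop)]; rfl
  rw [← Real.norm_eq_abs]
  refine (norm_integral_le_lintegral_norm _).trans ((ENNReal.toReal_mono (by finiteness) h1).trans
    (le_of_eq ?_))
  rw [ENNReal.toReal_mul, ENNReal.toReal_ofReal hpos]
  ring

end Weighted

/-! ### Picard iteration for mass and input in clock time. -/

section Load

variable {K : ℝ≥0} {f g : ℝ≥0 → ℝ}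

/-- The time during which the clock reaches `u`, if the total mass is `f`. -/
noncomputable def load (K : ℝ≥0) (f : ℝ≥0 → ℝ) (u : ℝ≥0) : ℝ :=
  ∫ v in Iic u, min (max (f v) 0) K ∂lebesgue

theorem served_nonneg (K : ℝ≥0) (r : ℝ) : 0 ≤ min (max r 0) (K : ℝ) :=
  le_min (le_max_right _ _) K.2

theorem integrableOn_served (hf : Measurable f) {E : Set ℝ≥0} (hE : lebesgue E ≠ ∞) :
    IntegrableOn (fun v => min (max (f v) 0) (K : ℝ)) E lebesgue := by
  refine Measure.integrableOn_of_bounded (M := K) hE (by fun_prop) (Eventually.of_forall fun v => ?_)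
  rw [Real.norm_of_nonneg (served_nonneg K _)]
  exact min_le_right _ _

theorem ofReal_load (hf : Measurable f) (u : ℝ≥0) : ENNReal.ofReal (load K f u) =
    ∫⁻ v in Iic u, (min (f v).toNNReal K : ℝ≥0) ∂lebesgue := by
  rw [load, ofReal_integral_eq_lintegral_ofReal (integrableOn_served hf (by simp [lebesgue_Iic]))
    (Eventually.of_forall fun v => served_nonneg K _)]
  refine lintegral_congr fun v => ?_
  rw [← Real.coe_toNNReal', ← NNReal.coe_min, ENNReal.ofReal_coe_nnreal]

theorem load_nonneg (K : ℝ≥0) (f : ℝ≥0 → ℝ) (u : ℝ≥0) : 0 ≤ load K f u :=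
  integral_nonneg fun _ => served_nonneg K _

theorem load_zero (K : ℝ≥0) (f : ℝ≥0 → ℝ) : load K f 0 = 0 := by
  rw [load, Measure.restrict_eq_zero.2 (by rw [lebesgue_Iic, ENNReal.coe_zero]), integral_zero_measure]

theorem load_sub (hf : Measurable f) {u v : ℝ≥0} (huv : u ≤ v) :
    load K f v - load K f u = ∫ r in Ioc u v, min (max (f r) 0) K ∂lebesgue := by
  have h := setIntegral_union (μ := lebesgue) (f := fun r => min (max (f r) 0) (K : ℝ))
    (Set.disjoint_left.2 fun a (ha : a ∈ Iic u) (hb : a ∈ Ioc u v) => not_lt.2 ha hb.1)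
    measurableSet_Ioc (integrableOn_served hf (by simp [lebesgue_Iic]))
    (integrableOn_served hf (by simp [lebesgue_Ioc]))
  rw [Iic_union_Ioc_eq_Iic huv] at h
  rw [load, load, h, add_sub_cancel_left]

theorem monotone_load (hf : Measurable f) : Monotone (load K f) := fun u v huv => by
  rw [← sub_nonneg, load_sub hf huv]
  exact integral_nonneg fun _ => served_nonneg K _

theorem load_sub_le (hf : Measurable f) {u v : ℝ≥0} (huv : u ≤ v) :
    load K f v - load K f u ≤ K * (v - u) := by
  rw [load_sub hf huv]
  refine (setIntegral_mono_on (g := fun _ => (K : ℝ)) (integrableOn_served hf (by simp [lebesgue_Ioc]))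
    (integrableOn_const (by simp [lebesgue_Ioc])) measurableSet_Ioc
    fun r _ => min_le_right _ _).trans (le_of_eq ?_)
  rw [setIntegral_const, measureReal_def, lebesgue_Ioc, ENNReal.coe_toReal, NNReal.coe_sub huv,
    smul_eq_mul, mul_comm]

theorem continuous_load (hf : Measurable f) : Continuous (load K f) := by
  refine (LipschitzWith.of_dist_le_mul (K := K) fun u v => ?_).continuous
  wlog huv : u ≤ v generalizing u v
  · rw [dist_comm, dist_comm u]
    exact this v u (le_of_not_ge huv)
  rw [dist_comm, Real.dist_eq, abs_of_nonneg (sub_nonneg.2 (monotone_load hf huv)), dist_comm,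
    NNReal.dist_eq, abs_of_nonneg (sub_nonneg.2 (by exact_mod_cast huv))]
  exact load_sub_le hf huv

theorem abs_load_sub_load_le (hf : Measurable f) (hg : Measurable g) {α c : ℝ} (hc : 0 ≤ c)
    (hL : laplace lebesgue α ≠ ∞) (h : ∀ v, |f v - g v| ≤ c * Real.exp (α * v)) (u : ℝ≥0) :
    |load K f u - load K g u| ≤ c * (laplace lebesgue α).toReal * Real.exp (α * u) := by
  rw [load, load, ← integral_sub (integrableOn_served hf (by simp [lebesgue_Iic]))
    (integrableOn_served hg (by simp [lebesgue_Iic]))]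
  refine abs_setIntegral_Iic_le hL hc (fun v => ?_) u
  exact (abs_min_sub_min_le_max _ _ _ _).trans (max_le ((abs_max_sub_max_le_abs _ _ _).trans (h v))
    (by rw [sub_self, abs_zero]; positivity))

end Load

/-- Arrivals to service: nondecreasing, right-continuous, and null at `0`. -/
structure IsInput (b : ℝ≥0 → ℝ) : Prop where
  mono : Monotone b
  right_continuous : ∀ u, ContinuousWithinAt b (Ici u) u
  zero : b 0 = 0

section Input

variable {b c : ℝ≥0 → ℝ} {n : Measure ℝ≥0} [IsFiniteMeasure n]

theorem IsInput.nonneg (h : IsInput b) (u : ℝ≥0) : 0 ≤ b u := h.zero ▸ h.mono zero_le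

theorem IsInput.integrable (h : IsInput b) (u : ℝ≥0) : Integrable (fun v => b (u - v)) n := by
  refine Integrable.of_bound (C := b u)
    (h.mono.measurable.comp (f := fun v : ℝ≥0 => u - v) (by fun_prop)).aestronglyMeasurable
    (Eventually.of_forall fun v => ?_)
  rw [Real.norm_of_nonneg (h.nonneg _)]
  exact h.mono tsub_le_self

theorem IsInput.convolution (h : IsInput b) : IsInput fun u => ∫ v, b (u - v) ∂n where
  mono u u' huu' := integral_mono (h.integrable u) (h.integrable u')
    fun v => h.mono (tsub_le_tsub_right huu' v)
  right_continuous u := by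
    have h1 : ∀ᶠ u' in 𝓝[≥] u, u' ∈ Iic (u + 1) :=
      nhdsWithin_le_nhds (Iic_mem_nhds (lt_add_of_pos_right u one_pos))
    refine tendsto_integral_filter_of_dominated_convergence (fun _ => b (u + 1))
      (Eventually.of_forall fun u' => (h.integrable u').aestronglyMeasurable) ?_
      (integrable_const _) (Eventually.of_forall fun v => ?_)
    · filter_upwards [h1] with u' hu'
      refine Eventually.of_forall fun v => ?_
      rw [Real.norm_of_nonneg (h.nonneg _)]
      exact h.mono (tsub_le_self.trans hu')
    · refine (h.right_continuous (u - v)).tendsto.comp ?_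
      refine tendsto_nhdsWithin_iff.2 ⟨?_, ?_⟩
      · exact ((continuous_id.sub continuous_const).tendsto u).mono_left nhdsWithin_le_nhds
      · filter_upwards [self_mem_nhdsWithin] with u' hu'
        exact tsub_le_tsub_right hu' v
  zero := by simp [h.zero]

/-- The weight is bounded on bounded sets, so convergence is locally uniform and right-continuity
survives; this closes the class under Picard limits. -/
theorem IsInput.of_weighted_limit {F : ℕ → ℝ≥0 → ℝ} {α C : ℝ} (hα : 0 ≤ α) (hC : 0 ≤ C)
    (hF : ∀ k, IsInput (F k))
    (hlim : ∀ k u, |F k u - b u| ≤ C / 2 ^ k * Real.exp (α * u)) : IsInput b := by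
  have hbound : ∀ r : ℝ, Tendsto (fun k : ℕ => C / 2 ^ k * r) atTop (𝓝 0) := fun r => by
    have h2 : Tendsto (fun k : ℕ => C * r * (1 / 2 : ℝ) ^ k) atTop (𝓝 (C * r * 0)) :=
      (tendsto_pow_atTop_nhds_zero_of_lt_one (by norm_num) (by norm_num)).const_mul _
    rw [mul_zero] at h2
    refine h2.congr fun k => ?_
    rw [one_div, inv_pow]
    ring
  have hpt : ∀ u, Tendsto (fun k => F k u) atTop (𝓝 (b u)) := fun u => by
    rw [tendsto_iff_norm_sub_tendsto_zero]
    exact squeeze_zero (fun _ => norm_nonneg _) (fun k => hlim k u) (hbound _)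
  refine ⟨fun u v huv => le_of_tendsto_of_tendsto' (hpt u) (hpt v) fun k => (hF k).mono huv, ?_, ?_⟩
  · intro u
    have hunif : TendstoUniformlyOn F b atTop (Iic (u + 1)) := by
      rw [Metric.tendstoUniformlyOn_iff]
      intro ε hε
      filter_upwards [(hbound (Real.exp (α * (u + 1)))).eventually_lt_const hε] with k hk v hv
      rw [dist_comm, Real.dist_eq]
      refine ((hlim k v).trans ?_).trans_lt hk
      have hv' : (v : ℝ) ≤ u + 1 := by exact_mod_cast hv
      gcongr
    have hc : ContinuousWithinAt b (Ici u ∩ Iic (u + 1)) u := by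
      have hu : u ∈ Ici u ∩ Iic (u + 1) := ⟨self_mem_Ici, by simp⟩
      refine continuousWithinAt_of_locally_uniform_approx_of_continuousWithinAt hu fun V hV => ?_
      obtain ⟨k, hk⟩ := (hunif V hV).exists
      exact ⟨_, inter_mem_nhdsWithin _ (Iic_mem_nhds (lt_add_of_pos_right u one_pos)), F k,
        ((hF k).right_continuous u).mono inter_subset_left, fun v hv => hk v hv.2⟩
    exact (continuousWithinAt_inter (Iic_mem_nhds (lt_add_of_pos_right u one_pos))).1 hc
  · refine tendsto_nhds_unique (hpt 0) ?_
    simp [(hF _).zero]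

end Input

theorem isInput_cdf {n : Measure ℝ≥0} (hfin : ∀ u, n (Iic u) ≠ ∞) (hn : n {0} = 0) :
    IsInput fun u => n.real (Iic u) where
  mono u v huv := measureReal_mono (Iic_subset_Iic.2 huv) (hfin v)
  right_continuous u := by
    rw [← continuousWithinAt_Ioi_iff_Ici]
    have h := tendsto_measure_biInter_gt (μ := n) (s := fun v : ℝ≥0 => Iic v) (a := u)
      (fun r _ => measurableSet_Iic.nullMeasurableSet)
      (fun i j _ hij => Iic_subset_Iic.2 hij) ⟨u + 1, lt_add_of_pos_right u one_pos, hfin _⟩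
    have h2 : ⋂ r > u, Iic r = Iic u := by
      ext a
      simp only [mem_iInter, mem_Iic]
      exact ⟨fun h => le_of_forall_gt_imp_ge_of_dense h, fun h r hr => h.trans hr.le⟩
    rw [h2] at h
    exact (ENNReal.tendsto_toReal (hfin u)).comp h
  zero := by
    have : Iic (0 : ℝ≥0) = {0} := by ext a; simp
    rw [this, measureReal_def, hn, ENNReal.toReal_zero]

section Picard

variable (K lam q₀ : ℝ≥0) (n μ : Measure ℝ≥0)

/-- Total mass produced from a given total mass and input. -/
noncomputable def nextMass (f : ℝ≥0 → ℝ × ℝ) (u : ℝ≥0) : ℝ :=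
  q₀ + μ.real univ + lam * load K (fun v => (f v).1) u - μ.real (Iic u) - ∫ v, (f (u - v)).2 ∂n

/-- Input to service produced from a given total mass and input. -/
noncomputable def nextInput (f : ℝ≥0 → ℝ × ℝ) (u : ℝ≥0) : ℝ :=
  lam * load K (fun v => (f v).1) u + q₀ - max (nextMass K lam q₀ n μ f u - K) 0

variable {K lam q₀ n μ} {f g : ℝ≥0 → ℝ × ℝ} [IsFiniteMeasure n] [IsFiniteMeasure μ]

theorem measurable_nextMass (hf : Measurable fun u => (f u).1) (hb : IsInput fun u => (f u).2) :
    Measurable (nextMass K lam q₀ n μ f) := by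
  have h1 : Measurable fun u => ∫ v, (f (u - v)).2 ∂n :=
    (hb.convolution (n := n)).mono.measurable
  have h2 : Measurable fun u => μ.real (Iic u) :=
    Monotone.measurable fun u v huv => measureReal_mono (Iic_subset_Iic.2 huv)
  have h3 := (continuous_load (K := K) hf).measurable
  exact ((measurable_const.add (h3.const_mul _)).sub h2).sub h1

/-- Apart from the load term, `nextMass` is nonincreasing, so the excess over K grows no faster than
λ times the load, and their difference is monotone. The relation `hq`, which comes from validity of
the initial condition, makes the input vanish at 0. -/
theorem isInput_nextInput (hμ : μ {0} = 0) (hq : (q₀ : ℝ) = max (q₀ + μ.real univ - K) 0)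
    (hf : Measurable fun u => (f u).1) (hb : IsInput fun u => (f u).2) :
    IsInput (nextInput K lam q₀ n μ f) where
  mono u v huv := by
    have h1 := monotone_load (K := K) hf huv
    have h2 := (hb.convolution (n := n)).mono huv
    have h3 : μ.real (Iic u) ≤ μ.real (Iic v) := measureReal_mono (Iic_subset_Iic.2 huv)
    have h4 := mul_le_mul_of_nonneg_left h1 lam.2
    have h5 : nextMass K lam q₀ n μ f v - nextMass K lam q₀ n μ f u ≤
        lam * load K (fun v => (f v).1) v - lam * load K (fun v => (f v).1) u := by
      simp only [nextMass] at *
      linarith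
    have h6 : max (nextMass K lam q₀ n μ f v - K) 0 ≤ max (nextMass K lam q₀ n μ f u - K) 0 +
        (lam * load K (fun v => (f v).1) v - lam * load K (fun v => (f v).1) u) := by
      refine max_le ?_ ?_
      · have := le_max_left (nextMass K lam q₀ n μ f u - K) 0
        linarith
      · have := le_max_right (nextMass K lam q₀ n μ f u - K) 0
        change (lam : ℝ) * _ ≤ (lam : ℝ) * _ at h4
        linarith
    simp only [nextInput]
    linarith
  right_continuous u := by
    have h1 : ContinuousWithinAt (load K fun v => (f v).1) (Ici u) u :=
      (continuous_load hf).continuousWithinAt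
    have h2 := (hb.convolution (n := n)).right_continuous u
    have h3 := (isInput_cdf (fun _ => measure_ne_top μ _) hμ).right_continuous u
    have h4 : ContinuousWithinAt (nextMass K lam q₀ n μ f) (Ici u) u :=
      ((continuousWithinAt_const.add (continuousWithinAt_const.mul h1)).sub h3).sub h2
    exact ((continuousWithinAt_const.mul h1).add continuousWithinAt_const).sub
      ((h4.sub continuousWithinAt_const).max continuousWithinAt_const)
  zero := by
    have h1 : ∫ v, (f (0 - v)).2 ∂n = 0 := (hb.convolution (n := n)).zero
    have h2 : μ.real (Iic 0) = 0 := (isInput_cdf (fun _ => measure_ne_top μ _) hμ).zero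
    rw [nextInput, nextMass, load_zero, h1, h2, mul_zero, zero_add, add_zero, sub_zero, sub_zero,
      ← hq, sub_self]

/-- The total mass and the input to service, as functions of the clock. -/
theorem exists_mass_input (hn : n {0} = 0) (hμ : μ {0} = 0)
    (hq : (q₀ : ℝ) = max (q₀ + μ.real univ - K) 0) :
    ∃ X b : ℝ≥0 → ℝ, Measurable X ∧ IsInput b ∧
      (∀ u, X u = q₀ + μ.real univ + lam * load K X u - μ.real (Iic u) - ∫ v, b (u - v) ∂n) ∧
      ∀ u, b u = lam * load K X u + q₀ - max (X u - K) 0 := by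
  -- The load enters `nextInput` twice, directly and through `nextMass`, while the convolution with
  -- n enters once; hence the measure n + 2λ·Lebesgue and the contraction factor one half.
  obtain ⟨α, hα, hL⟩ := exists_laplace_le (n := n + (2 * lam : ℝ≥0) • lebesgue) (ε := 2⁻¹)
    (by simp [hn]) (by
      rw [lintegral_add_measure, lintegral_smul_measure]
      refine ENNReal.add_ne_top.2 ⟨ne_top_of_le_ne_top (by finiteness) (lintegral_exp_neg_le n), ?_⟩
      exact ENNReal.mul_ne_top ENNReal.coe_ne_top lintegral_exp_neg_lebesgue_ne_top) (by simp)
  rw [lintegral_add_measure, lintegral_smul_measure] at hL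
  change laplace n α + _ * laplace lebesgue α ≤ _ at hL
  have hLn : laplace n α ≠ ∞ := ne_top_of_le_ne_top (by simp) (le_self_add.trans hL)
  have hLl : laplace lebesgue α ≠ ∞ := by
    refine ne_top_of_le_ne_top lintegral_exp_neg_lebesgue_ne_top (lintegral_mono fun v => ?_)
    refine ENNReal.ofReal_le_ofReal (Real.exp_le_exp.2 (neg_le_neg ?_))
    exact le_mul_of_one_le_left v.2 hα
  have hLr : (laplace n α).toReal + 2 * lam * (laplace lebesgue α).toReal ≤ 1 / 2 := by
    have := ENNReal.toReal_mono (by simp) hL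
    rw [ENNReal.toReal_add hLn (by finiteness), ENNReal.toReal_mul] at this
    simpa using this
  have hα0 : 0 ≤ α := zero_le_one.trans hα
  set A := (laplace n α).toReal with hA
  set A' := (laplace lebesgue α).toReal with hA'
  have hA'0 : 0 ≤ A' := ENNReal.toReal_nonneg
  suffices h : ∃ f : ℝ≥0 → ℝ × ℝ, ((Measurable fun u => (f u).1) ∧ IsInput fun u => (f u).2) ∧
      (fun u => (nextMass K lam q₀ n μ f u, nextInput K lam q₀ n μ f u)) = f by
    obtain ⟨f, ⟨hfm, hfb⟩, hfix⟩ := h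
    exact ⟨fun u => (f u).1, fun u => (f u).2, hfm, hfb, fun u => (congrArg Prod.fst
        (congrFun hfix u)).symm, fun u => by
          have h1 := congrArg Prod.fst (congrFun hfix u)
          have h2 := congrArg Prod.snd (congrFun hfix u)
          simp only at h1 h2
          show (f u).2 = _
          rw [← h2, nextInput, h1]⟩
  refine exists_fixedPoint_of_weighted
    (P := fun f : ℝ≥0 → ℝ × ℝ => (Measurable fun u => (f u).1) ∧ IsInput fun u => (f u).2)
    (Φ := fun f u => (nextMass K lam q₀ n μ f u, nextInput K lam q₀ n μ f u))
    (ω := fun u => Real.exp (α * u)) (f₀ := fun _ => 0)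
    (C := 2 * q₀ + 2 * μ.real univ + K)
    ⟨measurable_const, fun _ _ _ => le_rfl, fun _ => continuousWithinAt_const, rfl⟩
    (fun f hf => ⟨measurable_nextMass hf.1 hf.2, isInput_nextInput hμ hq hf.1 hf.2⟩)
    (by positivity) (fun u => ?_) (fun f g c hf hg hc hfg u => ?_) (fun F f c hF hlim => ?_)
  · have h0 : load K (fun _ => (0 : ℝ)) u = 0 := by simp [load]
    have h1 : nextMass K lam q₀ n μ (fun _ => 0) u = q₀ + μ.real univ - μ.real (Iic u) := by
      simp [nextMass, h0]
    have h2 : μ.real (Iic u) ≤ μ.real univ := measureReal_mono (subset_univ _)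
    have h3 : 0 ≤ μ.real (Iic u) := measureReal_nonneg
    have hq0 : (0 : ℝ) ≤ q₀ := q₀.2
    have hK0 : (0 : ℝ) ≤ K := K.2
    have h4 : 1 ≤ Real.exp (α * u) := Real.one_le_exp (by positivity)
    refine le_trans ?_ (le_mul_of_one_le_right (by positivity) h4)
    simp only [zero_sub, norm_neg]
    refine max_le ?_ ?_
    · rw [h1, Real.norm_of_nonneg (by linarith)]
      linarith
    · rw [Real.norm_eq_abs]
      simp only [nextInput]
      rw [h1]
      simp only [Prod.fst_zero, h0]
      rw [abs_le]
      have h5 : max ((q₀ : ℝ) + μ.real univ - μ.real (Iic u) - K) 0 ≤ q₀ + μ.real univ :=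
        max_le (by linarith) (by linarith)
      have h6 := le_max_right ((q₀ : ℝ) + μ.real univ - μ.real (Iic u) - K) 0
      constructor <;> linarith
  · have e1 : ∀ v, |(f v).1 - (g v).1| ≤ c * Real.exp (α * v) := fun v =>
      (le_max_left _ _).trans (hfg v)
    have e2 : ∀ v, |(f v).2 - (g v).2| ≤ c * Real.exp (α * v) := fun v =>
      (le_max_right _ _).trans (hfg v)
    have l1 := abs_load_sub_load_le (K := K) hf.1 hg.1 hc hLl e1 u
    have l2 := abs_integral_comp_tsub_le (n := n) hLn (g := fun v => (f v).2 - (g v).2)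
      (by rw [hf.2.zero, hg.2.zero, sub_self]) hc e2 u
    rw [integral_sub (hf.2.integrable u) (hg.2.integrable u)] at l2
    have l3 : |lam * load K (fun v => (f v).1) u - lam * load K (fun v => (g v).1) u| ≤
        lam * (c * A' * Real.exp (α * u)) := by
      rw [← mul_sub, abs_mul, abs_of_nonneg (NNReal.coe_nonneg lam)]
      exact mul_le_mul_of_nonneg_left l1 lam.2
    have m1 : |nextMass K lam q₀ n μ f u - nextMass K lam q₀ n μ g u| ≤
        lam * (c * A' * Real.exp (α * u)) + c * A * Real.exp (α * u) := by
      refine le_trans (le_of_eq ?_) ((abs_sub _ _).trans (add_le_add l3 l2))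
      simp only [nextMass]
      congr 1
      ring
    have m2 := (abs_max_sub_max_le_abs (nextMass K lam q₀ n μ f u - K)
      (nextMass K lam q₀ n μ g u - K) 0)
    rw [sub_sub_sub_cancel_right] at m2
    have hexp := (Real.exp_pos (α * u)).le
    have hce : 0 ≤ c * Real.exp (α * u) := by positivity
    have hfin : 2 * (lam * (c * A' * Real.exp (α * u))) + c * A * Real.exp (α * u) ≤
        c / 2 * Real.exp (α * u) := by
      have := mul_le_mul_of_nonneg_right hLr hce
      linarith
    refine max_le ?_ ?_
    · refine m1.trans (le_trans ?_ hfin)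
      have : 0 ≤ lam * (c * A' * Real.exp (α * u)) := by positivity
      linarith
    · refine le_trans ?_ hfin
      refine le_trans (le_of_eq ?_) ((abs_sub _ _).trans (add_le_add l3 (m2.trans m1))) |>.trans
        (le_of_eq (by ring))
      rw [Real.norm_eq_abs]
      simp only [nextInput, Prod.mk_sub_mk]
      congr 1
      ring
  · have e1 : ∀ k v, |(F k v).1 - (f v).1| ≤ c / 2 ^ k * Real.exp (α * v) := fun k v =>
      (le_max_left _ _).trans (hlim k v)
    have e2 : ∀ k v, |(F k v).2 - (f v).2| ≤ c / 2 ^ k * Real.exp (α * v) := fun k v =>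
      (le_max_right _ _).trans (hlim k v)
    have hc : 0 ≤ c := by
      have := (norm_nonneg _).trans (hlim 0 0)
      simpa using this
    refine ⟨measurable_of_tendsto_metrizable (fun k => (hF k).1) (tendsto_pi_nhds.2 fun u => ?_),
      IsInput.of_weighted_limit hα0 hc (fun k => (hF k).2) e2⟩
    rw [tendsto_iff_norm_sub_tendsto_zero]
    refine squeeze_zero (fun _ => norm_nonneg _) (fun k => e1 k u) ?_
    have h2 : Tendsto (fun k : ℕ => c * Real.exp (α * u) * (1 / 2 : ℝ) ^ k) atTop
        (𝓝 (c * Real.exp (α * u) * 0)) :=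
      (tendsto_pow_atTop_nhds_zero_of_lt_one (by norm_num) (by norm_num)).const_mul _
    rw [mul_zero] at h2
    refine h2.congr fun k => ?_
    rw [one_div, inv_pow]
    ring

end Picard

/-! ### Mass, input measure and real time as functions of the clock. -/

/-- Total mass `x`, input measure `m` and real time `T`, as functions of the clock. -/
structure ClockInput (K lam : ℝ≥0) (ν : ProbabilityMeasure ℝ≥0) (ξ μ : FinMeas) (x : ℝ≥0 → ℝ≥0)
    (m : Measure ℝ≥0) (T : ℝ≥0 → ℝ≥0) : Prop where
  measurable : Measurable x
  time : ∀ u, (T u : ℝ≥0∞) = ∫⁻ v in Iic u, (min (x v) K : ℝ≥0) ∂lebesgue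
  balance : ∀ u, m (Iic u) + (x u - K : ℝ≥0) = lam * T u + ξ.mass
  served : ∀ u, (μ : Measure ℝ≥0) (Ioi u) + ∫⁻ v in Iic u, (ν : Measure ℝ≥0) (Ioi (u - v)) ∂m =
    (min (x u) K : ℝ≥0)
  growth : ∀ u v, u ≤ v → x v ≤ x u + lam * (T v - T u)
  zero : m {0} = 0

theorem measure_Iic_of_zero {n : Measure ℝ≥0} (hn : n {0} = 0) (u : ℝ≥0) :
    n (Iic u) = n (Ioc 0 u) := by
  rw [← setLIntegral_one, ← lintegral_Ioc_zero hn, setLIntegral_one]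

/-- The measure of an input. -/
noncomputable def IsInput.measure {b : ℝ≥0 → ℝ} (h : IsInput b) : Measure ℝ≥0 :=
  (⟨b, h.mono, h.right_continuous⟩ : StieltjesFunction ℝ≥0).measure

theorem IsInput.measure_zero {b : ℝ≥0 → ℝ} (h : IsInput b) : h.measure {0} = 0 := by
  have := (⟨b, h.mono, h.right_continuous⟩ : StieltjesFunction ℝ≥0).measure_botSet
  rwa [botSet_eq_singleton_of_isBot (x := (0 : ℝ≥0)) (fun _ => zero_le)] at this

theorem IsInput.measure_Iic {b : ℝ≥0 → ℝ} (h : IsInput b) (u : ℝ≥0) :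
    h.measure (Iic u) = ENNReal.ofReal (b u) := by
  rw [measure_Iic_of_zero h.measure_zero, measure, StieltjesFunction.measure_Ioc]
  change ENNReal.ofReal (b u - b 0) = _
  rw [h.zero, sub_zero]

instance {b : ℝ≥0 → ℝ} (h : IsInput b) : SFinite h.measure := by
  rw [IsInput.measure]; infer_instance

/-- Translates the real-valued fixed point into measures. By parts, the arrivals still in service
amount to b - b∗ν, so the mass in service, which is the tail of μ plus b - b∗ν, equals X - (X-K)⁺.
-/
theorem exists_clockInput {K lam : ℝ≥0} (hK : 0 < K) {ν : ProbabilityMeasure ℝ≥0} {ξ μ : FinMeas}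
    (hν : (ν : Measure ℝ≥0) {0} = 0) (hv : IsValid K ν ξ μ) :
    ∃ x m T, SFinite m ∧ ClockInput K lam ν ξ μ x m T := by
  have hμ0 : (μ : Measure ℝ≥0) {0} = 0 := by
    rw [← FiniteMeasure.ennreal_coeFn_eq_coeFn_toMeasure, hv.server_zero, ENNReal.coe_zero]
  have hμu : (μ : Measure ℝ≥0).real univ = μ.mass := rfl
  have hξ : ξ.mass = ξ.mass + μ.mass - K := by
    conv_lhs => rw [hv.buffer_eq]
    exact mass_smul_probability _ _
  have hq : (ξ.mass : ℝ) = max (ξ.mass + (μ : Measure ℝ≥0).real univ - K) 0 := by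
    conv_lhs => rw [hξ]
    rw [NNReal.coe_sub_def, NNReal.coe_add, hμu]
  obtain ⟨X, b, hX, hb, hXeq, hbeq⟩ := exists_mass_input (K := K) (lam := lam) (q₀ := ξ.mass)
    (n := ν) (μ := μ) hν hμ0 hq
  have hν1 : (ν : Measure ℝ≥0) (Ioi 0) = 1 := by
    rw [← measure_univ_eq_of_zero hν, measure_univ]
  have hconv : ∀ u, ∫ v, b (u - v) ∂(ν : Measure ℝ≥0) ≤ b u := fun u => by
    refine (integral_mono (g := fun _ => b u) (hb.integrable u) (integrable_const _)
      fun v => hb.mono tsub_le_self).trans (le_of_eq ?_)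
    rw [integral_const, probReal_univ, one_smul]
  have hserved : ∀ u, ∫⁻ v in Iic u, (ν : Measure ℝ≥0) (Ioi (u - v)) ∂hb.measure =
      ENNReal.ofReal (b u - ∫ v, b (u - v) ∂(ν : Measure ℝ≥0)) := fun u => by
    have h1 := lintegral_tail_add_lintegral_cdf (ν : Measure ℝ≥0) hb.measure 0 u
    simp only [zero_add] at h1
    have h2 : ∫⁻ r in Ioc 0 u, hb.measure (Iic (u - r)) ∂(ν : Measure ℝ≥0) =
        ENNReal.ofReal (∫ v, b (u - v) ∂(ν : Measure ℝ≥0)) := by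
      rw [ofReal_integral_eq_lintegral_ofReal (hb.integrable u)
        (Eventually.of_forall fun v => hb.nonneg _), lintegral_Ioc_zero hν]
      simp_rw [hb.measure_Iic]
      rw [← lintegral_indicator measurableSet_Iic]
      refine lintegral_congr fun v => ?_
      by_cases hv : v ∈ Iic u
      · rw [indicator_of_mem hv]
      · rw [indicator_of_notMem hv, tsub_eq_zero_of_le (not_le.1 hv).le, hb.zero, ENNReal.ofReal_zero]
    rw [h2, hν1, mul_one, hb.measure_Iic] at h1
    rw [ENNReal.ofReal_sub _ (integral_nonneg fun v => hb.nonneg _), ← h1,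
      ENNReal.add_sub_cancel_right ENNReal.ofReal_ne_top]
  have hsplit : ∀ u, (μ : Measure ℝ≥0).real (Iic u) + (μ : Measure ℝ≥0).real (Ioi u) =
      (μ : Measure ℝ≥0).real univ := fun u => by
    rw [← compl_Iic]
    exact measureReal_add_measureReal_compl measurableSet_Iic
  have hmin : ∀ u, X u - max (X u - K) 0 = (μ : Measure ℝ≥0).real (Ioi u) +
      (b u - ∫ v, b (u - v) ∂(ν : Measure ℝ≥0)) := fun u => by
    have h1 := hXeq u
    have h2 := hbeq u
    have h3 := hsplit u
    linarith
  -- The sign of X is known only now, which is why `load` uses the positive part. If X were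
  -- negative, the left side of `hmin` would be X, while the right side is nonnegative.
  have hXpos : ∀ u, 0 ≤ X u := fun u => by
    by_contra hneg
    have h1 := hmin u
    rw [max_eq_right (by have : (0 : ℝ) ≤ K := K.2; linarith)] at h1
    have h2 : 0 ≤ (μ : Measure ℝ≥0).real (Ioi u) := measureReal_nonneg
    have h3 := hconv u
    linarith
  have hload : ∀ u, ENNReal.ofReal (load K X u) = ((load K X u).toNNReal : ℝ≥0∞) := fun u => rfl
  have hsub : ∀ u, (((X u).toNNReal - K : ℝ≥0) : ℝ) = max (X u - K) 0 := fun u => by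
    rw [NNReal.coe_sub_def, Real.coe_toNNReal _ (hXpos u)]
  refine ⟨fun u => (X u).toNNReal, hb.measure, fun u => (load K X u).toNNReal, inferInstance,
    by fun_prop, fun u => ?_, fun u => ?_, fun u => ?_, fun u v huv => ?_, hb.measure_zero⟩
  · rw [← hload, ofReal_load hX]
  · rw [hb.measure_Iic, hbeq]
    change ((_ : ℝ≥0) : ℝ≥0∞) + _ = _
    norm_cast
    rw [← NNReal.coe_inj, NNReal.coe_add, hsub, Real.coe_toNNReal _ (by
      rw [← hbeq]; exact hb.nonneg u), NNReal.coe_add, NNReal.coe_mul,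
      Real.coe_toNNReal _ (load_nonneg K X u)]
    ring
  · rw [hserved, ← ENNReal.ofReal_toReal (measure_ne_top (μ : Measure ℝ≥0) (Ioi u)),
      ← ENNReal.ofReal_add ENNReal.toReal_nonneg (sub_nonneg.2 (hconv u))]
    change ENNReal.ofReal ((μ : Measure ℝ≥0).real (Ioi u) + _) = _
    rw [← hmin, ← ENNReal.ofReal_coe_nnreal, NNReal.coe_min, Real.coe_toNNReal _ (hXpos u)]
    congr 1
    rcases le_total (X u) K with h | h
    · rw [max_eq_right (by linarith), min_eq_left h, sub_zero]
    · rw [max_eq_left (by linarith), min_eq_right h, sub_sub_cancel]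
  · have h1 := hb.convolution (n := (ν : Measure ℝ≥0)) |>.mono huv
    have h2 : (μ : Measure ℝ≥0).real (Iic u) ≤ (μ : Measure ℝ≥0).real (Iic v) :=
      measureReal_mono (Iic_subset_Iic.2 huv)
    have h3 := hXeq u
    have h4 := hXeq v
    have h5 := monotone_load (K := K) hX huv
    rw [← NNReal.coe_le_coe, NNReal.coe_add, NNReal.coe_mul,
      NNReal.coe_sub (Real.toNNReal_le_toNNReal h5), Real.coe_toNNReal _ (hXpos u),
      Real.coe_toNNReal _ (hXpos v), Real.coe_toNNReal _ (load_nonneg K X u),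
      Real.coe_toNNReal _ (load_nonneg K X v)]
    change ∫ w, b (u - w) ∂(ν : Measure ℝ≥0) ≤ ∫ w, b (v - w) ∂(ν : Measure ℝ≥0) at h1
    linarith

/-! ### Residual measures of arrival and departure records; càdlàg paths. -/

section Residual

variable (ρ : Measure (ℝ≥0 × ℝ≥0))

/-- The residual sizes at time `u` of jobs with (arrival, departure) times distributed by `ρ`. -/
noncomputable def residual (u : ℝ≥0) : Measure ℝ≥0 :=
  (ρ.restrict {p | p.1 ≤ u ∧ u < p.2}).map fun p => p.2 - u

/-- The residual sizes just before time `u`. -/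
noncomputable def residualLeft (u : ℝ≥0) : Measure ℝ≥0 :=
  (ρ.restrict {p | p.1 < u ∧ u ≤ p.2}).map fun p => p.2 - u

theorem measurableSet_active (u : ℝ≥0) : MeasurableSet {p : ℝ≥0 × ℝ≥0 | p.1 ≤ u ∧ u < p.2} :=
  (measurableSet_le measurable_fst measurable_const).inter
    (measurable_snd (measurableSet_Ioi (a := u)))

theorem measurableSet_activeLeft (u : ℝ≥0) : MeasurableSet {p : ℝ≥0 × ℝ≥0 | p.1 < u ∧ u ≤ p.2} :=
  (measurableSet_lt measurable_fst measurable_const).inter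
    (measurable_snd (measurableSet_Ici (a := u)))

theorem residual_Ioi (u y : ℝ≥0) : residual ρ u (Ioi y) = ρ {p | p.1 ≤ u ∧ y + u < p.2} := by
  have hm : Measurable fun p : ℝ≥0 × ℝ≥0 => p.2 - u := by fun_prop
  rw [residual, Measure.map_apply hm measurableSet_Ioi,
    Measure.restrict_apply (hm measurableSet_Ioi)]
  congr 1
  ext p
  simp only [mem_inter_iff, mem_preimage, mem_Ioi, mem_ofPred_eq, lt_tsub_iff_right]
  exact ⟨fun h => ⟨h.2.1, h.1⟩, fun h => ⟨h.2, h.1, le_add_self.trans_lt h.2⟩⟩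

theorem residual_zero (u : ℝ≥0) : residual ρ u {0} = 0 := by
  have hm : Measurable fun p : ℝ≥0 × ℝ≥0 => p.2 - u := by fun_prop
  rw [residual, Measure.map_apply hm (measurableSet_singleton _),
    Measure.restrict_apply (hm (measurableSet_singleton _))]
  convert measure_empty (μ := ρ)
  ext p
  simp only [mem_inter_iff, mem_preimage, mem_singleton_iff, mem_ofPred_eq, mem_empty_iff_false,
    iff_false, not_and, not_lt, tsub_eq_zero_iff_le]
  exact fun h _ => h

variable {ρ} (hρ : ∀ u, ρ {p | p.1 ≤ u} ≠ ∞)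

include hρ

theorem isFiniteMeasure_residual (u : ℝ≥0) : IsFiniteMeasure (residual ρ u) := by
  have : IsFiniteMeasure (ρ.restrict {p | p.1 ≤ u ∧ u < p.2}) := ⟨by
    rw [Measure.restrict_apply_univ]
    exact (measure_mono fun p hp => hp.1).trans_lt (hρ u).lt_top⟩
  rw [residual]
  infer_instance

theorem isFiniteMeasure_residualLeft (u : ℝ≥0) : IsFiniteMeasure (residualLeft ρ u) := by
  have : IsFiniteMeasure (ρ.restrict {p | p.1 < u ∧ u ≤ p.2}) := ⟨by
    rw [Measure.restrict_apply_univ]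
    exact (measure_mono fun p hp => hp.1.le).trans_lt (hρ u).lt_top⟩
  rw [residualLeft]
  infer_instance

omit hρ in
theorem edist_tsub_tsub_le (a b c : ℝ≥0) : edist (a - b) (a - c) ≤ edist b c := by
  rw [edist_nndist, edist_nndist, ENNReal.coe_le_coe, ← NNReal.coe_le_coe, coe_nndist, coe_nndist,
    NNReal.dist_eq, NNReal.dist_eq, NNReal.coe_sub_def, NNReal.coe_sub_def]
  refine (abs_max_sub_max_le_abs _ _ _).trans (le_of_eq ?_)
  rw [sub_sub_sub_cancel_left, abs_sub_comm]

/-- From u to v, residuals present at both times move by at most v - u. The active set changes only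
by records with an arrival or departure in (u, v], and their mass tends to zero as the interval
shrinks to the empty set. -/
theorem tendsto_residual_right (u : ℝ≥0) :
    Tendsto (fun v => levyProkhorovEDist (residual ρ v) (residual ρ u)) (𝓝[≥] u) (𝓝 0) := by
  set A : ℝ≥0 → Set (ℝ≥0 × ℝ≥0) := fun v =>
    {p | p.1 ≤ u + 1} ∩ (Prod.fst ⁻¹' Ioc u v ∪ Prod.snd ⁻¹' Ioc u v) with hA
  have hB : MeasurableSet {p : ℝ≥0 × ℝ≥0 | p.1 ≤ u + 1} :=
    measurableSet_le measurable_fst measurable_const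
  have hsmall : ∀ r : ℝ≥0, ∀ᶠ v in 𝓝[≥] u, r ∉ Ioc u v := fun r => by
    rcases le_or_gt r u with h | h
    · exact Eventually.of_forall fun v hv => not_lt.2 h hv.1
    · filter_upwards [nhdsWithin_le_nhds (Iio_mem_nhds h)] with v hv hr
      exact not_lt.2 hr.2 hv
  have h1 : Tendsto (fun v => ρ (A v)) (𝓝[≥] u) (𝓝 (ρ ∅)) := by
    refine tendsto_measure_of_tendsto_indicator _ (fun v => hB.inter
      ((measurable_fst measurableSet_Ioc).union (measurable_snd measurableSet_Ioc))) hB (hρ _)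
      (Eventually.of_forall fun v => inter_subset_left) fun p => ?_
    filter_upwards [hsmall p.1, hsmall p.2] with v hv1 hv2
    simp only [mem_empty_iff_false, iff_false]
    rintro ⟨-, h | h⟩
    · exact hv1 h
    · exact hv2 h
  rw [measure_empty] at h1
  have h2 : Tendsto (fun v => edist v u) (𝓝[≥] u) (𝓝 0) :=
    ((continuous_id.edist continuous_const).tendsto' u 0 (edist_self u)).mono_left nhdsWithin_le_nhds
  have h3 := h1.max h2
  rw [max_self] at h3
  refine tendsto_of_tendsto_of_tendsto_of_le_of_le' tendsto_const_nhds h3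
    (Eventually.of_forall fun _ => zero_le) ?_
  filter_upwards [self_mem_nhdsWithin, nhdsWithin_le_nhds (Iic_mem_nhds (lt_add_of_pos_right u one_pos))]
    with v hv hv1
  refine levyProkhorovEDist_map_restrict_le ρ (measurableSet_active v) (measurableSet_active u)
    (by fun_prop) (by fun_prop) _ (fun p _ => (edist_tsub_tsub_le _ _ _).trans (le_max_right _ _))
    ((measure_mono ?_).trans (le_max_left _ _)) ((measure_mono ?_).trans (le_max_left _ _))
  · rintro p ⟨⟨ha, hb⟩, hc⟩
    refine ⟨ha.trans hv1, Or.inl ⟨lt_of_not_ge fun h => hc ⟨h, lt_of_le_of_lt hv hb⟩, ha⟩⟩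
  · rintro p ⟨⟨ha, hb⟩, hc⟩
    exact ⟨ha.trans le_self_add, Or.inr ⟨hb, le_of_not_gt fun h => hc ⟨ha.trans hv, h⟩⟩⟩

/-- Same estimate with the open interval (v, u). The limit may charge 0 through departures exactly
at u, so it is a different measure from `residual ρ u`. -/
theorem tendsto_residual_left (u : ℝ≥0) :
    Tendsto (fun v => levyProkhorovEDist (residual ρ v) (residualLeft ρ u)) (𝓝[<] u) (𝓝 0) := by
  set A : ℝ≥0 → Set (ℝ≥0 × ℝ≥0) := fun v =>
    {p | p.1 ≤ u} ∩ (Prod.fst ⁻¹' Ioo v u ∪ Prod.snd ⁻¹' Ioo v u) with hA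
  have hB : MeasurableSet {p : ℝ≥0 × ℝ≥0 | p.1 ≤ u} :=
    measurableSet_le measurable_fst measurable_const
  have hsmall : ∀ r : ℝ≥0, ∀ᶠ v in 𝓝[<] u, r ∉ Ioo v u := fun r => by
    rcases le_or_gt u r with h | h
    · exact Eventually.of_forall fun v hv => not_lt.2 h hv.2
    · filter_upwards [nhdsWithin_le_nhds (Ioi_mem_nhds h)] with v hv hr
      exact lt_asymm hr.1 hv
  have h1 : Tendsto (fun v => ρ (A v)) (𝓝[<] u) (𝓝 (ρ ∅)) := by
    refine tendsto_measure_of_tendsto_indicator _ (fun v => hB.inter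
      ((measurable_fst measurableSet_Ioo).union (measurable_snd measurableSet_Ioo))) hB (hρ _)
      (Eventually.of_forall fun v => inter_subset_left) fun p => ?_
    filter_upwards [hsmall p.1, hsmall p.2] with v hv1 hv2
    simp only [mem_empty_iff_false, iff_false]
    rintro ⟨-, h | h⟩
    · exact hv1 h
    · exact hv2 h
  rw [measure_empty] at h1
  have h2 : Tendsto (fun v => edist v u) (𝓝[<] u) (𝓝 0) :=
    ((continuous_id.edist continuous_const).tendsto' u 0 (edist_self u)).mono_left nhdsWithin_le_nhds
  have h3 := h1.max h2
  rw [max_self] at h3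
  refine tendsto_of_tendsto_of_tendsto_of_le_of_le' tendsto_const_nhds h3
    (Eventually.of_forall fun _ => zero_le) ?_
  filter_upwards [self_mem_nhdsWithin] with v hv
  refine levyProkhorovEDist_map_restrict_le ρ (measurableSet_active v) (measurableSet_activeLeft u)
    (by fun_prop) (by fun_prop) _ (fun p _ => (edist_tsub_tsub_le _ _ _).trans (le_max_right _ _))
    ((measure_mono ?_).trans (le_max_left _ _)) ((measure_mono ?_).trans (le_max_left _ _))
  · rintro p ⟨⟨ha, hb⟩, hc⟩
    exact ⟨ha.trans (le_of_lt hv), Or.inr ⟨hb, lt_of_not_ge fun h => hc ⟨lt_of_le_of_lt ha hv, h⟩⟩⟩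
  · rintro p ⟨⟨ha, hb⟩, hc⟩
    exact ⟨ha.le, Or.inl ⟨lt_of_not_ge fun h => hc ⟨h, lt_of_lt_of_le hv hb⟩, ha⟩⟩

end Residual

section Records

variable (μ ν m : Measure ℝ≥0)

/-- (Arrival, departure) times of jobs initially present with sizes `μ`, or arriving according to
`m` with sizes `ν`. -/
noncomputable def records : Measure (ℝ≥0 × ℝ≥0) :=
  μ.map (fun r => (0, r)) + (m.prod ν).map fun p => (p.1, p.1 + p.2)

variable [SFinite ν]

theorem records_apply (u : ℝ≥0) {E : Set ℝ≥0} (hE : MeasurableSet E) :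
    records μ ν m {p | p.1 ≤ u ∧ p.2 ∈ E} = μ E + ∫⁻ v in Iic u, ν {r | v + r ∈ E} ∂m := by
  have hS : MeasurableSet {p : ℝ≥0 × ℝ≥0 | p.1 ≤ u ∧ p.2 ∈ E} :=
    (measurableSet_le measurable_fst measurable_const).inter (measurable_snd hE)
  have h2 : Measurable fun p : ℝ≥0 × ℝ≥0 => (p.1, p.1 + p.2) := by fun_prop
  rw [records, Measure.add_apply, Measure.map_apply (by fun_prop) hS, Measure.map_apply h2 hS,
    Measure.prod_apply (h2 hS), ← lintegral_indicator measurableSet_Iic]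
  congr 1
  · congr 1
    ext r
    simp
  · refine lintegral_congr fun v => ?_
    by_cases hv : v ∈ Iic u
    · rw [indicator_of_mem hv]
      congr 1
      ext r
      simp only [mem_preimage, mem_ofPred_eq]
      exact ⟨fun h => h.2, fun h => ⟨hv, h⟩⟩
    · rw [indicator_of_notMem hv]
      convert measure_empty (μ := ν)
      ext r
      simp only [mem_preimage, mem_ofPred_eq, mem_empty_iff_false, iff_false]
      exact fun h => hv h.1

theorem residual_records_Ioi (u y : ℝ≥0) : residual (records μ ν m) u (Ioi y) =
    μ (Ioi (y + u)) + ∫⁻ v in Iic u, ν (Ioi (y + (u - v))) ∂m := by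
  rw [residual_Ioi]
  refine (records_apply μ ν m u (measurableSet_Ioi (a := y + u))).trans ?_
  congr 1
  refine setLIntegral_congr_fun measurableSet_Iic fun v hv => ?_
  have : {r | v + r ∈ Ioi (y + u)} = Ioi (y + (u - v)) := by
    ext r
    simp only [mem_ofPred_eq, mem_Ioi]
    rw [← add_tsub_assoc_of_le hv, tsub_lt_iff_left (le_add_left hv)]
  rw [this]

theorem records_fst_ne_top [IsFiniteMeasure μ] [IsFiniteMeasure ν] {u : ℝ≥0} (hm : m (Iic u) ≠ ∞) :
    records μ ν m {p | p.1 ≤ u} ≠ ∞ := by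
  have h := records_apply μ ν m u MeasurableSet.univ
  simp only [mem_univ, and_true, ofPred_true] at h
  rw [h, setLIntegral_const]
  finiteness

end Records

theorem measure_ext_of_tails {n n' : Measure ℝ≥0} [IsFiniteMeasure n] (h0 : n {0} = 0)
    (h0' : n' {0} = 0) (h : ∀ y, n (Ioi y) = n' (Ioi y)) : n = n' := by
  have huniv : n univ = n' univ := by rw [measure_univ_eq_of_zero h0, measure_univ_eq_of_zero h0', h]
  have hfin' : IsFiniteMeasure n' := ⟨by rw [← huniv]; exact measure_lt_top n univ⟩
  refine Measure.ext_of_Iic _ _ fun a => ?_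
  rw [← compl_Ioi, measure_compl measurableSet_Ioi (measure_ne_top _ _),
    measure_compl measurableSet_Ioi (measure_ne_top _ _), huniv, h]

theorem finMeas_ext_of_tails {n n' : FinMeas} (h0 : (n : Measure ℝ≥0) {0} = 0)
    (h0' : (n' : Measure ℝ≥0) {0} = 0)
    (h : ∀ y, (n : Measure ℝ≥0) (Ioi y) = (n' : Measure ℝ≥0) (Ioi y)) : n = n' :=
  Subtype.ext (measure_ext_of_tails (n := (n : Measure ℝ≥0)) (n' := (n' : Measure ℝ≥0)) h0 h0' h)

/-! ### Positivity of the mass and invertibility of the time change. -/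

/-- An integrable solution of the renewal equation carries no work. -/
theorem RenewalSolution.tail_eq_zero_of_integrable {K Λ : ℝ≥0} {n₁ n₂ G : Measure ℝ≥0}
    {x : ℝ≥0 → ℝ≥0} [IsProbabilityMeasure n₁] [IsProbabilityMeasure n₂]
    (h : RenewalSolution K Λ n₁ n₂ G x) (hx : ∫⁻ s, x s ∂lebesgue ≠ ∞) :
    ∫⁻ s, G (Ioi s) ∂lebesgue = 0 := by
  have hxm := h.measurable
  obtain ⟨N, hN⟩ : ∃ N : Measure ℝ≥0, N = n₁ + n₂ := ⟨_, rfl⟩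
  have hNf : IsFiniteMeasure N := by rw [hN]; infer_instance
  have hNfin : N univ ≠ ∞ := measure_ne_top _ _
  have hxn : ∀ f : ℝ≥0 → ℝ≥0∞, Measurable f → Measurable fun s => (x s : ℝ≥0∞) * f s :=
    fun f hf => hxm.coe_nnreal_ennreal.mul hf
  -- The conservation law bounds the work by a convolution of x with the tails of N = n₁ + n₂. If x
  -- is integrable, this vanishes as U → ∞ by dominated convergence.
  have hle : ∀ U : ℝ≥0, ∫⁻ s in Iic U, G (Ioi s) ∂lebesgue ≤
      ∫⁻ s, (Iic U).indicator (fun s => x s * N (Ioi (U - s))) s ∂lebesgue := by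
    intro U
    have hNm : Measurable fun s => N (Ioi (U - s)) :=
      (measurable_tail N).comp (f := fun s => U - s) (by fun_prop)
    rw [lintegral_indicator measurableSet_Iic, ← lintegral_Iic_reflect U
      (f := fun s => x s * N (Ioi (U - s))) (hxn _ hNm), ← h.conservation U,
      ← lintegral_add_left
        (f := fun s => ((x (U - s) - K : ℝ≥0) : ℝ≥0∞) * n₁ (Ioi s))
        (Measurable.mul (by fun_prop) (measurable_tail n₁))]
    refine setLIntegral_mono' measurableSet_Iic fun s hs => ?_
    rw [tsub_tsub_cancel_of_le hs, hN, Measure.add_apply, mul_add]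
    gcongr
    · exact tsub_le_self
    · exact min_le_left _ _
  have h1 : Tendsto (fun k : ℕ => ∫⁻ s, (Iic (k : ℝ≥0)).indicator
      (fun s => x s * N (Ioi ((k : ℝ≥0) - s))) s ∂lebesgue) atTop (𝓝 (∫⁻ _, 0 ∂lebesgue)) := by
    refine tendsto_lintegral_of_dominated_convergence (fun s => x s * N univ) (fun k => ?_)
      (fun k => Eventually.of_forall fun s => ?_) ?_ (Eventually.of_forall fun s => ?_)
    · have hNm : Measurable fun s => N (Ioi ((k : ℝ≥0) - s)) :=
        (measurable_tail N).comp (f := fun s => (k : ℝ≥0) - s) (by fun_prop)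
      exact (hxn _ hNm).indicator measurableSet_Iic
    · refine (indicator_le_self _ _ _).trans ?_
      exact mul_le_mul_right (measure_mono (subset_univ _)) _
    · rw [lintegral_mul_const _ (by fun_prop)]
      exact ENNReal.mul_ne_top hx hNfin
    · have ht : Tendsto (fun k : ℕ => N (Ioi ((k : ℝ≥0) - s))) atTop (𝓝 (N ∅)) := by
        refine tendsto_measure_of_tendsto_indicator_of_isFiniteMeasure _ N
          (fun _ => measurableSet_Ioi) fun r => ?_
        obtain ⟨k₀, hk₀⟩ := exists_nat_ge (r + s)
        filter_upwards [eventually_ge_atTop k₀] with k hk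
        simp only [mem_Ioi, mem_empty_iff_false, iff_false, not_lt]
        exact le_tsub_of_add_le_right (hk₀.trans (by exact_mod_cast hk))
      rw [measure_empty] at ht
      have ht2 := ENNReal.Tendsto.const_mul (a := (x s : ℝ≥0∞)) ht (Or.inr ENNReal.coe_ne_top)
      rw [mul_zero] at ht2
      exact tendsto_of_tendsto_of_tendsto_of_le_of_le tendsto_const_nhds ht2
        (fun _ => zero_le) fun k => indicator_le_self _ _ _
  rw [lintegral_zero] at h1
  have h2 : Tendsto (fun k : ℕ => ∫⁻ s in Iic (k : ℝ≥0), G (Ioi s) ∂lebesgue) atTop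
      (𝓝 (∫⁻ s, G (Ioi s) ∂lebesgue)) :=
    (tendsto_lintegral_Iic (measurable_tail G)).comp tendsto_natCast_atTop_atTop
  exact le_antisymm (le_of_tendsto_of_tendsto' h2 h1 fun k => hle k) zero_le

namespace ClockInput

variable {K lam : ℝ≥0} {ν : ProbabilityMeasure ℝ≥0} {ξ μ : FinMeas} {x : ℝ≥0 → ℝ≥0}
  {m : Measure ℝ≥0} {T : ℝ≥0 → ℝ≥0}

theorem measure_Iic_ne_top (h : ClockInput K lam ν ξ μ x m T) (u : ℝ≥0) : m (Iic u) ≠ ∞ :=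
  ne_top_of_le_ne_top (by finiteness) (le_self_add.trans (h.balance u).le)

theorem time_add (h : ClockInput K lam ν ξ μ x m T) {u v : ℝ≥0} (huv : u ≤ v) :
    (T v : ℝ≥0∞) = T u + ∫⁻ r in Ioc u v, (min (x r) K : ℝ≥0) ∂lebesgue := by
  rw [h.time, h.time, ← Iic_union_Ioc_eq_Iic huv, lintegral_union measurableSet_Ioc]
  exact Set.disjoint_left.2 fun a (ha : a ∈ Iic u) (hb : a ∈ Ioc u v) => not_lt.2 ha hb.1

theorem monotone_time (h : ClockInput K lam ν ξ μ x m T) : Monotone T := fun u v huv => by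
  rw [← ENNReal.coe_le_coe, h.time_add huv]
  exact le_self_add

theorem time_zero (h : ClockInput K lam ν ξ μ x m T) : T 0 = 0 := by
  rw [← ENNReal.coe_inj, h.time, Measure.restrict_eq_zero.2 (by rw [lebesgue_Iic, ENNReal.coe_zero]),
    lintegral_zero_measure, ENNReal.coe_zero]

theorem le_initial (h : ClockInput K lam ν ξ μ x m T) (u : ℝ≥0) : x u ≤ x 0 + lam * T u := by
  have := h.growth 0 u zero_le
  rwa [h.time_zero, tsub_zero] at this

theorem continuous_time (h : ClockInput K lam ν ξ μ x m T) : Continuous T := by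
  refine (LipschitzWith.of_dist_le_mul (K := K) fun u v => ?_).continuous
  wlog huv : u ≤ v generalizing u v
  · rw [dist_comm, dist_comm u]
    exact this v u (le_of_not_ge huv)
  have h1 : T v ≤ T u + K * (v - u) := by
    rw [← ENNReal.coe_le_coe, h.time_add huv, ENNReal.coe_add]
    gcongr
    refine (setLIntegral_mono (g := fun _ => (K : ℝ≥0∞)) measurable_const
      fun r _ => ENNReal.coe_le_coe.2 (min_le_right _ _)).trans ?_
    rw [setLIntegral_const, lebesgue_Ioc, ENNReal.coe_mul]
  have h2 := h.monotone_time huv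
  rw [← NNReal.coe_le_coe] at h1 h2
  rw [NNReal.coe_add, NNReal.coe_mul, NNReal.coe_sub huv] at h1
  rw [dist_comm, NNReal.dist_eq, abs_of_nonneg (sub_nonneg.2 h2), dist_comm, NNReal.dist_eq,
    abs_of_nonneg (sub_nonneg.2 (by exact_mod_cast huv))]
  linarith

/-- Once empty, the system stays empty. -/
theorem eq_zero_of_eq_zero (h : ClockInput K lam ν ξ μ x m T) {u : ℝ≥0} (hu : x u = 0) (v : ℝ≥0)
    (huv : u ≤ v) : x v = 0 := by
  have hxm := h.measurable
  -- After u the growth bound becomes x(u+s) ≤ λ ∫₀ˢ x(u+r) dr, a convolution inequality with kernel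
  -- λ·Lebesgue.
  obtain ⟨α, hα, hL⟩ := exists_laplace_le (n := lam • lebesgue) (ε := 2⁻¹) (by simp) (by
    rw [lintegral_smul_measure]
    exact ENNReal.mul_ne_top ENNReal.coe_ne_top lintegral_exp_neg_lebesgue_ne_top) (by simp)
  have key := eq_zero_of_le_convolution (zero_le_one.trans hα) hL (d := fun s => x (u + s))
    (U := v - u) (C := x 0 + lam * T v) (fun s hs => ?_) (fun s _ => ?_) (v - u) le_rfl
  · rw [add_tsub_cancel_of_le huv] at key
    exact_mod_cast key
  · refine ENNReal.coe_le_coe.2 ((h.le_initial _).trans ?_)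
    gcongr
    refine h.monotone_time ?_
    calc u + s ≤ u + (v - u) := by gcongr
      _ = v := add_tsub_cancel_of_le huv
  · have h1 : x (u + s) ≤ lam * (T (u + s) - T u) := by
      have := h.growth u (u + s) le_self_add
      rwa [hu, zero_add] at this
    have h2 : ((T (u + s) - T u : ℝ≥0) : ℝ≥0∞) ≤ ∫⁻ r in Iic s, x (u + r) ∂lebesgue := by
      have e := lintegral_Icc_translate (f := fun r => (x (u + r) : ℝ≥0∞)) (by fun_prop) (v := u) (U := u + s)
      rw [add_tsub_cancel_left] at e
      rw [← e]
      have h3 : ((T (u + s) - T u : ℝ≥0) : ℝ≥0∞) =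
          ∫⁻ r in Ioc u (u + s), (min (x r) K : ℝ≥0) ∂lebesgue := by
        rw [ENNReal.coe_sub, h.time_add (le_self_add (a := u) (b := s)),
          ENNReal.add_sub_cancel_left ENNReal.coe_ne_top]
      rw [h3]
      refine (setLIntegral_mono' (g := fun r => (x (u + (r - u)) : ℝ≥0∞)) measurableSet_Ioc
        fun r hr => ?_).trans (lintegral_mono_set Ioc_subset_Icc_self)
      rw [add_tsub_cancel_of_le hr.1.le]
      exact ENNReal.coe_le_coe.2 (min_le_left _ _)
    have h4 := lintegral_Iic_reflect s (f := fun r => (x (u + r) : ℝ≥0∞)) (by fun_prop)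
    calc (x (u + s) : ℝ≥0∞) ≤ (lam * (T (u + s) - T u) : ℝ≥0) := ENNReal.coe_le_coe.2 h1
      _ ≤ lam * ∫⁻ r in Iic s, x (u + (s - r)) ∂lebesgue := by
        rw [h4, ENNReal.coe_mul]; gcongr
      _ = _ := by
        rw [Measure.restrict_smul, lintegral_smul_measure]; rfl

section Clock

variable (h : ClockInput K lam ν ξ μ x m T)

/-- The server measures, as functions of the clock. -/
noncomputable def server (h : ClockInput K lam ν ξ μ x m T) (u : ℝ≥0) : FinMeas :=
  ⟨residual (records μ ν m) u,
    isFiniteMeasure_residual (fun v => records_fst_ne_top _ _ _ (h.measure_Iic_ne_top v)) u⟩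

theorem server_Ioi (u y : ℝ≥0) : (h.server u : Measure ℝ≥0) (Ioi y) =
    (μ : Measure ℝ≥0) (Ioi (y + u)) +
      ∫⁻ v in Iic u, (ν : Measure ℝ≥0) (Ioi (y + (u - v))) ∂m :=
  residual_records_Ioi _ _ _ _ _

theorem server_zero (u : ℝ≥0) : (h.server u : Measure ℝ≥0) {0} = 0 := residual_zero _ _

theorem server_univ (u : ℝ≥0) : (h.server u : Measure ℝ≥0) univ = (min (x u) K : ℝ≥0) := by
  rw [← h.served u]
  have h1 := measure_add_measure_compl (μ := (h.server u : Measure ℝ≥0))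
    (measurableSet_singleton (0 : ℝ≥0))
  rw [h.server_zero, zero_add] at h1
  have h2 : ({0}ᶜ : Set ℝ≥0) = Ioi 0 := by
    ext r
    simp [pos_iff_ne_zero]
  rw [← h1, h2, h.server_Ioi]
  simp only [zero_add]

theorem clockSolution [SFinite m] (hload : (lam : ℝ≥0∞) * meanSize ν = 1)
    (hν : (ν : Measure ℝ≥0) {0} = 0) (hv : IsValid K ν ξ μ) :
    ClockSolution K lam ν (ξ + μ) x h.server := by
  refine clockSolution_of hload hν hv h.measurable h.time h.balance (fun y u => h.server_Ioi u y)
    (fun u => ?_) h.growth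
  rw [h.server_Ioi, ← h.served u]
  simp only [zero_add]

variable [SFinite m] (hK : 0 < K) (hload : (lam : ℝ≥0∞) * meanSize ν = 1)
  (hν : (ν : Measure ℝ≥0) {0} = 0) (hv : IsValid K ν ξ μ) (hw : firstMoment (ξ + μ) ≠ 0)
include h hload hν hv hw

theorem lintegral_eq_top : ∫⁻ s, x s ∂lebesgue = ∞ := by
  by_contra hfin
  have := isProbabilityMeasure_equilibrium hload
  have h1 := (h.clockSolution hload hν hv).renewal.tail_eq_zero_of_integrable hfin
  rw [lintegral_tail] at h1
  exact hw h1

/-- A zero would be absorbing and make x integrable, contradicting `lintegral_eq_top`. -/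
theorem mass_ne_zero (u : ℝ≥0) : x u ≠ 0 := fun hu => by
  have hxm := h.measurable
  have h1 := h.lintegral_eq_top hload hν hv hw
  rw [← lintegral_add_compl _ (measurableSet_Iic (a := u))] at h1
  have h2 : ∫⁻ s in (Iic u)ᶜ, (x s : ℝ≥0∞) ∂lebesgue = 0 := by
    rw [compl_Iic, setLIntegral_congr_fun (g := fun _ => 0) measurableSet_Ioi fun s hs => by
      simp only [h.eq_zero_of_eq_zero hu s (le_of_lt hs), ENNReal.coe_zero], lintegral_zero]
  rw [h2, add_zero] at h1
  have h3 : ∫⁻ s in Iic u, (x s : ℝ≥0∞) ∂lebesgue ≤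
      ∫⁻ s in Iic u, (x 0 + lam * T u : ℝ≥0) ∂lebesgue := by
    refine setLIntegral_mono measurable_const fun s hs => ENNReal.coe_le_coe.2
      ((h.le_initial s).trans ?_)
    have := h.monotone_time hs
    gcongr
  rw [h1, setLIntegral_const, lebesgue_Iic, top_le_iff] at h3
  exact ENNReal.mul_ne_top ENNReal.coe_ne_top ENNReal.coe_ne_top h3

include hK

/-- If real time stayed below c, then x would be bounded, hence at most a constant times x∧K, whose
integral is at most c. This again contradicts `lintegral_eq_top`. -/
theorem exists_le_time (c : ℝ≥0) : ∃ u, c ≤ T u := by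
  by_contra! hc
  have hxm := h.measurable
  refine (lt_top_iff_ne_top.1 ?_) (h.lintegral_eq_top hload hν hv hw)
  have h1 : ∫⁻ s, (min (x s) K : ℝ≥0) ∂lebesgue ≤ c := by
    refine le_of_tendsto' ((tendsto_lintegral_Iic (by fun_prop)).comp
      tendsto_natCast_atTop_atTop) fun k : ℕ => ?_
    exact (h.time k).symm.le.trans (ENNReal.coe_le_coe.2 (hc _).le)
  have h2 : ∀ s, x s ≤ (1 + (x 0 + lam * c) / K) * min (x s) K := fun s => by
    rcases le_total (x s) K with hs | hs
    · rw [min_eq_left hs]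
      exact le_mul_of_one_le_left zero_le le_self_add
    · rw [min_eq_right hs, add_mul, div_mul_cancel₀ _ hK.ne']
      refine le_add_left ((h.le_initial s).trans ?_)
      have := (hc s).le
      gcongr
  calc ∫⁻ s, (x s : ℝ≥0∞) ∂lebesgue
      ≤ ∫⁻ s, (1 + (x 0 + lam * c) / K : ℝ≥0) * (min (x s) K : ℝ≥0) ∂lebesgue :=
        lintegral_mono fun s => by
          rw [← ENNReal.coe_mul]; exact ENNReal.coe_le_coe.2 (h2 s)
    _ = (1 + (x 0 + lam * c) / K : ℝ≥0) * ∫⁻ s, (min (x s) K : ℝ≥0) ∂lebesgue :=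
        lintegral_const_mul _ (by fun_prop)
    _ < ∞ := ENNReal.mul_lt_top ENNReal.coe_lt_top (h1.trans_lt ENNReal.coe_lt_top)

theorem exists_time_orderIso : ∃ τ : ℝ≥0 ≃o ℝ≥0, ∀ u, τ u = T u := by
  have hxm := h.measurable
  have hmono : StrictMono T := fun u v huv => by
    rw [← ENNReal.coe_lt_coe, h.time_add huv.le]
    refine ENNReal.lt_add_right ENNReal.coe_ne_top ?_
    rw [← pos_iff_ne_zero, setLIntegral_pos_iff (by fun_prop)]
    have hs : (Function.support fun r => ((min (x r) K : ℝ≥0) : ℝ≥0∞)) = univ := by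
      ext r
      have hr := pos_iff_ne_zero.2 (h.mass_ne_zero hload hν hv hw r)
      simpa only [Function.mem_support, mem_univ, iff_true, ENNReal.coe_ne_zero] using
        (lt_min hr hK).ne'
    rw [hs, univ_inter, lebesgue_Ioc]
    exact_mod_cast tsub_pos_of_lt huv
  have hsurj : Function.Surjective T := fun c => by
    obtain ⟨u, hu⟩ := h.exists_le_time hK hload hν hv hw c
    obtain ⟨r, -, hr⟩ := intermediate_value_Icc (zero_le (a := u)) h.continuous_time.continuousOn
      ⟨by rw [h.time_zero]; exact zero_le, hu⟩
    exact ⟨r, hr⟩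
  exact ⟨hmono.orderIsoOfSurjective _ hsurj, fun _ => rfl⟩

end Clock

end ClockInput

/-! ### Verification of the constructed trajectory in real time. -/

theorem tendsto_ofMeasure_of_tails {ι : Type*} {l : Filter ι} {m : ι → FinMeas} {n : FinMeas}
    (hm : ∀ i, (m i : Measure ℝ≥0) {0} = 0) (hn : (n : Measure ℝ≥0) {0} = 0)
    (h : ∀ y, Tendsto (fun i => (m i : Measure ℝ≥0) (Ioi y)) l (𝓝 ((n : Measure ℝ≥0) (Ioi y)))) :
    Tendsto (fun i => (LevyProkhorov.ofMeasure (m i) : LevyProkhorov FinMeas)) l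
      (𝓝 (LevyProkhorov.ofMeasure n)) := by
  rw [tendsto_iff_edist_tendsto_0]
  exact tendsto_levyProkhorovEDist_of_tails hm hn h

theorem smul_probability_apply (c : ℝ≥0) (ν : ProbabilityMeasure ℝ≥0) (E : Set ℝ≥0) :
    ((c • ν.toFiniteMeasure : FinMeas) : Measure ℝ≥0) E = c * (ν : Measure ℝ≥0) E := by
  rw [FiniteMeasure.toMeasure_smul]
  rfl

theorem continuous_ofMeasure_smul {ν : ProbabilityMeasure ℝ≥0} (hν : (ν : Measure ℝ≥0) {0} = 0) :
    Continuous fun c : ℝ≥0 =>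
      (LevyProkhorov.ofMeasure (c • ν.toFiniteMeasure) : LevyProkhorov FinMeas) := by
  refine continuous_iff_continuousAt.2 fun c => tendsto_ofMeasure_of_tails
    (fun c => ?_) ?_ fun y => ?_
  · rw [smul_probability_apply, hν, mul_zero]
  · rw [smul_probability_apply, hν, mul_zero]
  · simp_rw [smul_probability_apply]
    exact ENNReal.Tendsto.mul_const ((ENNReal.continuous_coe.tendsto c))
      (Or.inr (measure_ne_top _ _))

theorem smul_probability_coe (c : ℝ≥0) (ν : ProbabilityMeasure ℝ≥0) (E : Set ℝ≥0) :
    (c • ν.toFiniteMeasure : FinMeas) E = c * ν E := by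
  rw [← ENNReal.coe_inj, FiniteMeasure.ennreal_coeFn_eq_coeFn_toMeasure, smul_probability_apply,
    ENNReal.coe_mul, ProbabilityMeasure.ennreal_coeFn_eq_coeFn_toMeasure]

theorem orderIso_zero (σ : ℝ≥0 ≃o ℝ≥0) : σ 0 = 0 :=
  le_antisymm ((σ.monotone zero_le).trans (σ.apply_symm_apply 0).le) zero_le

theorem tendsto_orderIso_right (σ : ℝ≥0 ≃o ℝ≥0) (t : ℝ≥0) : Tendsto σ (𝓝[≥] t) (𝓝[≥] (σ t)) :=
  tendsto_nhdsWithin_iff.2 ⟨(σ.continuous.tendsto t).mono_left nhdsWithin_le_nhds, by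
    filter_upwards [self_mem_nhdsWithin] with s hs using σ.monotone hs⟩

theorem tendsto_orderIso_left (σ : ℝ≥0 ≃o ℝ≥0) (t : ℝ≥0) : Tendsto σ (𝓝[<] t) (𝓝[<] (σ t)) :=
  tendsto_nhdsWithin_iff.2 ⟨(σ.continuous.tendsto t).mono_left nhdsWithin_le_nhds, by
    filter_upwards [self_mem_nhdsWithin] with s hs using σ.strictMono hs⟩

namespace ClockInput

variable {K lam : ℝ≥0} {ν : ProbabilityMeasure ℝ≥0} {ξ μ : FinMeas} {x : ℝ≥0 → ℝ≥0}
  {m : Measure ℝ≥0} {T : ℝ≥0 → ℝ≥0} (h : ClockInput K lam ν ξ μ x m T)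

/-- The trajectory in real time, `σ` being the clock. -/
noncomputable def trajectory (h : ClockInput K lam ν ξ μ x m T) (σ : ℝ≥0 ≃o ℝ≥0) (t : ℝ≥0) :
    State :=
  State.mk ((x (σ t) - K) • ν.toFiniteMeasure) (h.server (σ t))

-- The excess is a continuous function minus a distribution function, so its one-sided limits come
-- from monotonicity.
include h in
theorem coe_excess (u : ℝ≥0) : ((x u - K : ℝ≥0) : ℝ) = lam * T u + ξ.mass - m.real (Iic u) := by
  have h1 := h.balance u
  rw [← ENNReal.coe_toNNReal (h.measure_Iic_ne_top u)] at h1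
  have h2 : (m (Iic u)).toNNReal + (x u - K) = lam * T u + ξ.mass := by exact_mod_cast h1
  have h3 := congrArg ((↑) : ℝ≥0 → ℝ) h2
  rw [NNReal.coe_add, NNReal.coe_add, NNReal.coe_mul] at h3
  rw [← h3, measureReal_def]
  exact (add_sub_cancel_left _ _).symm

include h in
theorem excess_zero : x 0 - K = ξ.mass := by
  rw [← NNReal.coe_inj, h.coe_excess, h.time_zero, NNReal.coe_zero, mul_zero, zero_add,
    (isInput_cdf h.measure_Iic_ne_top h.zero).zero, sub_zero]

include h in
theorem excess_right (u : ℝ≥0) : ContinuousWithinAt (fun u => x u - K) (Ici u) u := by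
  refine NNReal.tendsto_coe.1 ?_
  simp_rw [h.coe_excess]
  have h1 : Continuous fun u => (lam : ℝ) * T u + ξ.mass := by
    have := h.continuous_time
    fun_prop
  exact h1.continuousWithinAt.sub ((isInput_cdf h.measure_Iic_ne_top h.zero).right_continuous u)

include h in
theorem excess_left (u : ℝ≥0) : ∃ l, Tendsto (fun u => x u - K) (𝓝[<] u) (𝓝 l) := by
  have h1 : Continuous fun u => (lam : ℝ) * T u + ξ.mass := by
    have := h.continuous_time
    fun_prop
  have h2 := (isInput_cdf h.measure_Iic_ne_top h.zero).mono.tendsto_leftLim u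
  have h3 := ((h1.tendsto u).mono_left nhdsWithin_le_nhds).sub h2
  refine ⟨Real.toNNReal _, ((continuous_real_toNNReal.tendsto _).comp h3).congr fun v => ?_⟩
  rw [Function.comp_apply, ← h.coe_excess, Real.toNNReal_coe]

theorem server_right (u : ℝ≥0) : Tendsto (fun v => (LevyProkhorov.ofMeasure (h.server v) :
    LevyProkhorov FinMeas)) (𝓝[≥] u) (𝓝 (LevyProkhorov.ofMeasure (h.server u))) := by
  rw [tendsto_iff_edist_tendsto_0]
  exact tendsto_residual_right (fun v => records_fst_ne_top _ _ _ (h.measure_Iic_ne_top v)) u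

theorem server_left (u : ℝ≥0) : ∃ l, Tendsto (fun v => (LevyProkhorov.ofMeasure (h.server v) :
    LevyProkhorov FinMeas)) (𝓝[<] u) (𝓝 l) := by
  have hf := fun v => records_fst_ne_top (μ : Measure ℝ≥0) (ν : Measure ℝ≥0) m
    (h.measure_Iic_ne_top v)
  refine ⟨LevyProkhorov.ofMeasure ⟨residualLeft (records μ ν m) u,
    isFiniteMeasure_residualLeft hf u⟩, ?_⟩
  rw [tendsto_iff_edist_tendsto_0]
  exact tendsto_residual_left hf u

section Verification

variable {σ : ℝ≥0 ≃o ℝ≥0}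

theorem isCadlag_trajectory (hν : (ν : Measure ℝ≥0) {0} = 0) : IsCadlag (h.trajectory σ) := by
  refine ⟨fun t => ?_, fun t _ => ?_⟩
  · refine Tendsto.prodMk_nhds ?_ ((h.server_right (σ t)).comp (tendsto_orderIso_right σ t))
    exact ((continuous_ofMeasure_smul hν).tendsto (x (σ t) - K)).comp
      ((h.excess_right (σ t)).tendsto.comp (tendsto_orderIso_right σ t))
  · obtain ⟨l₁, h₁⟩ := h.excess_left (σ t)
    obtain ⟨l₂, h₂⟩ := h.server_left (σ t)
    exact ⟨_, Tendsto.prodMk_nhds (((continuous_ofMeasure_smul hν).tendsto l₁).comp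
      (h₁.comp (tendsto_orderIso_left σ t))) (h₂.comp (tendsto_orderIso_left σ t))⟩

theorem Q_trajectory (t : ℝ≥0) : Q (h.trajectory σ) t = x (σ t) - K :=
  mass_smul_probability _ _

theorem Z_trajectory (t : ℝ≥0) : Z (h.trajectory σ) t = min (x (σ t)) K := by
  rw [← ENNReal.coe_inj, ← h.server_univ]
  exact FiniteMeasure.ennreal_mass

theorem X_trajectory (t : ℝ≥0) : X (h.trajectory σ) t = x (σ t) := by
  rw [X, Q_trajectory, Z_trajectory, tsub_add_min_self]

variable (hσ : ∀ t, T (σ t) = t) (hpos : ∀ u, x u ≠ 0) (hK : 0 < K)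
include hσ

theorem B_trajectory (t : ℝ≥0) : B lam (h.trajectory σ) t = m.real (Iic (σ t)) - ξ.mass := by
  rw [B, Q_trajectory, h.coe_excess, hσ]
  ring

theorem monotone_B_trajectory : Monotone (B lam (h.trajectory σ)) := fun s t hst => by
  rw [B_trajectory h hσ, B_trajectory h hσ]
  have := (isInput_cdf h.measure_Iic_ne_top h.zero).mono (σ.monotone hst)
  exact sub_le_sub_right this _

/-- Identifies dB in real time with the preimage of m under the clock; the server equation is then
transported by σ. -/
theorem inflow_trajectory_Iic (hB : Monotone (B lam (h.trajectory σ))) (t : ℝ≥0) :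
    hB.stieltjesFunction.measure (Iic t) = m (Iic (σ t)) := by
  have h0 : hB.stieltjesFunction.measure {0} = 0 := by
    have := hB.stieltjesFunction.measure_botSet
    rwa [botSet_eq_singleton_of_isBot (x := (0 : ℝ≥0)) (fun _ => zero_le)] at this
  have heq : ∀ t, hB.stieltjesFunction t = B lam (h.trajectory σ) t := fun t => by
    rw [hB.stieltjesFunction_eq]
    refine hB.continuousWithinAt_Ioi_iff_rightLim_eq.1 (continuousWithinAt_Ioi_iff_Ici.2 ?_)
    have h1 := ((isInput_cdf h.measure_Iic_ne_top h.zero).right_continuous (σ t)).tendsto.comp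
      (tendsto_orderIso_right σ t)
    refine (h1.sub_const (ξ.mass : ℝ)).congr' ?_ |>.trans (le_of_eq ?_)
    · exact Eventually.of_forall fun s => (B_trajectory h hσ s).symm
    · rw [B_trajectory h hσ]
  rw [measure_Iic_of_zero h0, StieltjesFunction.measure_Ioc, heq, heq, B_trajectory h hσ,
    B_trajectory h hσ, orderIso_zero σ, (isInput_cdf h.measure_Iic_ne_top h.zero).zero, zero_sub,
    sub_neg_eq_add, sub_add_cancel, measureReal_def, ENNReal.ofReal_toReal (h.measure_Iic_ne_top _)]

include hpos hK

theorem S_trajectory_zero (t : ℝ≥0) : S (h.trajectory σ) 0 t = σ t := by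
  have hxm := h.measurable
  have hT : ∀ u, (σ.symm u : ℝ≥0∞) = ∫⁻ v in Iic u, (min (x v) K : ℝ≥0) ∂lebesgue := fun u => by
    rw [← h.time, ← hσ (σ.symm u), σ.apply_symm_apply]
  have h1 := lintegral_Iic_comp_orderIso σ.symm (f := fun v => ((min (x v) K : ℝ≥0) : ℝ≥0∞))
    (by fun_prop) hT (g := fun r => ((min (x (σ r)) K : ℝ≥0) : ℝ≥0∞)⁻¹)
    (by have := σ.continuous.measurable; fun_prop) (σ t)
  rw [σ.symm_apply_apply] at h1
  rw [S, lintegral_Ioc_zero (measure_singleton 0)]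
  simp_rw [Z_trajectory]
  rw [← h1, ← lebesgue_Iic, ← setLIntegral_one]
  refine lintegral_congr fun r => ?_
  rw [σ.apply_symm_apply, ENNReal.mul_inv_cancel _ ENNReal.coe_ne_top]
  exact_mod_cast (lt_min (pos_iff_ne_zero.2 (hpos r)) hK).ne'

theorem S_trajectory {s t : ℝ≥0} (hst : s ≤ t) :
    S (h.trajectory σ) s t = (σ t - σ s : ℝ≥0) := by
  have h1 := S_add (h.trajectory σ) (zero_le (a := s)) hst
  rw [S_trajectory_zero h hσ hpos hK, S_trajectory_zero h hσ hpos hK] at h1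
  rw [ENNReal.coe_sub, ← h1, ENNReal.add_sub_cancel_left ENNReal.coe_ne_top]

theorem isFluidSolution_trajectory (hν : (ν : Measure ℝ≥0) {0} = 0) (hv : IsValid K ν ξ μ) :
    IsFluidSolution K lam ν ξ μ (h.trajectory σ) where
  cadlag := h.isCadlag_trajectory hν
  init := by
    have h0 : h.server 0 = μ := by
      refine finMeas_ext_of_tails (h.server_zero 0) ?_ fun y => ?_
      · rw [← FiniteMeasure.ennreal_coeFn_eq_coeFn_toMeasure, hv.server_zero, ENNReal.coe_zero]
      · refine (h.server_Ioi 0 y).trans ?_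
        have : m.restrict (Iic 0) = 0 := by
          rw [Measure.restrict_eq_zero]
          convert h.zero
          ext a
          simp
        rw [this, lintegral_zero_measure, add_zero, add_zero]
    rw [trajectory, orderIso_zero σ, h.excess_zero, ← hv.eq_smul, h0]
  server_zero t := by
    have := h.server_zero (σ t)
    rw [← FiniteMeasure.ennreal_coeFn_eq_coeFn_toMeasure] at this
    exact_mod_cast this
  buffer_dynamics t y := by
    have h1 : (ξ (Ioi y) : ℝ) = ξ.mass * ν (Ioi y) := by
      conv_lhs => rw [hv.eq_smul, smul_probability_coe, NNReal.coe_mul]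
    have h2 : ((h.trajectory σ t).buffer (Ioi y) : ℝ) = (x (σ t) - K : ℝ≥0) * ν (Ioi y) := by
      rw [← NNReal.coe_mul, ← smul_probability_coe]
      rfl
    rw [h1, h2, Q_trajectory, Q_trajectory, orderIso_zero σ, h.excess_zero]
    ring
  mono := monotone_B_trajectory h hσ
  server_dynamics t y := by
    have hin := inflow_trajectory_Iic h hσ (monotone_B_trajectory h hσ)
    set n := (monotone_B_trajectory h hσ).stieltjesFunction.measure with hn
    have hmap : (n.restrict (Iic t)).map σ = m.restrict (Iic (σ t)) := by
      have hfin : IsFiniteMeasure (m.restrict (Iic (σ t))) := ⟨by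
        rw [Measure.restrict_apply_univ]
        exact (h.measure_Iic_ne_top _).lt_top⟩
      refine (Measure.ext_of_Iic _ _ fun a => ?_).symm
      rw [Measure.map_apply σ.continuous.measurable measurableSet_Iic,
        Measure.restrict_apply measurableSet_Iic,
        Measure.restrict_apply (σ.continuous.measurable measurableSet_Iic)]
      have : σ ⁻¹' Iic a ∩ Iic t = Iic (min (σ.symm a) t) := by
        ext s
        simp [OrderIso.le_symm_apply]
      rw [this, hin, Iic_inter_Iic, σ.map_inf, σ.apply_symm_apply]
    have hI : ∫⁻ s in Iic t, (ν : Measure ℝ≥0) (shiftedTail y (S (h.trajectory σ) s t)) ∂n =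
        ∫⁻ v in Iic (σ t), (ν : Measure ℝ≥0) (Ioi (y + (σ t - v))) ∂m := by
      rw [← hmap, lintegral_map (f := fun v => (ν : Measure ℝ≥0) (Ioi (y + (σ t - v))))
        ((measurable_tail _).comp (f := fun v : ℝ≥0 => y + (σ t - v)) (by fun_prop))
        σ.continuous.measurable]
      refine setLIntegral_congr_fun measurableSet_Iic fun s hs => ?_
      change tailAt ν (y + S (h.trajectory σ) s t) = _
      rw [S_trajectory h hσ hpos hK hs, ← ENNReal.coe_add, tailAt_coe]
    rw [hI, S_trajectory_zero h hσ hpos hK]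
    change _ = tailAt μ (y + σ t) + _
    rw [← ENNReal.coe_add, tailAt_coe]
    exact h.server_Ioi (σ t) y
  policy_buffer t := by rw [Q_trajectory, X_trajectory]
  policy_server t := by rw [Z_trajectory, X_trajectory]

end Verification

end ClockInput

/-- Existence for a positive workload. -/
theorem exists_isFluidSolution {K lam : ℝ≥0} (hK : 0 < K) {ν : ProbabilityMeasure ℝ≥0}
    (hload : (lam : ℝ≥0∞) * meanSize ν = 1) (hν : (ν : Measure ℝ≥0) {0} = 0) {ξ μ : FinMeas}
    (hv : IsValid K ν ξ μ) (hw : firstMoment (ξ + μ) ≠ 0) :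
    ∃ Ψ, IsFluidSolution K lam ν ξ μ Ψ := by
  obtain ⟨x, m, T, hm, h⟩ := exists_clockInput (lam := lam) hK hν hv
  obtain ⟨τ, hτ⟩ := h.exists_time_orderIso hK hload hν hv hw
  exact ⟨h.trajectory τ.symm, h.isFluidSolution_trajectory (fun t => by
    rw [← hτ, τ.apply_symm_apply]) (h.mass_ne_zero hload hν hv hw) hK hν hv⟩

/-! ### Uniqueness, and the case of no work. -/

/-- The renewal equation has at most one solution. -/
theorem RenewalSolution.unique {K Λ : ℝ≥0} {n₁ n₂ G : Measure ℝ≥0} [IsFiniteMeasure n₁]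
    [IsFiniteMeasure n₂] (h₁ : n₁ {0} = 0) (h₂ : n₂ {0} = 0) {x x' : ℝ≥0 → ℝ≥0}
    (h : RenewalSolution K Λ n₁ n₂ G x) (h' : RenewalSolution K Λ n₁ n₂ G x') : x = x' := by
  obtain ⟨α, hα, hL⟩ := exists_laplace_le (n := n₁ + n₂) (ε := 2⁻¹) (by simp [h₁, h₂])
    (ne_top_of_le_ne_top (measure_ne_top _ _) (lintegral_exp_neg_le _)) (by simp)
  -- This is |x - x'|. Both nonlinearities are 1-Lipschitz, so d is at most its convolution with n₁
  -- + n₂. Without an atom at 0, this measure has a small Laplace transform for large α despite its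
  -- mass 2.
  set d : ℝ≥0 → ℝ≥0 := fun u => max (x u - x' u) (x' u - x u) with hd
  have hmeas : ∀ {y : ℝ≥0 → ℝ≥0}, Measurable y → ∀ u, Measurable fun v => (y (u - v) : ℝ≥0∞) :=
    fun hy u => (hy.comp (f := fun v : ℝ≥0 => u - v) (by fun_prop)).coe_nnreal_ennreal
  have hdm : Measurable d := by
    have := h.measurable
    have := h'.measurable
    fun_prop
  have key : ∀ {y y' : ℝ≥0 → ℝ≥0}, RenewalSolution K Λ n₁ n₂ G y → RenewalSolution K Λ n₁ n₂ G y' →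
      (∀ u, y u ≤ y' u + d u) → ∀ u, (y u : ℝ≥0∞) ≤ y' u +
        ∫⁻ v in Iic u, (d (u - v) : ℝ≥0∞) ∂(n₁ + n₂) := by
    intro y y' hy hy' hle u
    have hy'm := hy'.measurable
    rw [hy.renewal, hy'.renewal, Measure.restrict_add, lintegral_add_measure]
    have e1 : ∫⁻ v in Iic u, (y (u - v) - K : ℝ≥0) ∂n₁ ≤ ∫⁻ v in Iic u, (y' (u - v) - K : ℝ≥0) ∂n₁ +
        ∫⁻ v in Iic u, (d (u - v) : ℝ≥0∞) ∂n₁ := by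
      rw [← lintegral_add_right _ (hmeas hdm u)]
      refine lintegral_mono fun v => ?_
      rw [← ENNReal.coe_add]
      refine ENNReal.coe_le_coe.2 (tsub_le_iff_left.2 ((hle _).trans ?_))
      rw [← add_assoc]
      gcongr
      exact le_add_tsub
    have e2 : ∫⁻ v in Iic u, (min (y (u - v)) K : ℝ≥0) ∂n₂ ≤
        ∫⁻ v in Iic u, (min (y' (u - v)) K : ℝ≥0) ∂n₂ +
        ∫⁻ v in Iic u, (d (u - v) : ℝ≥0∞) ∂n₂ := by
      rw [← lintegral_add_right _ (hmeas hdm u)]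
      refine lintegral_mono fun v => ?_
      rw [← ENNReal.coe_add]
      refine ENNReal.coe_le_coe.2 ?_
      rw [min_add]
      exact min_le_min (hle _) le_self_add
    calc _ ≤ G (Ioi u) + (∫⁻ v in Iic u, (y' (u - v) - K : ℝ≥0) ∂n₁ +
          ∫⁻ v in Iic u, (d (u - v) : ℝ≥0∞) ∂n₁) + (∫⁻ v in Iic u, (min (y' (u - v)) K : ℝ≥0) ∂n₂ +
          ∫⁻ v in Iic u, (d (u - v) : ℝ≥0∞) ∂n₂) := by gcongr
      _ = _ := by ring
  have k1 := key h h' fun u => by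
    rw [← tsub_le_iff_left]; exact le_max_left _ _
  have k2 := key h' h fun u => by
    rw [← tsub_le_iff_left]; exact le_max_right _ _
  have hzero : ∀ u, (d u : ℝ≥0∞) = 0 := fun u =>
    eq_zero_of_le_convolution (zero_le_one.trans hα) hL (d := fun u => (d u : ℝ≥0∞)) (U := u)
      (C := max (x 0 + Λ * u) (x' 0 + Λ * u)) (fun s hs => ENNReal.coe_le_coe.2 (max_le_max
        (tsub_le_self.trans ((h.growth 0 s zero_le).trans ?_))
        (tsub_le_self.trans ((h'.growth 0 s zero_le).trans ?_)))) (fun s _ => ?_) u le_rfl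
  · funext u
    have h0 : max (x u - x' u) (x' u - x u) = 0 := by exact_mod_cast hzero u
    have h3 := (le_max_left (x u - x' u) (x' u - x u)).trans h0.le
    have h4 := (le_max_right (x u - x' u) (x' u - x u)).trans h0.le
    exact le_antisymm (tsub_eq_zero_iff_le.1 (le_antisymm h3 zero_le))
      (tsub_eq_zero_iff_le.1 (le_antisymm h4 zero_le))
  · rw [tsub_zero]; gcongr
  · rw [tsub_zero]; gcongr
  · simp only [hd]
    rw [ENNReal.coe_max]
    refine max_le ?_ ?_
    · rw [ENNReal.coe_sub, tsub_le_iff_left]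
      exact k1 s
    · rw [ENNReal.coe_sub, tsub_le_iff_left]
      exact k2 s

theorem State.ext {s s' : State} (h₁ : s.buffer = s'.buffer) (h₂ : s.server = s'.server) :
    s = s' := by
  obtain ⟨⟨a⟩, ⟨b⟩⟩ := s
  obtain ⟨⟨a'⟩, ⟨b'⟩⟩ := s'
  change a = a' at h₁
  change b = b' at h₂
  rw [h₁, h₂]

namespace IsFluidSolution

variable {K lam : ℝ≥0} {ν : ProbabilityMeasure ℝ≥0} {ξ μ : FinMeas} {Ψ Ψ' : ℝ≥0 → State}

theorem buffer_eq (h : IsFluidSolution K lam ν ξ μ Ψ) (hv : IsValid K ν ξ μ)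
    (hν : (ν : Measure ℝ≥0) {0} = 0) (t : ℝ≥0) :
    (Ψ t).buffer = Q Ψ t • ν.toFiniteMeasure := by
  have htail : ∀ y, ((Ψ t).buffer : Measure ℝ≥0) (Ioi y) =
      ((Q Ψ t • ν.toFiniteMeasure : FinMeas) : Measure ℝ≥0) (Ioi y) := by
    intro y
    have h1 : (ξ (Ioi y) : ℝ) = ξ.mass * ν (Ioi y) := by
      conv_lhs => rw [hv.eq_smul, smul_probability_coe, NNReal.coe_mul]
    have h2 := h.buffer_dynamics t y
    have h3 : Q Ψ 0 = ξ.mass := by rw [Q, h.init_buffer]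
    rw [h1, h3, ← add_mul, add_sub_cancel, ← NNReal.coe_mul, NNReal.coe_inj,
      ← smul_probability_coe] at h2
    rw [← FiniteMeasure.ennreal_coeFn_eq_coeFn_toMeasure, h2,
      FiniteMeasure.ennreal_coeFn_eq_coeFn_toMeasure]
  have hν1 : (ν : Measure ℝ≥0) (Ioi 0) = 1 := by
    rw [← measure_univ_eq_of_zero hν, measure_univ]
  refine finMeas_ext_of_tails ?_ ?_ htail
  · have h4 := measure_add_measure_compl (μ := ((Ψ t).buffer : Measure ℝ≥0))
      (measurableSet_singleton (0 : ℝ≥0))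
    have h5 : ({0}ᶜ : Set ℝ≥0) = Ioi 0 := by
      ext r
      simp [pos_iff_ne_zero]
    rw [h5, htail, smul_probability_apply, hν1, mul_one, ← FiniteMeasure.ennreal_mass] at h4
    change _ + (Q Ψ t : ℝ≥0∞) = (Q Ψ t : ℝ≥0∞) at h4
    exact (ENNReal.add_left_inj ENNReal.coe_ne_top).1 (h4.trans (zero_add _).symm)
  · rw [smul_probability_apply, hν, mul_zero]

theorem server_measure_zero (h : IsFluidSolution K lam ν ξ μ Ψ) (t : ℝ≥0) :
    ((Ψ t).server : Measure ℝ≥0) {0} = 0 := by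
  rw [← FiniteMeasure.ennreal_coeFn_eq_coeFn_toMeasure, h.server_zero, ENNReal.coe_zero]

/-- In clock time the renewal equation determines x. Then x determines the inverse clock as ∫ (x∧K),
the profile identity gives the server, and the policy gives the buffer. -/
theorem eq_of_workload_ne_zero (h : IsFluidSolution K lam ν ξ μ Ψ)
    (h' : IsFluidSolution K lam ν ξ μ Ψ') (hK : 0 < K)
    (hload : (lam : ℝ≥0∞) * meanSize ν = 1) (hmean : meanSize ν < ∞)
    (hν : (ν : Measure ℝ≥0) {0} = 0) (hv : IsValid K ν ξ μ)
    (hw : firstMoment (ξ + μ) ≠ 0) (hwfin : firstMoment (ξ + μ) ≠ ∞) : Ψ = Ψ' := by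
  obtain ⟨σ, -, hT, hc⟩ := h.exists_clockSolution hK hload hmean hν hv hw hwfin
  obtain ⟨σ', -, hT', hc'⟩ := h'.exists_clockSolution hK hload hmean hν hv hw hwfin
  have hx := hc.renewal.unique hν (equilibrium_countable (countable_singleton 0)) hc'.renewal
  have hx' : ∀ u, X Ψ (σ.symm u) = X Ψ' (σ'.symm u) := fun u => congrFun hx u
  have hσ : ∀ u, σ.symm u = σ'.symm u := fun u => by
    rw [← ENNReal.coe_inj, hT, hT']
    simp_rw [hx']
  funext t
  obtain ⟨u, rfl⟩ := σ.symm.surjective t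
  have hX : X Ψ (σ.symm u) = X Ψ' (σ.symm u) := by rw [hx', hσ]
  refine State.ext ?_ (finMeas_ext_of_tails (h.server_measure_zero _)
    (h'.server_measure_zero _) fun y => ?_)
  · rw [h.buffer_eq hv hν, h'.buffer_eq hv hν, h.policy_buffer, h'.policy_buffer, hX]
  · have p1 := hc.profile y u
    have p2 := hc'.profile y u
    simp_rw [hx'] at p1
    rw [← p2, ← hσ] at p1
    exact (ENNReal.add_left_inj (ENNReal.mul_ne_top ENNReal.coe_ne_top (measure_ne_top _ _))).1 p1

theorem eq_zero_of_workload_eq_zero (h : IsFluidSolution K lam ν ξ μ Ψ) (hK : 0 < K)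
    (hload : (lam : ℝ≥0∞) * meanSize ν = 1) (hv : IsValid K ν ξ μ)
    (hw : firstMoment (ξ + μ) = 0) (t : ℝ≥0) : Ψ t = State.mk 0 0 := by
  obtain ⟨hZ, hQ⟩ := h.mass_eq_zero hK hload hv hw t
  exact State.ext (FiniteMeasure.mass_zero_iff _ |>.1 hQ) (FiniteMeasure.mass_zero_iff _ |>.1 hZ)

end IsFluidSolution

theorem IsValid.eq_zero {K : ℝ≥0} {ν : ProbabilityMeasure ℝ≥0} {ξ μ : FinMeas}
    (hv : IsValid K ν ξ μ) (hmean0 : meanSize ν ≠ 0) (hw : firstMoment (ξ + μ) = 0) :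
    ξ = 0 ∧ μ = 0 := by
  rw [hv.firstMoment_add, add_eq_zero, mul_eq_zero, or_iff_left hmean0] at hw
  refine ⟨FiniteMeasure.mass_zero_iff _ |>.1 (by exact_mod_cast hw.2), ?_⟩
  have h1 := hw.1
  rw [firstMoment, lintegral_eq_zero_iff (by fun_prop)] at h1
  have h2 : (μ : Measure ℝ≥0) {0}ᶜ = 0 := by
    refine measure_mono_null (fun r hr => ?_) (ae_iff.1 h1)
    simpa using hr
  have h3 : (μ : Measure ℝ≥0) {0} = 0 := by
    rw [← FiniteMeasure.ennreal_coeFn_eq_coeFn_toMeasure, hv.server_zero, ENNReal.coe_zero]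
  have h4 := measure_add_measure_compl (μ := (μ : Measure ℝ≥0)) (measurableSet_singleton (0 : ℝ≥0))
  rw [h2, h3, add_zero, ← FiniteMeasure.ennreal_mass] at h4
  exact FiniteMeasure.mass_zero_iff _ |>.1 (by exact_mod_cast h4.symm)

/-- With Z = 0 the clock is infinite on every nontrivial interval, so arrivals leave at once. Only s
= t could contribute to the server equation, and dB = λ ds has no atom. -/
theorem isFluidSolution_zero {K lam : ℝ≥0} {ν : ProbabilityMeasure ℝ≥0} :
    IsFluidSolution K lam ν 0 0 fun _ => State.mk 0 0 := by
  have hQ : ∀ t, Q (fun _ => State.mk 0 0) t = 0 := fun t => FiniteMeasure.zero_mass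
  have hZ : ∀ t, Z (fun _ => State.mk 0 0) t = 0 := fun t => FiniteMeasure.zero_mass
  have hX : ∀ t, X (fun _ => State.mk 0 0) t = 0 := fun t => by rw [X, hQ, hZ, add_zero]
  have hB : ∀ t, B lam (fun _ => State.mk 0 0) t = lam * t := fun t => by
    rw [B, hQ, NNReal.coe_zero, sub_zero]
  have hmono : Monotone (B lam fun _ => State.mk 0 0) := fun s t hst => by
    rw [hB, hB]
    have : (s : ℝ) ≤ t := by exact_mod_cast hst
    gcongr
  refine ⟨⟨fun t => continuousWithinAt_const, fun t _ => ⟨_, tendsto_const_nhds⟩⟩, rfl,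
    fun t => rfl, fun t y => ?_, hmono, fun t y => ?_, fun t => ?_, fun t => ?_⟩
  · rw [hQ, hQ, sub_self, zero_mul, add_zero]
    rfl
  · have hS : ∀ s < t, S (fun _ => State.mk 0 0) s t = ∞ := fun s hs => by
      rw [S]
      simp_rw [hZ]
      rw [ENNReal.coe_zero, ENNReal.inv_zero, setLIntegral_const, lebesgue_Ioc, ENNReal.top_mul]
      exact_mod_cast (tsub_pos_of_lt hs).ne'
    have hcont : ∀ s, hmono.stieltjesFunction s = lam * s := fun s => by
      rw [hmono.stieltjesFunction_eq, ← hB]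
      refine hmono.continuousWithinAt_Ioi_iff_rightLim_eq.1 (Continuous.continuousWithinAt ?_)
      simp_rw [funext hB]
      fun_prop
    have hat : hmono.stieltjesFunction.measure {t} = 0 := by
      rcases eq_or_ne t 0 with rfl | ht
      · have := hmono.stieltjesFunction.measure_botSet
        rwa [botSet_eq_singleton_of_isBot (x := (0 : ℝ≥0)) (fun _ => zero_le)] at this
      · have hle : ∀ s < t, hmono.stieltjesFunction.measure {t} ≤
            ENNReal.ofReal (lam * t - lam * s) := fun s hs => by
          rw [← hcont, ← hcont, ← StieltjesFunction.measure_Ioc]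
          exact measure_mono (singleton_subset_iff.2 ⟨hs, le_rfl⟩)
        have hlim : Tendsto (fun s : ℝ≥0 => ENNReal.ofReal (lam * t - lam * s)) (𝓝[<] t) (𝓝 0) := by
          have : Continuous fun s : ℝ≥0 => ENNReal.ofReal (lam * t - lam * s) :=
            ENNReal.continuous_ofReal.comp (by fun_prop)
          exact (this.tendsto' t 0 (by simp)).mono_left nhdsWithin_le_nhds
        have : (𝓝[<] t).NeBot := nhdsLT_neBot_of_exists_lt ⟨0, pos_iff_ne_zero.2 ht⟩
        exact le_antisymm (ge_of_tendsto hlim (by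
          filter_upwards [self_mem_nhdsWithin] with s hs using hle s hs)) zero_le
    have h0 : ∫⁻ s in Iic t, (ν : Measure ℝ≥0) (shiftedTail y (S (fun _ => State.mk 0 0) s t))
        ∂hmono.stieltjesFunction.measure = 0 := by
      have hae : (fun s => (ν : Measure ℝ≥0) (shiftedTail y (S (fun _ => State.mk 0 0) s t)))
          =ᵐ[hmono.stieltjesFunction.measure.restrict (Iic t)] fun _ => 0 := by
        rw [EventuallyEq, ae_restrict_iff' measurableSet_Iic]
        have hne : ∀ᵐ s ∂hmono.stieltjesFunction.measure, s ≠ t := by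
          rw [ae_iff]
          simpa using hat
        filter_upwards [hne] with s hs hst
        rw [hS s (lt_of_le_of_ne hst hs), shiftedTail]
        simp
      rw [lintegral_congr_ae hae, lintegral_zero]
    rw [h0, add_zero]
    rfl
  · rw [hQ, hX, zero_tsub]
  · rw [hZ, hX, zero_min]

theorem existsUnique_isFluidSolution {K lam : ℝ≥0} (hK : 0 < K) {ν : ProbabilityMeasure ℝ≥0}
    (hload : (lam : ℝ≥0∞) * meanSize ν = 1) (hmean : meanSize ν < ∞)
    (hν : (ν : Measure ℝ≥0) {0} = 0) {ξ μ : FinMeas} (hv : IsValid K ν ξ μ)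
    (hwfin : firstMoment (ξ + μ) ≠ ∞) : ∃! Ψ, IsFluidSolution K lam ν ξ μ Ψ := by
  rcases eq_or_ne (firstMoment (ξ + μ)) 0 with hw | hw
  · have hmean0 : meanSize ν ≠ 0 := fun h0 => by simp [h0] at hload
    refine ⟨fun _ => State.mk 0 0, ?_, fun Ψ h => funext fun t =>
      h.eq_zero_of_workload_eq_zero hK hload hv hw t⟩
    obtain ⟨rfl, rfl⟩ := hv.eq_zero hmean0 hw
    exact isFluidSolution_zero
  · obtain ⟨Ψ, h⟩ := exists_isFluidSolution hK hload hν hv hw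
    exact ⟨Ψ, h, fun Ψ' h' => h'.eq_of_workload_ne_zero h hK hload hmean hν hv hw hwfin⟩

/-! ### The lifted state: masses, work and continuity. -/

section Lift

variable (K : ℝ≥0) (ν : ProbabilityMeasure ℝ≥0)

/-- The limiting buffer mass for the workload `w`. -/
noncomputable def bufferLimit (w : ℝ≥0) : ℝ≥0 :=
  ((w - K * equilibriumMean ν) / meanSize ν).toNNReal

/-- The limiting server mass for the workload `w`. -/
noncomputable def serverLimit (w : ℝ≥0) : ℝ≥0 :=
  (min (w : ℝ≥0∞) (K * equilibriumMean ν) / equilibriumMean ν).toNNReal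

theorem lift_eq (w : ℝ≥0) : lift K ν w = State.mk (bufferLimit K ν w • ν.toFiniteMeasure)
    (serverLimit K ν w • equilibriumMeasure ν) := rfl

variable {K ν} {lam : ℝ≥0}

theorem meanSize_ne_zero (hload : (lam : ℝ≥0∞) * meanSize ν = 1) : meanSize ν ≠ 0 :=
  fun h0 => by simp [h0] at hload

theorem equilibriumMean_ne_zero (hload : (lam : ℝ≥0∞) * meanSize ν = 1) :
    equilibriumMean ν ≠ 0 := by
  intro h
  rw [equilibriumMean, firstMoment, lintegral_eq_zero_iff (by fun_prop)] at h
  have h1 : (equilibriumMeasure ν : Measure ℝ≥0) {0}ᶜ = 0 := by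
    refine measure_mono_null (fun r hr => ?_) (ae_iff.1 h)
    simpa using hr
  have h2 := measure_add_measure_compl (μ := (equilibriumMeasure ν : Measure ℝ≥0))
    (measurableSet_singleton (0 : ℝ≥0))
  rw [h1, equilibrium_countable (countable_singleton _), add_zero, equilibrium_univ hload] at h2
  exact zero_ne_one h2

theorem coe_bufferLimit (hload : (lam : ℝ≥0∞) * meanSize ν = 1) (w : ℝ≥0) :
    (bufferLimit K ν w : ℝ≥0∞) = (w - K * equilibriumMean ν) / meanSize ν :=
  ENNReal.coe_toNNReal (ENNReal.div_ne_top (by finiteness) (meanSize_ne_zero hload))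

theorem coe_serverLimit (hload : (lam : ℝ≥0∞) * meanSize ν = 1) (w : ℝ≥0) :
    (serverLimit K ν w : ℝ≥0∞) = min (w : ℝ≥0∞) (K * equilibriumMean ν) / equilibriumMean ν :=
  ENNReal.coe_toNNReal (ENNReal.div_ne_top (ne_top_of_le_ne_top ENNReal.coe_ne_top
    (min_le_left _ _)) (equilibriumMean_ne_zero hload))

theorem limits_of_mean_eq_top (hK : 0 < K) (h : equilibriumMean ν = ∞) (w : ℝ≥0) :
    bufferLimit K ν w = 0 ∧ serverLimit K ν w = 0 := by
  rw [bufferLimit, serverLimit, h, ENNReal.mul_top (by exact_mod_cast hK.ne')]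
  simp

theorem serverLimit_le (hload : (lam : ℝ≥0∞) * meanSize ν = 1) (w : ℝ≥0) :
    serverLimit K ν w ≤ K := by
  rw [← ENNReal.coe_le_coe, coe_serverLimit hload]
  exact ENNReal.div_le_of_le_mul (min_le_right _ _)

theorem serverLimit_eq (hK : 0 < K) (hload : (lam : ℝ≥0∞) * meanSize ν = 1) {w : ℝ≥0}
    (hw : bufferLimit K ν w ≠ 0) : serverLimit K ν w = K := by
  have hne : equilibriumMean ν ≠ ∞ := fun h => hw (limits_of_mean_eq_top hK h w).1
  have h1 : K * equilibriumMean ν ≤ w := by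
    by_contra! hlt
    refine hw ?_
    rw [bufferLimit, tsub_eq_zero_of_le hlt.le]
    simp
  rw [← ENNReal.coe_inj, coe_serverLimit hload, min_eq_right h1,
    ENNReal.mul_div_cancel_right (equilibriumMean_ne_zero hload) hne]

/-- The limiting buffer is nonempty only when the limiting server is full. Together with
`limit_min`, this lets both masses be recovered from the limit of the total mass. -/
theorem limit_tsub (hK : 0 < K) (hload : (lam : ℝ≥0∞) * meanSize ν = 1) (w : ℝ≥0) :
    bufferLimit K ν w + serverLimit K ν w - K = bufferLimit K ν w := by
  rcases eq_or_ne (bufferLimit K ν w) 0 with h | h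
  · rw [h, zero_add]
    exact tsub_eq_zero_of_le (serverLimit_le hload w)
  · rw [serverLimit_eq hK hload h, add_tsub_cancel_right]

theorem limit_min (hK : 0 < K) (hload : (lam : ℝ≥0∞) * meanSize ν = 1) (w : ℝ≥0) :
    min (bufferLimit K ν w + serverLimit K ν w) K = serverLimit K ν w := by
  rcases eq_or_ne (bufferLimit K ν w) 0 with h | h
  · rw [h, zero_add]
    exact min_eq_left (serverLimit_le hload w)
  · rw [serverLimit_eq hK hload h]
    exact min_eq_right le_add_self

theorem limit_work (hload : (lam : ℝ≥0∞) * meanSize ν = 1) (hmean : meanSize ν < ∞)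
    (h : equilibriumMean ν ≠ ∞) (w : ℝ≥0) :
    bufferLimit K ν w * meanSize ν + serverLimit K ν w * equilibriumMean ν = w := by
  rw [coe_bufferLimit hload, coe_serverLimit hload,
    ENNReal.div_mul_cancel (meanSize_ne_zero hload) hmean.ne,
    ENNReal.div_mul_cancel (equilibriumMean_ne_zero hload) h]
  rcases le_total (w : ℝ≥0∞) (K * equilibriumMean ν) with h1 | h1
  · rw [tsub_eq_zero_of_le h1, min_eq_left h1, zero_add]
  · rw [min_eq_right h1, tsub_add_cancel_of_le h1]

theorem continuous_bufferLimit (hload : (lam : ℝ≥0∞) * meanSize ν = 1) :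
    Continuous (bufferLimit K ν) := by
  rw [← ENNReal.continuous_coe_iff]
  simp_rw [coe_bufferLimit hload]
  exact (ENNReal.continuous_div_const _ (meanSize_ne_zero hload)).comp
    ((ENNReal.continuous_sub_right _).comp ENNReal.continuous_coe)

theorem continuous_serverLimit (hload : (lam : ℝ≥0∞) * meanSize ν = 1) :
    Continuous (serverLimit K ν) := by
  rw [← ENNReal.continuous_coe_iff]
  simp_rw [coe_serverLimit hload]
  exact (ENNReal.continuous_div_const _ (equilibriumMean_ne_zero hload)).comp
    (ENNReal.continuous_coe.min continuous_const)

theorem smul_equilibrium_apply (c : ℝ≥0) (E : Set ℝ≥0) :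
    ((c • equilibriumMeasure ν : FinMeas) : Measure ℝ≥0) E =
      c * (equilibriumMeasure ν : Measure ℝ≥0) E := by
  rw [FiniteMeasure.toMeasure_smul]
  rfl

/-- Convergence to the lifted state follows from convergence of masses and of tails. -/
theorem tendsto_lift_of_tails {ι : Type*} {l : Filter ι} {q : ι → ℝ≥0} {D : ι → FinMeas}
    (hν : (ν : Measure ℝ≥0) {0} = 0) (hD : ∀ i, (D i : Measure ℝ≥0) {0} = 0) {w : ℝ≥0}
    (hq : Tendsto q l (𝓝 (bufferLimit K ν w)))
    (ht : ∀ y, Tendsto (fun i => (D i : Measure ℝ≥0) (Ioi y)) l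
      (𝓝 (serverLimit K ν w * (equilibriumMeasure ν : Measure ℝ≥0) (Ioi y)))) :
    Tendsto (fun i => State.mk (q i • ν.toFiniteMeasure) (D i)) l (𝓝 (lift K ν w)) := by
  rw [lift_eq]
  refine Tendsto.prodMk_nhds (((continuous_ofMeasure_smul hν).tendsto _).comp hq)
    (tendsto_ofMeasure_of_tails hD ?_ fun y => ?_)
  · rw [smul_equilibrium_apply, equilibrium_countable (countable_singleton _), mul_zero]
  · rw [smul_equilibrium_apply]
    exact ht y

theorem continuous_lift (hload : (lam : ℝ≥0∞) * meanSize ν = 1)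
    (hν : (ν : Measure ℝ≥0) {0} = 0) : Continuous (lift K ν) := by
  refine continuous_iff_continuousAt.2 fun w => ?_
  refine tendsto_lift_of_tails hν (fun v => ?_) ((continuous_bufferLimit hload).tendsto w)
    fun y => ?_
  · exact (smul_equilibrium_apply _ _).trans (by
      rw [equilibrium_countable (countable_singleton _), mul_zero])
  · refine Tendsto.congr (fun v => (smul_equilibrium_apply (serverLimit K ν v) (Ioi y)).symm) ?_
    exact ENNReal.Tendsto.mul_const (ENNReal.tendsto_coe.2 ((continuous_serverLimit hload).tendsto w))
      (Or.inr (measure_ne_top _ _))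

theorem lift_zero : lift K ν 0 = State.mk 0 0 := by
  have h1 : bufferLimit K ν 0 = 0 := by simp [bufferLimit]
  have h2 : serverLimit K ν 0 = 0 := by simp [serverLimit]
  rw [lift_eq, h1, h2, zero_smul, zero_smul]

end Lift

/-! ### Convergence of families of fluid solutions. -/

/-- Convergence of a convolution whose integrand converges. -/
theorem tendsto_lintegral_window {ι : Type*} {L : Filter ι} [L.IsCountablyGenerated]
    {n : Measure ℝ≥0} [IsFiniteMeasure n] {f : ι → ℝ≥0 → ℝ≥0} (hf : ∀ i, Measurable (f i)) {C : ℝ≥0}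
    (hC : ∀ i u, f i u ≤ C) {a : ℝ≥0}
    (ha : Tendsto (fun p : ι × ℝ≥0 => f p.1 p.2) (L ×ˢ atTop) (𝓝 a)) (y : ℝ≥0) :
    Tendsto (fun p : ι × ℝ≥0 => ∫⁻ r in Ioc y (y + p.2), (f p.1 (y + p.2 - r) : ℝ≥0∞) ∂n)
      (L ×ˢ atTop) (𝓝 (a * n (Ioi y))) := by
  have h1 : Tendsto (fun p : ι × ℝ≥0 => ∫⁻ r, (Ioc y (y + p.2)).indicator
      (fun r => (f p.1 (y + p.2 - r) : ℝ≥0∞)) r ∂n) (L ×ˢ atTop)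
      (𝓝 (∫⁻ r, (Ioi y).indicator (fun _ => (a : ℝ≥0∞)) r ∂n)) := by
    refine tendsto_lintegral_filter_of_dominated_convergence (fun _ => (C : ℝ≥0∞))
      (Eventually.of_forall fun p => ?_) (Eventually.of_forall fun p => Eventually.of_forall fun r => ?_)
      ?_ (Eventually.of_forall fun r => ?_)
    · exact (((hf p.1).comp (f := fun r : ℝ≥0 => y + p.2 - r)
        (by fun_prop)).coe_nnreal_ennreal).indicator measurableSet_Ioc
    · exact (indicator_le_self _ _ _).trans (ENNReal.coe_le_coe.2 (hC _ _))
    · rw [lintegral_const]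
      finiteness
    · by_cases hr : r ∈ Ioi y
      · rw [indicator_of_mem hr]
        have hmap : Tendsto (fun p : ι × ℝ≥0 => (p.1, y + p.2 - r)) (L ×ˢ atTop) (L ×ˢ atTop) := by
          refine tendsto_fst.prodMk ?_
          refine (tendsto_atTop.2 fun b => ?_ : Tendsto (fun u : ℝ≥0 => y + u - r) atTop atTop).comp
            tendsto_snd
          filter_upwards [eventually_ge_atTop (b + r)] with u hu
          exact le_tsub_of_add_le_right (hu.trans le_add_self)
        refine (ENNReal.tendsto_coe.2 (ha.comp hmap)).congr' ?_
        have hev : ∀ᶠ p : ι × ℝ≥0 in L ×ˢ atTop, r ≤ p.2 :=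
          tendsto_snd.eventually (eventually_ge_atTop r)
        filter_upwards [hev] with p hp
        rw [indicator_of_mem (show r ∈ Ioc y (y + p.2) from ⟨hr, hp.trans le_add_self⟩)]
        rfl
      · rw [indicator_of_notMem hr]
        refine tendsto_const_nhds.congr fun p => ?_
        rw [indicator_of_notMem fun h => hr h.1]
  rw [lintegral_indicator measurableSet_Ioi, setLIntegral_const] at h1
  refine h1.congr fun p => ?_
  rw [lintegral_indicator measurableSet_Ioc]

section Convergence

variable {ι : Type*} {L : Filter ι} {K lam : ℝ≥0} {ν : ProbabilityMeasure ℝ≥0}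

/-- A lattice is countable and ν_e is absolutely continuous. -/
theorem notLattice_equilibrium (hload : (lam : ℝ≥0∞) * meanSize ν = 1) :
    NotLattice (equilibriumMeasure ν : Measure ℝ≥0) := fun d _ h => by
  have h1 := equilibrium_countable (ν := ν) (countable_range fun k : ℕ => (k : ℝ≥0) * d)
  have h2 := measure_univ_le_add_compl (μ := (equilibriumMeasure ν : Measure ℝ≥0))
    (range fun k : ℕ => (k : ℝ≥0) * d)
  rw [h1, h, add_zero, equilibrium_univ hload] at h2
  exact one_ne_zero (le_antisymm h2 zero_le)

/-- In the profile identity the convolution with ν tends to q ν((y,∞)), exactly the limit of the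
buffer term on the left. Subtracting it leaves the part carried by ν_e. -/
theorem tendsto_profile [L.IsCountablyGenerated] {G : ι → FinMeas} {x : ι → ℝ≥0 → ℝ≥0}
    {D : ι → ℝ≥0 → FinMeas} (hc : ∀ i, ClockSolution K lam ν (G i) (x i) (D i)) {C q z : ℝ≥0}
    (hCx : ∀ i u, x i u ≤ C)
    (hgE : Tendsto (fun p : ι × ℝ≥0 => (G p.1 : Measure ℝ≥0) (Ioi p.2)) (L ×ˢ atTop) (𝓝 0))
    (hq : Tendsto (fun p : ι × ℝ≥0 => x p.1 p.2 - K) (L ×ˢ atTop) (𝓝 q))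
    (hz : Tendsto (fun p : ι × ℝ≥0 => min (x p.1 p.2) K) (L ×ˢ atTop) (𝓝 z)) (y : ℝ≥0) :
    Tendsto (fun p : ι × ℝ≥0 => (D p.1 p.2 : Measure ℝ≥0) (Ioi y)) (L ×ˢ atTop)
      (𝓝 (z * (equilibriumMeasure ν : Measure ℝ≥0) (Ioi y))) := by
  have hg' : Tendsto (fun p : ι × ℝ≥0 => (G p.1 : Measure ℝ≥0) (Ioi (y + p.2))) (L ×ˢ atTop) (𝓝 0) :=
    hgE.comp (tendsto_fst.prodMk (tendsto_atTop_mono (fun _ => le_add_self) tendsto_snd))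
  have h1 := tendsto_lintegral_window (n := (ν : Measure ℝ≥0)) (f := fun i u => x i u - K)
    (fun i => (hc i).renewal.measurable.sub_const K) (fun i u => tsub_le_self.trans (hCx i u)) hq y
  have h2 := tendsto_lintegral_window (n := (equilibriumMeasure ν : Measure ℝ≥0))
    (f := fun i u => min (x i u) K) (fun i => (hc i).renewal.measurable.min measurable_const)
    (fun i u => (min_le_left _ _).trans (hCx i u)) hz y
  have h3 := (hg'.add h1).add h2
  have hqν : Tendsto (fun p : ι × ℝ≥0 => ((x p.1 p.2 - K : ℝ≥0) : ℝ≥0∞) * (ν : Measure ℝ≥0) (Ioi y))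
      (L ×ˢ atTop) (𝓝 (q * (ν : Measure ℝ≥0) (Ioi y))) :=
    ENNReal.Tendsto.mul_const (ENNReal.tendsto_coe.2 hq) (Or.inr (measure_ne_top _ _))
  have hne : (q : ℝ≥0∞) * (ν : Measure ℝ≥0) (Ioi y) ≠ ∞ :=
    ENNReal.mul_ne_top ENNReal.coe_ne_top (measure_ne_top _ _)
  have h4 := ENNReal.Tendsto.sub h3 hqν (Or.inr hne)
  rw [zero_add, ENNReal.add_sub_cancel_left hne] at h4
  refine h4.congr fun p => ?_
  have hp := (hc p.1).profile y p.2
  exact (ENNReal.eq_sub_of_add_eq (ENNReal.mul_ne_top ENNReal.coe_ne_top (measure_ne_top _ _))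
    hp).symm

/-- Joint convergence of a family of fluid solutions whose initial conditions have uniformly small
tails and convergent workloads. -/
theorem tendsto_fluid [NeBot L] [L.IsCountablyGenerated] (hK : 0 < K) (hmean : meanSize ν < ∞)
    (hload : (lam : ℝ≥0∞) * meanSize ν = 1) (hν : (ν : Measure ℝ≥0) {0} = 0)
    (hlat : Nonlattice ν) {ξ μ : ι → FinMeas} {Ψ : ι → ℝ≥0 → State}
    (hv : ∀ i, IsValid K ν (ξ i) (μ i)) (hΨ : ∀ i, IsFluidSolution K lam ν (ξ i) (μ i) (Ψ i))
    (hw0 : ∀ i, firstMoment (ξ i + μ i) ≠ 0) {M : ℝ≥0} (hM : ∀ i, firstMoment (ξ i + μ i) ≤ M)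
    {w : ℝ≥0} (hw : Tendsto (fun i => firstMoment (ξ i + μ i)) L (𝓝 w))
    (hG : Tendsto (fun p : ι × ℝ≥0 => ∫⁻ s in Ioi p.2,
      ((ξ p.1 + μ p.1 : FinMeas) : Measure ℝ≥0) (Ioi s) ∂lebesgue) (L ×ˢ atTop) (𝓝 0)) :
    Tendsto (fun p : ι × ℝ≥0 => Ψ p.1 p.2) (L ×ˢ atTop) (𝓝 (lift K ν w)) := by
  have hfin : ∀ i, firstMoment (ξ i + μ i) ≠ ∞ := fun i =>
    ne_top_of_le_ne_top ENNReal.coe_ne_top (hM i)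
  choose σ hσ hT hc using fun i =>
    (hΨ i).exists_clockSolution hK hload hmean hν (hv i) (hw0 i) (hfin i)
  have hprob := isProbabilityMeasure_equilibrium hload
  set G : ι → Measure ℝ≥0 := fun i => ((ξ i + μ i : FinMeas) : Measure ℝ≥0) with hGdef
  set x : ι → ℝ≥0 → ℝ≥0 := fun i u => X (Ψ i) ((σ i).symm u) with hx
  have hren : ∀ i, RenewalSolution K (lam * K) ν (equilibriumMeasure ν : Measure ℝ≥0) (G i) (x i) :=
    fun i => (hc i).renewal
  have hGm : ∀ i, ∫⁻ s, G i (Ioi s) ∂lebesgue = firstMoment (ξ i + μ i) := fun i => lintegral_tail _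
  have hν1 : (ν : Measure ℝ≥0) (Ioi 0) = 1 := by
    rw [← measure_univ_eq_of_zero hν, measure_univ]
  have hx0 : ∀ i, x i 0 ≤ lam * M + K := fun i => by
    have h1 : x i 0 = (ξ i).mass + (μ i).mass := by
      simp only [hx]
      rw [orderIso_zero, X, Q, Z, (hΨ i).init_buffer, (hΨ i).init_server]
    rw [h1]
    refine add_le_add ?_ ((hv i).server_mass.le.trans (min_le_right _ _))
    have h2 : (ξ i).mass * meanSize ν ≤ M := (le_add_self.trans ((hv i).firstMoment_add).ge).trans (hM i)
    rw [← ENNReal.coe_le_coe, ENNReal.coe_mul]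
    calc ((ξ i).mass : ℝ≥0∞) = lam * ((ξ i).mass * meanSize ν) := by
          rw [mul_left_comm, hload, mul_one]
      _ ≤ lam * M := by gcongr
  -- The bound depends only on the workload bound M and on the initial mass, so it holds for the
  -- whole family.
  obtain ⟨C, hC⟩ := RenewalSolution.exists_bound K (lam * K) M (lam * M + K)
    (n₁ := (ν : Measure ℝ≥0)) (equilibriumMeasure ν : Measure ℝ≥0) (by rw [hν1]; exact one_ne_zero)
  have hCx : ∀ i u, x i u ≤ C := fun i => hC (G i) (x i) (hren i) ((hGm i).le.trans (hM i)) (hx0 i)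
  -- Markov's inequality with the common first moment bound M makes the tails uniformly small.
  have hgE : Tendsto (fun p : ι × ℝ≥0 => G p.1 (Ioi p.2)) (L ×ˢ atTop) (𝓝 0) := by
    have hlim : Tendsto (fun p : ι × ℝ≥0 => (M : ℝ≥0∞) / p.2) (L ×ˢ atTop) (𝓝 0) := by
      have : Tendsto (fun u : ℝ≥0 => (M : ℝ≥0∞) / u) atTop (𝓝 0) := by
        have h1 := ENNReal.Tendsto.const_div (a := (M : ℝ≥0∞)) (ENNReal.tendsto_coe_nhds_top.2
          (tendsto_id (x := atTop (α := ℝ≥0)))) (Or.inr ENNReal.coe_ne_top)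
        rwa [ENNReal.div_top] at h1
      exact this.comp tendsto_snd
    refine tendsto_of_tendsto_of_tendsto_of_le_of_le' tendsto_const_nhds hlim
      (Eventually.of_forall fun _ => zero_le) ?_
    have hev : ∀ᶠ p : ι × ℝ≥0 in L ×ˢ atTop, 0 < p.2 :=
      tendsto_snd.eventually (eventually_gt_atTop 0)
    filter_upwards [hev] with p hp
    refine (measure_mono (Ioi_subset_Ici_self)).trans ?_
    have h1 := meas_ge_le_lintegral_div (μ := G p.1) (f := fun r : ℝ≥0 => (r : ℝ≥0∞)) (by fun_prop)
      (ε := p.2) (by exact_mod_cast hp.ne') ENNReal.coe_ne_top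
    have h2 : {r : ℝ≥0 | (p.2 : ℝ≥0∞) ≤ r} = Ici p.2 := by
      ext r
      simp
    rw [h2] at h1
    exact h1.trans (ENNReal.div_le_div_right (hM p.1) _)
  have hxlim : Tendsto (fun p : ι × ℝ≥0 => x p.1 p.2) (L ×ˢ atTop)
      (𝓝 (bufferLimit K ν w + serverLimit K ν w)) := by
    refine tendsto_renewal hren hlat (notLattice_equilibrium hload) hCx hK ?_ ?_ ?_
      (w := w) ENNReal.coe_ne_top ?_ ?_ hG ?_ ?_
    · rw [lintegral_tail]; exact hmean.ne
    · rw [lintegral_tail]; exact meanSize_ne_zero hload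
    · rw [lintegral_tail]; exact equilibriumMean_ne_zero hload
    · simp_rw [hGm]; exact hw
    · exact (ENNReal.tendsto_toReal ENNReal.zero_ne_top).comp hgE
    · rw [lintegral_tail]
      intro h
      obtain ⟨h1, h2⟩ := limits_of_mean_eq_top hK h w
      rw [h1, h2, add_zero]
    · rw [lintegral_tail, lintegral_tail]
      intro h
      rw [limit_tsub hK hload, limit_min hK hload]
      exact limit_work hload hmean h w
  have hq : Tendsto (fun p : ι × ℝ≥0 => x p.1 p.2 - K) (L ×ˢ atTop) (𝓝 (bufferLimit K ν w)) := by
    have := hxlim.sub (tendsto_const_nhds (x := K))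
    rwa [limit_tsub hK hload] at this
  have hz : Tendsto (fun p : ι × ℝ≥0 => min (x p.1 p.2) K) (L ×ˢ atTop)
      (𝓝 (serverLimit K ν w)) := by
    have := hxlim.min (tendsto_const_nhds (x := K))
    rwa [limit_min hK hload] at this
  have hserver : ∀ y, Tendsto (fun p : ι × ℝ≥0 =>
      ((Ψ p.1 ((σ p.1).symm p.2)).server : Measure ℝ≥0) (Ioi y)) (L ×ˢ atTop)
      (𝓝 (serverLimit K ν w * (equilibriumMeasure ν : Measure ℝ≥0) (Ioi y))) :=
    tendsto_profile hc hCx hgE hq hz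
  have hclock : Tendsto (fun p : ι × ℝ≥0 =>
      State.mk ((x p.1 p.2 - K) • ν.toFiniteMeasure) (Ψ p.1 ((σ p.1).symm p.2)).server)
      (L ×ˢ atTop) (𝓝 (lift K ν w)) :=
    tendsto_lift_of_tails hν (fun p => (hΨ p.1).server_measure_zero _) hq hserver
  -- All clocks satisfy σ(t) ≥ t / K, so limits in clock time transfer to real time uniformly over
  -- the family.
  have hmap : Tendsto (fun p : ι × ℝ≥0 => (p.1, σ p.1 p.2)) (L ×ˢ atTop) (L ×ˢ atTop) := by
    refine tendsto_fst.prodMk (tendsto_atTop.2 fun b => ?_)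
    have hev : ∀ᶠ p : ι × ℝ≥0 in L ×ˢ atTop, b * K ≤ p.2 :=
      tendsto_snd.eventually (eventually_ge_atTop (b * K))
    filter_upwards [hev] with p hp
    rw [← (σ p.1).symm.le_iff_le, (σ p.1).symm_apply_apply]
    refine le_trans ?_ hp
    rw [← ENNReal.coe_le_coe, hT]
    refine (setLIntegral_mono (g := fun _ => (K : ℝ≥0∞)) measurable_const
      fun r _ => ENNReal.coe_le_coe.2 (min_le_right _ _)).trans ?_
    rw [setLIntegral_const, lebesgue_Iic, ENNReal.coe_mul, mul_comm]
  refine (hclock.comp hmap).congr fun p => ?_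
  simp only [Function.comp_apply, hx, (σ p.1).symm_apply_apply]
  refine State.ext ?_ rfl
  rw [← (hΨ p.1).policy_buffer, (hΨ p.1).buffer_eq (hv p.1) hν]
  rfl

end Convergence

theorem tendsto_lintegral_Ioi_zero {f : ℝ≥0 → ℝ≥0∞} (hf : Measurable f)
    (hfin : ∫⁻ s, f s ∂lebesgue ≠ ∞) :
    Tendsto (fun u => ∫⁻ s in Ioi u, f s ∂lebesgue) atTop (𝓝 0) := by
  have h1 := ENNReal.Tendsto.sub (tendsto_const_nhds (x := ∫⁻ s, f s ∂lebesgue))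
    (tendsto_lintegral_Iic hf) (Or.inl hfin)
  rw [tsub_self] at h1
  refine h1.congr fun u => ?_
  rw [← lintegral_add_compl f (measurableSet_Iic (a := u)), compl_Iic]
  exact ENNReal.add_sub_cancel_left (ne_top_of_le_ne_top hfin (setLIntegral_le_lintegral _ _))

/-- Markov bound for the integrated tail. -/
theorem lintegral_Ioi_tail_le (n : FinMeas) {p u : ℝ≥0} (hu : u ≠ 0) :
    ∫⁻ s in Ioi u, (n : Measure ℝ≥0) (Ioi s) ∂lebesgue ≤
      momentOfOrder (1 + p) n / (u : ℝ≥0∞) ^ (p : ℝ) := by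
  have hup : (u : ℝ≥0∞) ^ (p : ℝ) ≠ 0 := by
    simp [ENNReal.rpow_eq_zero_iff, hu]
  have hup' : (u : ℝ≥0∞) ^ (p : ℝ) ≠ ∞ := ENNReal.rpow_ne_top_of_nonneg p.2 ENNReal.coe_ne_top
  calc ∫⁻ s in Ioi u, (n : Measure ℝ≥0) (Ioi s) ∂lebesgue
      ≤ ∫⁻ s in Ioi u, ((n : Measure ℝ≥0).restrict (Ioi u)) (Ioi s) ∂lebesgue := by
        refine setLIntegral_mono' measurableSet_Ioi fun s hs => ?_
        rw [Measure.restrict_apply measurableSet_Ioi,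
          inter_eq_left.2 (Ioi_subset_Ioi (le_of_lt hs))]
    _ ≤ ∫⁻ s, ((n : Measure ℝ≥0).restrict (Ioi u)) (Ioi s) ∂lebesgue :=
        setLIntegral_le_lintegral _ _
    _ = ∫⁻ r in Ioi u, (r : ℝ≥0∞) ∂(n : Measure ℝ≥0) := lintegral_tail _
    _ ≤ ∫⁻ r in Ioi u, (r : ℝ≥0∞) ^ (1 + (p : ℝ)) / (u : ℝ≥0∞) ^ (p : ℝ) ∂(n : Measure ℝ≥0) := by
        refine setLIntegral_mono' measurableSet_Ioi fun r hr => ?_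
        rw [ENNReal.le_div_iff_mul_le (Or.inl hup) (Or.inl hup'),
          ENNReal.rpow_add_of_nonneg (x := (r : ℝ≥0∞)) 1 (p : ℝ) zero_le_one p.2,
          ENNReal.rpow_one]
        gcongr
        exact le_of_lt hr
    _ ≤ ∫⁻ r, (r : ℝ≥0∞) ^ (1 + (p : ℝ)) / (u : ℝ≥0∞) ^ (p : ℝ) ∂(n : Measure ℝ≥0) :=
        setLIntegral_le_lintegral _ _
    _ = _ := by
        simp_rw [div_eq_mul_inv]
        rw [lintegral_mul_const _ (by fun_prop), momentOfOrder]

/-! ### The convergence statements. -/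

section Main

variable {K lam : ℝ≥0} {ν : ProbabilityMeasure ℝ≥0}

theorem IsFluidSolution.tendsto_lift (hK : 0 < K) (hmean : meanSize ν < ∞)
    (hload : (lam : ℝ≥0∞) * meanSize ν = 1) (hν : (ν : Measure ℝ≥0) {0} = 0)
    (hlat : Nonlattice ν) {ξ μ : FinMeas} {Ψ : ℝ≥0 → State} (hv : IsValid K ν ξ μ)
    (hwfin : firstMoment (ξ + μ) ≠ ∞) (hΨ : IsFluidSolution K lam ν ξ μ Ψ) :
    Tendsto Ψ atTop (𝓝 (lift K ν (firstMoment (ξ + μ)).toNNReal)) := by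
  rcases eq_or_ne (firstMoment (ξ + μ)) 0 with hw | hw
  · rw [hw, ENNReal.toNNReal_zero, lift_zero]
    exact tendsto_const_nhds.congr fun t => (hΨ.eq_zero_of_workload_eq_zero hK hload hv hw t).symm
  · have hG := tendsto_lintegral_Ioi_zero (measurable_tail ((ξ + μ : FinMeas) : Measure ℝ≥0))
      (by rw [lintegral_tail]; exact hwfin)
    -- A single solution is a family over one point; a finite first moment already makes its
    -- integrated tail vanish.
    have h := tendsto_fluid (L := (pure () : Filter Unit)) hK hmean hload hν hlat
      (ξ := fun _ => ξ) (μ := fun _ => μ) (Ψ := fun _ => Ψ) (fun _ => hv) (fun _ => hΨ) (fun _ => hw)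
      (M := (firstMoment (ξ + μ)).toNNReal) (fun _ => (ENNReal.coe_toNNReal hwfin).ge)
      (w := (firstMoment (ξ + μ)).toNNReal) (by
        rw [ENNReal.coe_toNNReal hwfin]; exact tendsto_const_nhds) (hG.comp tendsto_snd)
    exact h.comp ((tendsto_const_pure (b := ())).prodMk tendsto_id)

/-- Counterexamples at times tₙ ≥ n have workloads in the compact set [0, M]. Along a convergent
subsequence, `tendsto_fluid` and continuity of the lifting map bring both the states and the lifted
workloads to the same limit, so their distance cannot stay above ε. -/
theorem exists_uniform_time (hK : 0 < K) (hmean : meanSize ν < ∞)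
    (hload : (lam : ℝ≥0∞) * meanSize ν = 1) (hν : (ν : Measure ℝ≥0) {0} = 0)
    (hlat : Nonlattice ν) {p M : ℝ≥0} (hp : 0 < p) {ε : ℝ} (hε : 0 < ε) :
    ∃ T : ℝ≥0, ∀ (ξ μ : FinMeas) (Ψ : ℝ≥0 → State), IsValid K ν ξ μ →
      firstMoment (ξ + μ) < M → momentOfOrder (1 + p) (ξ + μ) < M →
      IsFluidSolution K lam ν ξ μ Ψ → ∀ t, T ≤ t →
        dist (Ψ t) (lift K ν (firstMoment (ξ + μ)).toNNReal) < ε := by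
  by_contra! hbad
  choose ξ μ Ψ hv hm hmp hΨ t ht hdist using fun n : ℕ => hbad (n : ℝ≥0)
  have hfin : ∀ n, firstMoment (ξ n + μ n) ≠ ∞ := fun n => (hm n).ne_top
  -- `tendsto_fluid` needs nonzero workloads; a solution with no work equals its lifted state at all
  -- times and cannot be a counterexample.
  have hw0 : ∀ n, firstMoment (ξ n + μ n) ≠ 0 := fun n hw => by
    have h1 := hdist n
    rw [hw, ENNReal.toNNReal_zero, lift_zero,
      (hΨ n).eq_zero_of_workload_eq_zero hK hload (hv n) hw, dist_self] at h1
    exact absurd hε (not_lt.2 h1)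
  have hIcc : ∀ n, (firstMoment (ξ n + μ n)).toNNReal ∈ Icc 0 M := fun n =>
    ⟨zero_le, by
      rw [← ENNReal.coe_le_coe, ENNReal.coe_toNNReal (hfin n)]
      exact (hm n).le⟩
  obtain ⟨w, -, φ, hφ, hlim⟩ := isCompact_Icc.tendsto_subseq hIcc
  have hG : Tendsto (fun q : ℕ × ℝ≥0 => ∫⁻ s in Ioi q.2,
      ((ξ (φ q.1) + μ (φ q.1) : FinMeas) : Measure ℝ≥0) (Ioi s) ∂lebesgue) (atTop ×ˢ atTop)
      (𝓝 0) := by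
    have h1 : Tendsto (fun u : ℝ≥0 => (M : ℝ≥0∞) / (u : ℝ≥0∞) ^ (p : ℝ)) atTop (𝓝 0) := by
      have h2 := (ENNReal.tendsto_rpow_at_top (y := (p : ℝ)) (by exact_mod_cast hp)).comp
        (ENNReal.tendsto_coe_nhds_top.2 (tendsto_id (x := atTop (α := ℝ≥0))))
      have h3 := ENNReal.Tendsto.const_div (a := (M : ℝ≥0∞)) h2 (Or.inr ENNReal.coe_ne_top)
      rwa [ENNReal.div_top] at h3
    refine tendsto_of_tendsto_of_tendsto_of_le_of_le' tendsto_const_nhds (h1.comp tendsto_snd)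
      (Eventually.of_forall fun _ => zero_le) ?_
    have hev : ∀ᶠ q : ℕ × ℝ≥0 in atTop ×ˢ atTop, 0 < q.2 :=
      tendsto_snd.eventually (eventually_gt_atTop 0)
    filter_upwards [hev] with q hq
    exact (lintegral_Ioi_tail_le _ hq.ne').trans (ENNReal.div_le_div_right (hmp _).le _)
  have hwlim : Tendsto (fun n => firstMoment (ξ (φ n) + μ (φ n))) atTop (𝓝 w) := by
    refine (ENNReal.tendsto_coe.2 hlim).congr fun n => ?_
    exact ENNReal.coe_toNNReal (hfin _)
  have hmain := tendsto_fluid (L := (atTop : Filter ℕ)) hK hmean hload hν hlat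
    (fun n => hv (φ n)) (fun n => hΨ (φ n)) (fun n => hw0 (φ n)) (fun n => (hm (φ n)).le) hwlim hG
  have htime : Tendsto (fun n => (n, t (φ n))) (atTop : Filter ℕ) (atTop ×ˢ atTop) := by
    refine tendsto_id.prodMk (tendsto_atTop_mono (fun n => ?_) tendsto_natCast_atTop_atTop)
    exact le_trans (by exact_mod_cast hφ.id_le n) (ht (φ n))
  have h1 : Tendsto (fun n => Ψ (φ n) (t (φ n))) atTop (𝓝 (lift K ν w)) := hmain.comp htime
  have h2 := ((continuous_lift (K := K) hload hν).tendsto w).comp hlim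
  have h3 := h1.dist h2
  rw [dist_self] at h3
  obtain ⟨n, hn⟩ := (h3.eventually_lt_const hε).exists
  exact absurd hn (not_lt.2 (hdist (φ n)))

end Main

end LPS

theorem theorem3p1 (K lam : ℝ≥0) (hK : 0 < K) (ν : ProbabilityMeasure ℝ≥0)
    (hmean : LPS.meanSize ν < ∞) (hload : (lam : ℝ≥0∞) * LPS.meanSize ν = 1)
    (hzero : ν {0} = 0) (hnonlattice : LPS.Nonlattice ν) :
    (∀ ξ μ : LPS.FinMeas, LPS.IsValid K ν ξ μ → LPS.firstMoment (ξ + μ) < ∞ →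
      (∃! Ψ : ℝ≥0 → LPS.State, LPS.IsFluidSolution K lam ν ξ μ Ψ) ∧
      ∀ Ψ : ℝ≥0 → LPS.State, LPS.IsFluidSolution K lam ν ξ μ Ψ →
        Tendsto Ψ atTop (𝓝 (LPS.lift K ν (LPS.firstMoment (ξ + μ)).toNNReal))) ∧
    (∀ p M : ℝ≥0, 0 < p → 0 < M → ∀ ε : ℝ, 0 < ε → ∃ T : ℝ≥0,
      ∀ (ξ μ : LPS.FinMeas) (Ψ : ℝ≥0 → LPS.State), LPS.IsValid K ν ξ μ →
        LPS.firstMoment (ξ + μ) < M → LPS.momentOfOrder (1 + p) (ξ + μ) < M →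
        LPS.IsFluidSolution K lam ν ξ μ Ψ →
        ∀ t, T ≤ t →
          dist (Ψ t) (LPS.lift K ν (LPS.firstMoment (ξ + μ)).toNNReal) < ε) := by
  have hν : (ν : Measure ℝ≥0) {0} = 0 := by
    rw [← ProbabilityMeasure.ennreal_coeFn_eq_coeFn_toMeasure, hzero, ENNReal.coe_zero]
  exact ⟨fun ξ μ hv hw => ⟨LPS.existsUnique_isFluidSolution hK hload hmean hν hv hw.ne,
    fun Ψ hΨ => hΨ.tendsto_lift hK hmean hload hν hnonlattice hv hw.ne⟩,
    fun p M hp _ ε hε => LPS.exists_uniform_time hK hmean hload hν hnonlattice hp hε⟩
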